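/- **Setting.** A link function with values in a set $S$ of labels (for example $\mathbb Z_+$ or $\mathbb Z_+^2$) is a sequence of maps $L=L_n:\{1,\dots,n\}^2\to S$, $n\ge 1$; it is symmetric if $L(i,j)=L(j,i)$. Given real random variables $(x_s)_{s\in S}$ (the input), the patterned matrix with link function $L$ is $X_n=((x_{L_n(i,j)}))_{1\le i,j\le n}$. * *Property B*: $\sup_n\sup_{t}\sup_{1\le k\le n}\#\{l\le n: L_n(k,l)=t\}<\infty$. * *Growth conditions*: with $k_n=\#\{L_n(i,j):1\le i,j\le n\}$ and $\alpha_n=\max_s\#\{(i,j):L_n(i,j)=s\}$, one has $k_n\to\infty$ and $k_n\alpha_n=O(n^2)$. * A pair-matched word $w$ of length $2k$ is a sequence $w[1]\cdots w[2k]$ of letters in which every letter occurs exactly twice and first occurrences are in alphabetical order. $\Pi_L(w)$ is the set of maps $\pi:\{0,\dots,2k\}\to\{1,\dots,n\}$ with $\pi(0)=\pi(2k)$ such that for all $i,j$: $w[i]=w[j]\iff L_n(\pi(i-1),\pi(i))=L_n(\pi(j-1),\pi(j))$. We say that $p_L(w)$ exists if $\lim_n n^{-(1+k)}\#\Pi_L(w)$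 exists in $\mathbb R$. * Inputs. All inputs consist of independent random variables with mean $0$ and variance $1$. (A1): they are moreover uniformly bounded; (A2): they are moreover identically distributed; (A3): for every $k$ their $k$-th absolute moments are moreover uniformly bounded. * The ESD $F^{A}$ of a symmetric $n\times n$ matrix $A$ is the distribution function of the uniform measure on its eigenvalues. A probability measure $\mu$ on $\mathbb R$ with distribution function $F$ is the LSD of random symmetric matrices $A_n$ almost surely if, outside a null set, $F^{A_n}(t)\to F(t)$ at all continuity points $t$ of $F$; it is the LSD in probability if $F^{A_n}(t)\to F(t)$ in probability at all continuity points $t$ of $F$. **Theorem.** Let $L_X$ be a symmetric link function that satisfies Property B and the growth conditions, and suppose that $p_{L_X}(w)$ exists for every pair-matched word $w$. Then there is a probability measure $\mathcal L_X$ on $\mathbb R$, depending on $L_X$ only, such that the following hold. 1. $\mathcal L_X$ is the LSD of $n^{-1/2}X_n$ almost surely if the input satisfies (A1) or (A3), and in probability if the input satisfies (A1), (A2) or (A3). 2. Let $L_Y$ be a link function that satisfies Property B and the growth conditions and is of the form $L_{Y,n}=\rho_n\circ L_{X,n}$ for some maps $\rho_n$ (which may depend on $n$). If the inputs of $X_n$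 and $Y_n$ are independent of each other, then $\mathcal L_X$ is the LSD of the entrywise products $n^{-1/2}X_n\odot Y_n$: almost surely if each of the two inputs satisfies (A1) or (A3), and in probability if each of them satisfies (A1), (A2) or (A3). **Consequences.** Below, "is the LSD" is meant as in 1 and 2: almost surely for inputs that satisfy (A1) or (A3), in probability for inputs that satisfy (A1), (A2) or (A3), the inputs of the two factors being independent of each other. (a) For the Wigner matrices $W_n$, $L_W(i,j)=(\min\{i,j\},\max\{i,j\})$, the semicircular law with density $\frac1{2\pi}\sqrt{4-t^2}$ on $[-2,2]$ is the LSD of $n^{-1/2}W_n$, and it is the LSD of $n^{-1/2}W_n\odot Y_n$ for every symmetric link function $L_Y$ that satisfies Property B and the growth conditions. (b) For the Toeplitz matrices $T_n$, $L_T(i,j)=|i-j|$, and the symmetric circulant matrices $SC_n$, $L_{SC}(i,j)=\frac n2-\bigl|\frac n2-|i-j|\bigr|$, there is a probability measure $\mathcal L_T$ that is the LSD of $n^{-1/2}T_n$ and the LSD of $n^{-1/2}T_n\odot SC_n$. -/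

import Mathlib

open MeasureTheory ProbabilityTheory Filter Topology Asymptotics Set
open scoped Matrix ENNReal

universe u v w

noncomputable section

/-! ### Spectral distributions -/

/-- The empirical spectral distribution function of a real `n × n` matrix: `t ↦` the proportion of
eigenvalues (roots of the characteristic polynomial, with multiplicity) that are `≤ t`.
It is only used for symmetric matrices, all of whose eigenvalues are real. -/
def esd {n : ℕ} (A : Matrix (Fin n) (Fin n) ℝ) (t : ℝ) : ℝ :=
  (A.charpoly.roots.countP (fun r => r ≤ t) : ℝ) / n

/-- The law `μ` is the almost sure limiting spectral distribution of the random matrices `A n`: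
outside a null set, the empirical spectral distribution functions converge to the distribution
function of `μ` at all continuity points of the latter. -/
def HasLSDAlmostSurely {Ω : Type w} [MeasurableSpace Ω] (P : Measure Ω)
    (A : (n : ℕ) → Ω → Matrix (Fin n) (Fin n) ℝ) (μ : Measure ℝ) : Prop :=
  ∀ᵐ ω ∂P, ∀ t : ℝ, ContinuousAt (fun s => μ.real (Iic s)) t →
    Tendsto (fun n => esd (A n ω) t) atTop (𝓝 (μ.real (Iic t)))

/-- The law `μ` is the limiting spectral distribution in probability of the random matrices
`A n`: at all continuity points of the distribution function of `μ`, the empirical spectral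
distribution functions converge to it in probability. -/
def HasLSDInProbability {Ω : Type w} [MeasurableSpace Ω] (P : Measure Ω)
    (A : (n : ℕ) → Ω → Matrix (Fin n) (Fin n) ℝ) (μ : Measure ℝ) : Prop :=
  ∀ t : ℝ, ContinuousAt (fun s => μ.real (Iic s)) t →
    TendstoInMeasure P (fun n ω => esd (A n ω) t) atTop (fun _ => μ.real (Iic t))

/-! ### Link functions -/

/-- A link function with values in a set `S` of labels: a sequence of maps
`L n : {1, …, n}² → S`. The element `i : Fin n` stands for the row (or column) number `i + 1`. -/
abbrev LinkFunction (S : Type u) : Type u := (n : ℕ) → Fin n → Fin n → S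

/-- The link function is symmetric, so that its patterned matrices are symmetric. -/
def LinkFunction.IsSymmetric {S : Type u} (L : LinkFunction S) : Prop :=
  ∀ (n : ℕ) (i j : Fin n), L n i j = L n j i

/-- Property B: the number of occurrences of a label in a row is uniformly bounded. -/
def LinkFunction.PropertyB {S : Type u} (L : LinkFunction S) : Prop :=
  ∃ Δ : ℕ, ∀ (n : ℕ) (k : Fin n) (t : S), {l : Fin n | L n k l = t}.ncard ≤ Δ

/-- `k_n`, the number of distinct labels in the `n × n` pattern. -/
def LinkFunction.numLabels {S : Type u} (L : LinkFunction S) (n : ℕ) : ℕ :=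
  (range fun p : Fin n × Fin n => L n p.1 p.2).ncard

/-- `α_n`, the maximal number of occurrences of a label in the `n × n` pattern. -/
def LinkFunction.maxMult {S : Type u} (L : LinkFunction S) (n : ℕ) : ℕ :=
  ⨆ s : S, {p : Fin n × Fin n | L n p.1 p.2 = s}.ncard

/-- The conditions `k_n → ∞` and `k_n α_n = O(n²)`. -/
def LinkFunction.GrowthConditions {S : Type u} (L : LinkFunction S) : Prop :=
  Tendsto L.numLabels atTop atTop ∧
    (fun n : ℕ => (L.numLabels n : ℝ) * (L.maxMult n : ℝ)) =O[atTop] (fun n : ℕ => (n : ℝ) ^ 2)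

/-! ### Words and circuits -/

/-- Words of length `h`: the letters are `0, 1, 2, …` and their first occurrences are in
alphabetical order. -/
def IsWord {h : ℕ} (w : Fin h → ℕ) : Prop :=
  ∀ i : Fin h, ∀ a < w i, ∃ j < i, w j = a

/-- Every letter of `w` occurs exactly twice. -/
def IsPairMatched {h : ℕ} (w : Fin h → ℕ) : Prop :=
  ∀ i : Fin h, {j : Fin h | w j = w i}.ncard = 2

/-- The class `Π(w)`: circuits `π : {0, …, h} → {1, …, n}`, `π(0) = π(h)`, whose `L`-values match
at exactly the positions at which the letters of `w` match. -/
def LinkFunction.circuits {S : Type u} (L : LinkFunction S) {h : ℕ} (w : Fin h → ℕ) (n : ℕ) :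
    Set (Fin (h + 1) → Fin n) :=
  {π | π 0 = π (Fin.last h) ∧ ∀ i j : Fin h,
    w i = w j ↔ L n (π i.castSucc) (π i.succ) = L n (π j.castSucc) (π j.succ)}

/-- The limit `p(w) = lim n^{-(1+k)} #Π(w)` exists for every pair-matched word `w` of
length `2k`. -/
def LinkFunction.WordLimitsExist {S : Type u} (L : LinkFunction S) : Prop :=
  ∀ (k : ℕ) (w : Fin (2 * k) → ℕ), IsWord w → IsPairMatched w →
    ∃ p : ℝ, Tendsto (fun n : ℕ => ((L.circuits w n).ncard : ℝ) / (n : ℝ) ^ (k + 1)) atTop (𝓝 p)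

/-! ### Input sequences -/

section Inputs

variable {Ω : Type w} [MeasurableSpace Ω] {S : Type u}

/-- Independent random variables with mean `0` and variance `1`. -/
structure IsStandardInput (P : Measure Ω) (x : S → Ω → ℝ) : Prop where
  measurable : ∀ s, Measurable (x s)
  indep : iIndepFun x P
  memLp : ∀ s, MemLp (x s) 2 P
  mean : ∀ s, ∫ ω, x s ω ∂P = 0
  variance : ∀ s, Var[x s; P] = 1

/-- (A1): independent, uniformly bounded, mean `0`, variance `1`. -/
def AssumptionA1 (P : Measure Ω) (x : S → Ω → ℝ) : Prop :=
  IsStandardInput P x ∧ ∃ B : ℝ, ∀ s, ∀ᵐ ω ∂P, |x s ω| ≤ B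

/-- (A2): i.i.d. with mean `0` and variance `1`. -/
def AssumptionA2 (P : Measure Ω) (x : S → Ω → ℝ) : Prop :=
  IsStandardInput P x ∧ ∀ s t, IdentDistrib (x s) (x t) P P

/-- (A3): independent, mean `0`, variance `1`, uniformly bounded moments of all orders. -/
def AssumptionA3 (P : Measure Ω) (x : S → Ω → ℝ) : Prop :=
  IsStandardInput P x ∧ ∀ k : ℕ, ∃ C : ℝ, ∀ s,
    Integrable (fun ω => |x s ω| ^ k) P ∧ ∫ ω, |x s ω| ^ k ∂P ≤ C

/-- The patterned random matrix `((x_{L(i,j)}))` of size `n`. -/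
def patterned (L : LinkFunction S) (x : S → Ω → ℝ) (n : ℕ) (ω : Ω) : Matrix (Fin n) (Fin n) ℝ :=
  Matrix.of fun i j => x (L n i j) ω

end Inputs

/-- `μ` is the limiting spectral distribution of the patterned matrices `n^{-1/2} X_n` with link
function `L`, whatever the input: almost surely for inputs that satisfy (A1) or (A3), and in
probability for inputs that satisfy (A1), (A2) or (A3). -/
def LinkFunction.IsLSD {S : Type u} (L : LinkFunction S) (μ : Measure ℝ) : Prop :=
  ∀ (Ω : Type w) [MeasurableSpace Ω] (P : Measure Ω) [IsProbabilityMeasure P] (x : S → Ω → ℝ),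
    ((AssumptionA1 P x ∨ AssumptionA3 P x) →
      HasLSDAlmostSurely P (fun n ω => (Real.sqrt n)⁻¹ • patterned L x n ω) μ) ∧
    ((AssumptionA1 P x ∨ AssumptionA2 P x ∨ AssumptionA3 P x) →
      HasLSDInProbability P (fun n ω => (Real.sqrt n)⁻¹ • patterned L x n ω) μ)

/-- `μ` is the limiting spectral distribution of the Schur-Hadamard products
`n^{-1/2} X_n ⊙ Y_n` of patterned matrices with link functions `LX` and `LY` and independent
input sequences: almost surely for inputs that satisfy (A1) or (A3), and in probability for inputs
that satisfy (A1), (A2) or (A3). -/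
def LinkFunction.IsHadamardLSD {S : Type u} {T : Type v} (LX : LinkFunction S)
    (LY : LinkFunction T) (μ : Measure ℝ) : Prop :=
  ∀ (Ω : Type w) [MeasurableSpace Ω] (P : Measure Ω) [IsProbabilityMeasure P]
    (x : S → Ω → ℝ) (y : T → Ω → ℝ),
    IndepFun (fun ω s => x s ω) (fun ω t => y t ω) P →
    ((AssumptionA1 P x ∨ AssumptionA3 P x) → (AssumptionA1 P y ∨ AssumptionA3 P y) →
      HasLSDAlmostSurely P
        (fun n ω => (Real.sqrt n)⁻¹ • (patterned LX x n ω ⊙ patterned LY y n ω)) μ) ∧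
    ((AssumptionA1 P x ∨ AssumptionA2 P x ∨ AssumptionA3 P x) →
      (AssumptionA1 P y ∨ AssumptionA2 P y ∨ AssumptionA3 P y) →
      HasLSDInProbability P
        (fun n ω => (Real.sqrt n)⁻¹ • (patterned LX x n ω ⊙ patterned LY y n ω)) μ)

/-! ### Particular link functions and the semicircular law -/

/-- Wigner: `L(i,j) = (min(i,j), max(i,j))`. -/
def wignerLink : LinkFunction (ℕ × ℕ) := fun _ i j =>
  (min ((i : ℕ) + 1) ((j : ℕ) + 1), max ((i : ℕ) + 1) ((j : ℕ) + 1))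

/-- Toeplitz: `L(i,j) = |i - j|`. -/
def toeplitzLink : LinkFunction ℕ := fun _ i j => ((i : ℤ) - (j : ℤ)).natAbs

/-- Symmetric circulant: `L(i,j) = n/2 - |n/2 - |i - j|| = min(|i - j|, n - |i - j|)`. -/
def symmetricCirculantLink : LinkFunction ℕ := fun n i j =>
  min ((i : ℤ) - (j : ℤ)).natAbs (n - ((i : ℤ) - (j : ℤ)).natAbs)

theorem symmetricCirculantLink_eq (n : ℕ) (i j : Fin n) :
    (symmetricCirculantLink n i j : ℝ)
      = (n : ℝ) / 2 - abs ((n : ℝ) / 2 - abs ((i : ℝ) - (j : ℝ))) := by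
  have hd : ((((i : ℤ) - (j : ℤ)).natAbs : ℕ) : ℝ) = |(i : ℝ) - (j : ℝ)| := by
    rw [Nat.cast_natAbs]; push_cast; rfl
  have hle : ((i : ℤ) - (j : ℤ)).natAbs ≤ n := by omega
  unfold symmetricCirculantLink
  rw [Nat.cast_min, Nat.cast_sub hle, hd]
  generalize |(i : ℝ) - (j : ℝ)| = d
  rcases le_total d ((n : ℝ) / 2) with h | h
  · rw [min_eq_left (by linarith), abs_of_nonneg (by linarith)]; ring
  · rw [min_eq_right (by linarith), abs_of_nonpos (by linarith)]; ring

/-- The standard semicircular law, with density `√(4 - t²) / (2π)` on `[-2, 2]`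
(`Real.sqrt` vanishes at negative numbers). -/
def semicircularLaw : Measure ℝ :=
  volume.withDensity fun t => ENNReal.ofReal (Real.sqrt (4 - t ^ 2) / (2 * Real.pi))

end

/-! ### Spectra of real symmetric matrices -/

/-! The proof is by the method of moments. The normalised trace of the `h`-th power of `n^{-1/2} X ⊙
Y` is a sum over closed walks of length `h`, and the expectation of the product along a walk factors
over its distinct labels. If some `LX`-label of the walk occurs only once, the expectation vanishes.
Otherwise, since `LY` is a function of `LX`, every `LY`-label occurs at least twice too, so there
are at most `h / 2` of them. With exactly `h / 2` of them, both words are pair-matched with the same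
pairs, and the expectation is a product of second moments, that is `1` (`integral_prod_eq_ite`).
Walks with fewer `LY`-labels are negligible. Hence only the pair-matched walks of `LX` survive in
the limit, and neither `LY` nor the laws of the inputs matter.

All counts come from an exploration of circuits vertex by vertex (`numRestrictions_path`): an edge
with a new letter leaves `n` choices for its end, an edge with a known letter at most `Δ`, by
Property B. A letter that occurs once in its circuit and in no circuit explored earlier saves a
factor `n`, because the circuit has to close (`ExplorationBound.insert_saving`). For quadruples of
circuits this gives fourth centred moments of order `n^{-2}` after normalisation
(`card_quadruples_le`, `exists_bound_fourth_moment`), which are summable, so the moments converge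
almost surely.

The limits satisfy `β (2k) ≤ Δ^{2k} (2k)! / k!`, so Taylor expansion of characteristic functions
shows that they determine a law (`HasMomentLimits.tendsto_charFun_sub`), and tightness provides this
law (`exists_momentsDetermine`). Inputs that are only i.i.d. with variance `1` are truncated; the
effect on the spectrum is controlled by the Frobenius norm (`esd_le_esd_add`). The matrix `X` alone
is the product of `X` with a constant input `1`, which is why `HasBoundedMoments` does not ask for
mean zero.

For Wigner matrices the surviving walks are depth first searches of trees. Their asymptotic number
is a number of Dyck paths, which is a moment of the semicircular law. For Toeplitz matrices they
correspond, up to a negligible number, to lattice points in dilated polytopes. -/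

theorem esd_eq_card_eigenvalues {n : ℕ} {A : Matrix (Fin n) (Fin n) ℝ} (hA : A.IsHermitian)
    (t : ℝ) :
    esd A t = ((Finset.univ.filter fun i => hA.eigenvalues i ≤ t).card : ℝ) / n := by
  unfold esd
  rw [hA.roots_charpoly_eq_eigenvalues, Multiset.countP_map]
  rfl

theorem Matrix.IsHermitian.exists_orthogonal_diagonal {n : ℕ} {A : Matrix (Fin n) (Fin n) ℝ}
    (hA : A.IsHermitian) :
    ∃ U : Matrix (Fin n) (Fin n) ℝ, U * Uᵀ = 1 ∧ Uᵀ * U = 1 ∧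
      A = U * Matrix.diagonal hA.eigenvalues * Uᵀ := by
  refine ⟨hA.eigenvectorUnitary, ?_, ?_, ?_⟩
  · simpa [Matrix.star_eq_conjTranspose] using Unitary.coe_mul_star_self hA.eigenvectorUnitary
  · simpa [Matrix.star_eq_conjTranspose] using Unitary.coe_star_mul_self hA.eigenvectorUnitary
  · conv_lhs => rw [hA.spectral_theorem, Unitary.conjStarAlgAut_apply]
    simp [Matrix.star_eq_conjTranspose]

theorem trace_pow_eq_sum_eigenvalues_pow {n : ℕ} {A : Matrix (Fin n) (Fin n) ℝ}
    (hA : A.IsHermitian) (h : ℕ) : (A ^ h).trace = ∑ i, hA.eigenvalues i ^ h := by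
  obtain ⟨U, h1, h2, h3⟩ := hA.exists_orthogonal_diagonal
  have key : A ^ h = U * Matrix.diagonal hA.eigenvalues ^ h * Uᵀ := by
    induction h with
    | zero => simp [h1]
    | succ k ih =>
      rw [pow_succ, ih]
      conv_lhs => rw [show U * Matrix.diagonal hA.eigenvalues ^ k * Uᵀ * A
        = U * Matrix.diagonal hA.eigenvalues ^ k * Uᵀ *
          (U * Matrix.diagonal hA.eigenvalues * Uᵀ) from congrArg _ h3]
      rw [show U * Matrix.diagonal hA.eigenvalues ^ k * Uᵀ *
        (U * Matrix.diagonal hA.eigenvalues * Uᵀ) = U * Matrix.diagonal hA.eigenvalues ^ k *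
          (Uᵀ * U) * (Matrix.diagonal hA.eigenvalues * Uᵀ) by simp only [Matrix.mul_assoc], h2,
        pow_succ]
      simp only [Matrix.mul_assoc, Matrix.one_mul]
  rw [key, Matrix.trace_mul_comm, ← Matrix.mul_assoc, h2, Matrix.one_mul, Matrix.diagonal_pow,
    Matrix.trace_diagonal]
  rfl

theorem sum_sq_orthogonal_mul {n : ℕ} {U V M : Matrix (Fin n) (Fin n) ℝ} (hU : U * Uᵀ = 1)
    (hV : V * Vᵀ = 1) : ∑ i, ∑ j, (Uᵀ * M * V) i j ^ 2 = ∑ i, ∑ j, M i j ^ 2 := by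
  have key : ∀ N : Matrix (Fin n) (Fin n) ℝ, ∑ i, ∑ j, N i j ^ 2 = (N * Nᵀ).trace := by
    intro N
    simp [Matrix.trace, Matrix.mul_apply, sq]
  rw [key, key]
  have : Uᵀ * M * V * (Uᵀ * M * V)ᵀ = Uᵀ * (M * (V * Vᵀ) * Mᵀ) * U := by
    simp only [Matrix.transpose_mul, Matrix.transpose_transpose, Matrix.mul_assoc]
  rw [this, hV, Matrix.mul_one, Matrix.trace_mul_comm, ← Matrix.mul_assoc, hU, Matrix.one_mul]

/-- Two symmetric matrices that are close in Frobenius norm have close spectral distributions. -/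
theorem esd_le_esd_add {n : ℕ} {A B : Matrix (Fin n) (Fin n) ℝ} (hA : A.IsHermitian)
    (hB : B.IsHermitian) (t : ℝ) {δ : ℝ} (hδ : 0 < δ) :
    esd A t ≤ esd B (t + δ) + (∑ i, ∑ j, (A i j - B i j) ^ 2) / (n * δ ^ 2) := by
  obtain ⟨U, hU1, hU2, hU3⟩ := hA.exists_orthogonal_diagonal
  obtain ⟨V, hV1, hV2, hV3⟩ := hB.exists_orthogonal_diagonal
  set a := hA.eigenvalues with ha
  set b := hB.eigenvalues with hb
  set W := Uᵀ * V with hW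
  have hW1 : W * Wᵀ = 1 := by
    rw [hW, Matrix.transpose_mul, Matrix.transpose_transpose, Matrix.mul_assoc,
      ← Matrix.mul_assoc V, hV1, Matrix.one_mul, hU2]
  have hW2 : Wᵀ * W = 1 := by
    rw [hW, Matrix.transpose_mul, Matrix.transpose_transpose, Matrix.mul_assoc,
      ← Matrix.mul_assoc U, hU1, Matrix.one_mul, hV2]
  have row : ∀ i, ∑ j, W i j ^ 2 = 1 := by
    intro i
    have := congrFun (congrFun hW1 i) i
    simpa [Matrix.mul_apply, sq] using this
  have col : ∀ j, ∑ i, W i j ^ 2 = 1 := by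
    intro j
    have := congrFun (congrFun hW2 j) j
    simpa [Matrix.mul_apply, sq] using this
  -- Orthogonal matrices preserve the Frobenius norm. The weights `W i j ^ 2` are doubly stochastic,
  -- so they couple the two spectra.
  have frob : ∑ i, ∑ j, (A i j - B i j) ^ 2 = ∑ i, ∑ j, (a i - b j) ^ 2 * W i j ^ 2 := by
    have h1 := sum_sq_orthogonal_mul (M := A - B) hU1 hV1
    have h2 : Uᵀ * (A - B) * V = Matrix.diagonal a * W - W * Matrix.diagonal b := by
      rw [Matrix.mul_sub, Matrix.sub_mul]
      congr 1
      · conv_lhs => rw [hU3]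
        rw [show Uᵀ * (U * Matrix.diagonal a * Uᵀ) * V = (Uᵀ * U) * (Matrix.diagonal a * (Uᵀ * V)) by
          simp only [Matrix.mul_assoc], hU2, Matrix.one_mul]
      · conv_lhs => rw [hV3]
        rw [show Uᵀ * (V * Matrix.diagonal b * Vᵀ) * V = (Uᵀ * V) * Matrix.diagonal b * (Vᵀ * V) by
          simp only [Matrix.mul_assoc], hV2, Matrix.mul_one]
    rw [h2] at h1
    simp only [Matrix.sub_apply] at h1
    rw [← h1]
    refine Finset.sum_congr rfl fun i _ => Finset.sum_congr rfl fun j _ => ?_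
    rw [Matrix.diagonal_mul, Matrix.mul_diagonal]
    ring
  rw [esd_eq_card_eigenvalues hA, esd_eq_card_eigenvalues hB, frob]
  rcases Nat.eq_zero_or_pos n with rfl | hn
  · simp
  have hn' : (0 : ℝ) < n := by exact_mod_cast hn
  rw [mul_comm (n : ℝ) (δ ^ 2), ← div_div, ← add_div]
  refine div_le_div_of_nonneg_right ?_ hn'.le
  have e1 : ((Finset.univ.filter fun i => a i ≤ t).card : ℝ)
      = ∑ i, ∑ j, (if a i ≤ t then 1 else 0) * W i j ^ 2 := by
    rw [Finset.card_filter]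
    push_cast
    refine Finset.sum_congr rfl fun i _ => ?_
    rw [← Finset.mul_sum, row, mul_one]
  have e2 : ((Finset.univ.filter fun j => b j ≤ t + δ).card : ℝ)
      = ∑ i, ∑ j, (if b j ≤ t + δ then 1 else 0) * W i j ^ 2 := by
    rw [Finset.sum_comm, Finset.card_filter]
    push_cast
    refine Finset.sum_congr rfl fun i _ => ?_
    rw [← Finset.mul_sum, col, mul_one]
  rw [← ha, ← hb, e1, e2, Finset.sum_div, ← Finset.sum_add_distrib]
  refine Finset.sum_le_sum fun i _ => ?_
  rw [Finset.sum_div, ← Finset.sum_add_distrib]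
  refine Finset.sum_le_sum fun j _ => ?_
  rw [mul_div_right_comm, ← add_mul]
  refine mul_le_mul_of_nonneg_right ?_ (sq_nonneg _)
  -- Termwise comparison: if `a i ≤ t` but `b j > t + δ`, then `(a i - b j) ^ 2 / δ ^ 2 ≥ 1`.
  have hp : 0 ≤ (a i - b j) ^ 2 / δ ^ 2 := by positivity
  by_cases h1 : a i ≤ t
  · by_cases h2 : b j ≤ t + δ
    · simp [h1, h2]; exact hp
    · simp only [h1, h2, if_true, if_false, zero_add]
      rw [le_div_iff₀ (by positivity), one_mul]
      push Not at h2
      nlinarith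
  · by_cases h2 : b j ≤ t + δ
    · simp only [h1, h2, if_true, if_false]; linarith
    · simp only [h1, h2, if_false]; linarith

/-! ### Traces of powers as sums over closed walks -/

theorem matrix_pow_apply_eq_sum {n : ℕ} (A : Matrix (Fin n) (Fin n) ℝ) (h : ℕ) (i j : Fin n) :
    (A ^ (h + 1)) i j = ∑ p : Fin h → Fin n,
      ∏ k : Fin (h + 1), A ((Fin.cons i p : Fin (h + 1) → Fin n) k)
        ((Fin.snoc p j : Fin (h + 1) → Fin n) k) := by
  induction h generalizing i with
  | zero => simp [Fin.snoc]
  | succ h ih =>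
    rw [pow_succ', Matrix.mul_apply, ← (Fin.consEquiv fun _ => Fin n).sum_comp,
      Fintype.sum_prod_type]
    refine Finset.sum_congr rfl fun a _ => ?_
    rw [ih, Finset.mul_sum]
    refine Finset.sum_congr rfl fun p _ => ?_
    conv_rhs => rw [Fin.prod_univ_succ]
    simp only [Fin.consEquiv, Equiv.coe_fn_mk, ← Fin.cons_snoc_eq_snoc_cons, Fin.cons_zero,
      Fin.cons_succ]

/-- The trace of a power as a sum over closed walks. -/
theorem trace_pow_eq_sum_closed {n : ℕ} (A : Matrix (Fin n) (Fin n) ℝ) (h : ℕ) :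
    (A ^ (h + 1)).trace = ∑ q : Fin (h + 1) → Fin n, ∏ k, A (q k) (q (k + 1)) := by
  rw [← (Fin.consEquiv fun _ => Fin n).sum_comp, Fintype.sum_prod_type, Matrix.trace]
  refine Finset.sum_congr rfl fun i _ => ?_
  rw [Matrix.diag_apply, matrix_pow_apply_eq_sum]
  refine Finset.sum_congr rfl fun p _ => Finset.prod_congr rfl fun k _ => ?_
  simp only [Fin.consEquiv, Equiv.coe_fn_mk]
  congr 1
  -- Addition in `Fin (h + 1)` is cyclic, so the last edge leads back to the vertex `q 0`.
  refine Fin.lastCases ?_ (fun l => ?_) k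
  · simp
  · simp [Fin.coeSucc_eq_succ]

/-- The uniform probability measure on the (labelled) atoms `a i`. -/
noncomputable def empiricalMeasure {n : ℕ} (a : Fin n → ℝ) : Measure ℝ :=
  (n : ℝ≥0∞)⁻¹ • ∑ i, Measure.dirac (a i)

theorem isProbabilityMeasure_empiricalMeasure {n : ℕ} (hn : n ≠ 0) (a : Fin n → ℝ) :
    IsProbabilityMeasure (empiricalMeasure a) := by
  constructor
  simp only [empiricalMeasure, Measure.smul_apply, Measure.finsetSum_apply, measure_univ,
    Finset.sum_const, Finset.card_univ, Fintype.card_fin, smul_eq_mul, nsmul_eq_mul, mul_one]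
  exact ENNReal.inv_mul_cancel (by exact_mod_cast hn) (by simp)

theorem integrable_empiricalMeasure {n : ℕ} (hn : n ≠ 0) (a : Fin n → ℝ) (f : ℝ → ℝ) :
    Integrable f (empiricalMeasure a) := by
  refine Integrable.smul_measure ?_ (by simpa using hn)
  rw [integrable_finsetSum_measure]
  exact fun i _ => integrable_dirac (by simp)

theorem integral_empiricalMeasure {n : ℕ} (a : Fin n → ℝ) (f : ℝ → ℝ) :
    ∫ x, f x ∂empiricalMeasure a = (∑ i, f (a i)) / n := by
  rw [empiricalMeasure, integral_smul_measure, integral_finsetSum_measure]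
  · simp [div_eq_inv_mul]
  · exact fun i _ => integrable_dirac (by simp)

theorem empiricalMeasure_real_Iic {n : ℕ} (a : Fin n → ℝ) (t : ℝ) :
    (empiricalMeasure a).real (Iic t) = ((Finset.univ.filter fun i => a i ≤ t).card : ℝ) / n := by
  rw [← integral_indicator_one measurableSet_Iic, integral_empiricalMeasure, Finset.card_filter]
  push_cast
  rfl

/-! ### The method of moments -/

/-- Up to the factor `c`, the derivative of the Taylor remainder of order `N + 1` is the remainder
of order `N`, so the bound is integrated by induction. The cases `c = I` and `c = -I` cover both
signs of the argument. -/
theorem norm_exp_mul_sub_sum_le {c : ℂ} (hc : ‖c‖ ≤ 1) (hexp : ∀ s : ℝ, ‖Complex.exp (c * s)‖ ≤ 1)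
    (N : ℕ) : ∀ s : ℝ, 0 ≤ s →
    ‖Complex.exp (c * s) - ∑ h ∈ Finset.range N, (c * s) ^ h / (h.factorial : ℂ)‖
      ≤ s ^ N / N.factorial := by
  induction N with
  | zero => intro s _; simpa using hexp s
  | succ N ih =>
    intro s hs
    set f : ℝ → ℂ := fun s => Complex.exp (c * s) -
      ∑ h ∈ Finset.range (N + 1), (c * s) ^ h / (h.factorial : ℂ) with hf
    set f' : ℝ → ℂ := fun s => c * (Complex.exp (c * s) -
      ∑ h ∈ Finset.range N, (c * s) ^ h / (h.factorial : ℂ)) with hf'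
    have hlin : ∀ s : ℝ, HasDerivAt (fun s : ℝ => c * (s : ℂ)) c s := by
      intro s
      simpa using (Complex.ofRealCLM.hasDerivAt (x := s)).const_mul c
    have hder : ∀ s : ℝ, HasDerivAt f (f' s) s := by
      intro s
      have h1 : HasDerivAt (fun s : ℝ => Complex.exp (c * s)) (Complex.exp (c * s) * c) s :=
        (hlin s).cexp
      have h2 : ∀ h : ℕ, HasDerivAt (fun s : ℝ => (c * (s : ℂ)) ^ (h + 1) / ((h + 1).factorial : ℂ))
          (c * ((c * s) ^ h / (h.factorial : ℂ))) s := by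
        intro h
        have h3 := ((hlin s).fun_pow (h + 1)).div_const (((h + 1).factorial : ℕ) : ℂ)
        refine h3.congr_deriv ?_
        have : (h.factorial : ℂ) ≠ 0 := by exact_mod_cast h.factorial_ne_zero
        have h5 : ((h : ℂ) + 1) ≠ 0 := by exact_mod_cast h.succ_ne_zero
        rw [Nat.factorial_succ]
        push_cast
        field_simp
      have h4 := h1.fun_sub (HasDerivAt.fun_sum (u := Finset.range N) fun h _ => h2 h)
      have h6 := h4.sub_const 1
      have e : f = fun x : ℝ => Complex.exp (c * x) -
          ∑ i ∈ Finset.range N, (c * x) ^ (i + 1) / ((i + 1).factorial : ℂ) - 1 := by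
        funext x
        simp only [hf, Finset.sum_range_succ']
        simp
        ring
      rw [e]
      refine h6.congr_deriv ?_
      simp only [hf', mul_sub, Finset.mul_sum]
      ring
    have hB : ∀ s : ℝ, HasDerivAt (fun s : ℝ => s ^ (N + 1) / ((N + 1).factorial : ℝ))
        (s ^ N / (N.factorial : ℝ)) s := by
      intro s
      have h3 := (hasDerivAt_pow (N + 1) s).div_const (((N + 1).factorial : ℕ) : ℝ)
      refine h3.congr_deriv ?_
      have : (N.factorial : ℝ) ≠ 0 := by exact_mod_cast N.factorial_ne_zero
      have h5 : ((N : ℝ) + 1) ≠ 0 := by exact_mod_cast N.succ_ne_zero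
      rw [Nat.factorial_succ]
      push_cast
      field_simp
    refine image_norm_le_of_norm_deriv_right_le_deriv_boundary (a := 0) (b := s) (f := f) (f' := f')
      (fun x _ => (hder x).continuousAt.continuousWithinAt)
      (fun x _ => (hder x).hasDerivWithinAt) ?_ hB ?_ ⟨hs, le_rfl⟩
    · simp [hf, Finset.sum_range_succ']
    · intro x hx
      simp only [hf', norm_mul]
      calc _ ≤ 1 * (x ^ N / (N.factorial : ℝ)) :=
            mul_le_mul hc (ih x hx.1) (norm_nonneg _) zero_le_one
        _ = _ := one_mul _

theorem norm_exp_mul_I_sub_sum_le (s : ℝ) (N : ℕ) :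
    ‖Complex.exp (s * Complex.I) -
      ∑ h ∈ Finset.range N, (s * Complex.I) ^ h / (h.factorial : ℂ)‖ ≤ |s| ^ N / N.factorial := by
  rcases le_total 0 s with hs | hs
  · have := norm_exp_mul_sub_sum_le (c := Complex.I) (by simp)
      (fun s => by rw [mul_comm, Complex.norm_exp_ofReal_mul_I]) N s hs
    rw [abs_of_nonneg hs]
    simpa only [mul_comm] using this
  · have := norm_exp_mul_sub_sum_le (c := -Complex.I) (by simp)
      (fun s => by
        rw [show -Complex.I * (s : ℂ) = ((-s : ℝ) : ℂ) * Complex.I by push_cast; ring,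
          Complex.norm_exp_ofReal_mul_I]) N (-s) (by linarith)
    rw [abs_of_nonpos hs]
    rwa [show -Complex.I * ((-s : ℝ) : ℂ) = s * Complex.I by push_cast; ring] at this

/-- The order `2 * K` is even so that the remainder `|t x| ^ (2 * K)` needs no absolute value and
integrates to a moment. -/
theorem norm_charFun_sub_sum_moments_le {ν : Measure ℝ} [IsProbabilityMeasure ν]
    (hν : ∀ h : ℕ, Integrable (fun x : ℝ => x ^ h) ν) (t : ℝ) (K : ℕ) :
    ‖charFun ν t - ∑ h ∈ Finset.range (2 * K),
        (t * Complex.I) ^ h / (h.factorial : ℂ) * ((∫ x, x ^ h ∂ν : ℝ) : ℂ)‖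
      ≤ t ^ (2 * K) / (2 * K).factorial * ∫ x, x ^ (2 * K) ∂ν := by
  have hint : ∀ h : ℕ, Integrable (fun x : ℝ => (t * Complex.I) ^ h / (h.factorial : ℂ) *
      ((x ^ h : ℝ) : ℂ)) ν := fun h => ((hν h).ofReal).const_mul _
  have hexp : Integrable (fun x : ℝ => Complex.exp (t * x * Complex.I)) ν := by
    refine Integrable.of_bound (C := 1) (by fun_prop) (Eventually.of_forall fun x => ?_)
    rw [← Complex.ofReal_mul, Complex.norm_exp_ofReal_mul_I]
  have h1 : charFun ν t - ∑ h ∈ Finset.range (2 * K),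
        (t * Complex.I) ^ h / (h.factorial : ℂ) * ((∫ x, x ^ h ∂ν : ℝ) : ℂ)
      = ∫ x : ℝ, (Complex.exp (t * x * Complex.I) - ∑ h ∈ Finset.range (2 * K),
        (t * Complex.I) ^ h / (h.factorial : ℂ) * ((x ^ h : ℝ) : ℂ)) ∂ν := by
    rw [integral_sub hexp (integrable_finsetSum _ fun h _ => hint h), charFun_apply_real,
      integral_finsetSum _ fun h _ => hint h]
    congr 1
    refine Finset.sum_congr rfl fun h _ => ?_
    rw [integral_const_mul, integral_complex_ofReal]
  rw [h1, ← integral_const_mul]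
  refine norm_integral_le_of_norm_le ((hν _).const_mul _) (Eventually.of_forall fun x => ?_)
  have h2 := norm_exp_mul_I_sub_sum_le (t * x) (2 * K)
  have h3 : |t * x| ^ (2 * K) / ((2 * K).factorial : ℝ)
      = t ^ (2 * K) / ((2 * K).factorial : ℝ) * x ^ (2 * K) := by
    rw [Even.pow_abs ⟨K, by ring⟩]; ring
  rw [← h3]
  have h4 : ∑ h ∈ Finset.range (2 * K), (t * Complex.I) ^ h / (h.factorial : ℂ) * ((x ^ h : ℝ) : ℂ)
      = ∑ h ∈ Finset.range (2 * K), (((t * x : ℝ) : ℂ) * Complex.I) ^ h / (h.factorial : ℂ) := by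
    refine Finset.sum_congr rfl fun h _ => ?_
    push_cast
    ring
  rw [h4, ← Complex.ofReal_mul]
  exact h2

/-- The even moments grow slowly enough for the exponential series to be controlled. -/
def MomentGrowth (β : ℕ → ℝ) : Prop :=
  ∀ t : ℝ, Tendsto (fun k : ℕ => t ^ (2 * k) / (2 * k).factorial * β (2 * k)) atTop (𝓝 0)

/-- A sequence of probability measures whose moments converge to `β`. -/
structure HasMomentLimits (β : ℕ → ℝ) (ν : ℕ → Measure ℝ) : Prop where
  prob : ∀ n, IsProbabilityMeasure (ν n)
  integrable : ∀ n h, Integrable (fun x : ℝ => x ^ h) (ν n)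
  tendsto : ∀ h, Tendsto (fun n => ∫ x, x ^ h ∂ν n) atTop (𝓝 (β h))

/-- Every sequence of probability measures whose moments converge to `β` converges to `μ` at the
continuity points of the distribution function of `μ`. -/
def MomentsDetermine (β : ℕ → ℝ) (μ : Measure ℝ) : Prop :=
  ∀ ν : ℕ → Measure ℝ, HasMomentLimits β ν → ∀ t : ℝ,
    ContinuousAt (fun s => μ.real (Iic s)) t →
    Tendsto (fun n => (ν n).real (Iic t)) atTop (𝓝 (μ.real (Iic t)))

theorem HasMomentLimits.comp {β : ℕ → ℝ} {ν : ℕ → Measure ℝ} (h : HasMomentLimits β ν)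
    {φ : ℕ → ℕ} (hφ : Tendsto φ atTop atTop) : HasMomentLimits β (fun n => ν (φ n)) :=
  ⟨fun _ => h.prob _, fun _ => h.integrable _, fun k => (h.tendsto k).comp hφ⟩

/-- For fixed `t`, first choose `K` with a small Taylor remainder, then let `n` tend to infinity in
the finitely many moments below `2 * K`. No limit measure is involved, so this serves both for the
existence of a limit law and for its uniqueness. -/
theorem HasMomentLimits.tendsto_charFun_sub {β : ℕ → ℝ} (hβ : MomentGrowth β)
    {ν ν' : ℕ → Measure ℝ} (h : HasMomentLimits β ν) (h' : HasMomentLimits β ν') (t : ℝ) :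
    Tendsto (fun n => charFun (ν n) t - charFun (ν' n) t) atTop (𝓝 0) := by
  rw [Metric.tendsto_nhds]
  intro ε hε
  obtain ⟨K, hK⟩ := ((hβ t).eventually (gt_mem_nhds (show (0 : ℝ) < ε / 2 by linarith))).exists
  set S : (ℕ → ℝ) → ℂ := fun m => ∑ h ∈ Finset.range (2 * K),
    (t * Complex.I) ^ h / (h.factorial : ℂ) * (m h : ℂ) with hS
  have hSlim : ∀ {ν : ℕ → Measure ℝ}, HasMomentLimits β ν →
      Tendsto (fun n => S fun h => ∫ x, x ^ h ∂ν n) atTop (𝓝 (S β)) := by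
    intro ν hν
    refine tendsto_finsetSum _ fun h _ => ?_
    exact ((Complex.continuous_ofReal.tendsto _).comp (hν.tendsto h)).const_mul _
  have hRlim : ∀ {ν : ℕ → Measure ℝ}, HasMomentLimits β ν →
      Tendsto (fun n => t ^ (2 * K) / (2 * K).factorial * ∫ x, x ^ (2 * K) ∂ν n) atTop
        (𝓝 (t ^ (2 * K) / (2 * K).factorial * β (2 * K))) :=
    fun hν => (hν.tendsto _).const_mul _
  have hlim := (((hSlim h).sub (hSlim h')).norm.add (hRlim h)).add (hRlim h')
  rw [sub_self, norm_zero, zero_add] at hlim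
  filter_upwards [hlim.eventually (gt_mem_nhds (show _ < ε by linarith))] with n hn
  have := h.prob n
  have := h'.prob n
  have b1 := norm_charFun_sub_sum_moments_le (h.integrable n) t K
  have b2 := norm_charFun_sub_sum_moments_le (h'.integrable n) t K
  rw [dist_zero_right]
  refine lt_of_le_of_lt ?_ hn
  have e : charFun (ν n) t - charFun (ν' n) t
      = ((S fun h => ∫ x, x ^ h ∂ν n) - S fun h => ∫ x, x ^ h ∂ν' n)
        + (charFun (ν n) t - S fun h => ∫ x, x ^ h ∂ν n)
        - (charFun (ν' n) t - S fun h => ∫ x, x ^ h ∂ν' n) := by ring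
  rw [e]
  refine (norm_sub_le _ _).trans (add_le_add ((norm_add_le _ _).trans (add_le_add le_rfl b1)) b2)

/-- An atom at `t` is a jump of the distribution function at `t`. -/
theorem measure_singleton_eq_zero_of_continuousAt {μ : Measure ℝ} [IsFiniteMeasure μ] {t : ℝ}
    (ht : ContinuousAt (fun s => μ.real (Iic s)) t) : μ {t} = 0 := by
  by_contra hne
  have hpos : 0 < μ.real {t} := by
    rw [Measure.real]; exact ENNReal.toReal_pos hne (measure_ne_top _ _)
  have hle : ∀ s < t, μ.real (Iic s) + μ.real {t} ≤ μ.real (Iic t) := by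
    intro s hs
    rw [← measureReal_union (by simpa using hs) (measurableSet_singleton t)]
    refine measureReal_mono ?_
    rintro x (hx | hx)
    · exact le_trans hx hs.le
    · exact le_of_eq hx
  have hlim : Tendsto (fun s => μ.real (Iic s) + μ.real {t}) (𝓝[<] t)
      (𝓝 (μ.real (Iic t) + μ.real {t})) :=
    (ht.tendsto.mono_left nhdsWithin_le_nhds).add tendsto_const_nhds
  have := le_of_tendsto hlim (eventually_mem_nhdsWithin.mono fun s hs => hle s hs)
  linarith

theorem tendsto_real_Iic_of_tendsto_charFun {ν : ℕ → Measure ℝ} (hν : ∀ n, IsProbabilityMeasure (ν n))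
    {μ : Measure ℝ} [IsProbabilityMeasure μ]
    (h : ∀ t, Tendsto (fun n => charFun (ν n) t) atTop (𝓝 (charFun μ t))) {t : ℝ}
    (ht : ContinuousAt (fun s => μ.real (Iic s)) t) :
    Tendsto (fun n => (ν n).real (Iic t)) atTop (𝓝 (μ.real (Iic t))) := by
  let κ : ℕ → ProbabilityMeasure ℝ := fun n => ⟨ν n, hν n⟩
  let κ₀ : ProbabilityMeasure ℝ := ⟨μ, inferInstance⟩
  have hw : Tendsto κ atTop (𝓝 κ₀) :=
    ProbabilityMeasure.tendsto_of_tendsto_charFun h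
  have := ProbabilityMeasure.tendsto_measure_of_null_frontier_of_tendsto' hw (E := Iic t)
    (by rw [frontier_Iic]; exact measure_singleton_eq_zero_of_continuousAt ht)
  exact (ENNReal.tendsto_toReal (measure_ne_top _ _)).comp this

theorem momentsDetermine_of_tendsto_charFun {β : ℕ → ℝ} (hβ : MomentGrowth β) {ν : ℕ → Measure ℝ}
    (h : HasMomentLimits β ν) {μ : Measure ℝ} [IsProbabilityMeasure μ]
    (hlim : ∀ t, Tendsto (fun n => charFun (ν n) t) atTop (𝓝 (charFun μ t))) :
    MomentsDetermine β μ := by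
  intro ν' h' t ht
  refine tendsto_real_Iic_of_tendsto_charFun h'.prob (fun s => ?_) ht
  have := (h'.tendsto_charFun_sub hβ h s).add (hlim s)
  simpa using this

theorem momentsDetermine_of_moments {β : ℕ → ℝ} (hβ : MomentGrowth β) {μ : Measure ℝ}
    [IsProbabilityMeasure μ] (hint : ∀ h : ℕ, Integrable (fun x : ℝ => x ^ h) μ)
    (hm : ∀ h : ℕ, ∫ x, x ^ h ∂μ = β h) : MomentsDetermine β μ :=
  momentsDetermine_of_tendsto_charFun hβ (ν := fun _ => μ)
    ⟨fun _ => inferInstance, fun _ => hint, fun h => by simp [hm]⟩ fun _ => tendsto_const_nhds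

/-- Chebyshev's inequality: the second moments converge, hence are bounded. -/
theorem HasMomentLimits.isTightMeasureSet_range {β : ℕ → ℝ} {ν : ℕ → Measure ℝ}
    (h : HasMomentLimits β ν) : IsTightMeasureSet (range ν) := by
  obtain ⟨C, hC⟩ := (h.tendsto 2).bddAbove_range
  have hC' : ∀ n, ∫ x, x ^ 2 ∂ν n ≤ C := fun n => hC ⟨n, rfl⟩
  refine isTightMeasureSet_of_tendsto_measure_norm_gt ?_
  have hbound : ∀ᶠ r : ℝ in atTop, ⨆ μ ∈ range ν, μ {x | r < ‖x‖} ≤ ENNReal.ofReal (C / r ^ 2) := by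
    filter_upwards [eventually_gt_atTop 0] with r hr
    refine iSup₂_le ?_
    rintro _ ⟨n, rfl⟩
    have := h.prob n
    rw [← ofReal_measureReal]
    refine ENNReal.ofReal_le_ofReal ?_
    rw [le_div_iff₀ (by positivity), mul_comm]
    refine le_trans ?_ ((mul_meas_ge_le_integral_of_nonneg (Eventually.of_forall fun x => sq_nonneg x)
      (h.integrable n 2) (r ^ 2)).trans (hC' n))
    refine mul_le_mul_of_nonneg_left (measureReal_mono fun x hx => ?_) (by positivity)
    simp only [mem_ofPred_eq, Real.norm_eq_abs] at hx ⊢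
    rw [← sq_abs x]
    exact pow_le_pow_left₀ hr.le hx.le 2
  refine tendsto_of_tendsto_of_tendsto_of_le_of_le' tendsto_const_nhds ?_
    (Eventually.of_forall fun _ => zero_le) hbound
  rw [← ENNReal.ofReal_zero]
  refine ENNReal.tendsto_ofReal ?_
  exact tendsto_const_nhds.div_atTop (tendsto_pow_atTop two_ne_zero)

/-- By Prokhorov's theorem a subsequence converges weakly. Any other sequence with the same moment
limits has asymptotically the same characteristic functions as this subsequence, so it has the same
limit. The moments of the limit need not be identified. -/
theorem exists_momentsDetermine {β : ℕ → ℝ} (hβ : MomentGrowth β) {ν : ℕ → Measure ℝ}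
    (h : HasMomentLimits β ν) : ∃ μ : Measure ℝ, IsProbabilityMeasure μ ∧ MomentsDetermine β μ := by
  set κ : ℕ → ProbabilityMeasure ℝ := fun n => ⟨ν n, h.prob n⟩ with hκ
  have hcomp : IsCompact (closure (range κ)) := by
    refine isCompact_closure_of_isTightMeasureSet ?_
    convert h.isTightMeasureSet_range using 1
    ext m
    constructor
    · rintro ⟨_, ⟨n, rfl⟩, rfl⟩
      exact ⟨n, rfl⟩
    · rintro ⟨n, rfl⟩
      exact ⟨κ n, ⟨n, rfl⟩, rfl⟩
  obtain ⟨μ, -, φ, hφ, hlim⟩ := hcomp.tendsto_subseq (x := κ) fun n => subset_closure ⟨n, rfl⟩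
  refine ⟨μ, inferInstance, momentsDetermine_of_tendsto_charFun hβ (h.comp hφ.tendsto_atTop) ?_⟩
  exact fun t => ProbabilityMeasure.tendsto_iff_tendsto_charFun.1 hlim t

/-- Finitely many moments suffice to approximate the distribution function at a point. -/
theorem MomentsDetermine.exists_finite {β : ℕ → ℝ} {μ : Measure ℝ} (h : MomentsDetermine β μ)
    {t : ℝ} (ht : ContinuousAt (fun s => μ.real (Iic s)) t) {ε : ℝ} (hε : 0 < ε) :
    ∃ (H : ℕ) (η : ℝ), 0 < η ∧ ∀ ν : Measure ℝ, IsProbabilityMeasure ν →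
      (∀ h : ℕ, Integrable (fun x : ℝ => x ^ h) ν) →
      (∀ h ≤ H, |∫ x, x ^ h ∂ν - β h| < η) → |ν.real (Iic t) - μ.real (Iic t)| < ε := by
  -- Otherwise there is, for every `n`, a bad measure whose moments up to order `n` are within `1 /
  -- (n + 1)` of `β`. These measures have moment limits `β`, yet stay away from `μ` at `t`.
  by_contra! hcon
  choose ν hν1 hν2 hν3 hν4 using fun n : ℕ => hcon n (1 / ((n : ℝ) + 1)) (by positivity)
  have hlim : HasMomentLimits β ν := by
    refine ⟨hν1, hν2, fun k => ?_⟩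
    rw [tendsto_iff_norm_sub_tendsto_zero]
    refine squeeze_zero' (Eventually.of_forall fun _ => norm_nonneg _) ?_
      tendsto_one_div_add_atTop_nhds_zero_nat
    filter_upwards [eventually_ge_atTop k] with n hn
    exact (hν3 n k hn).le
  obtain ⟨n, hn⟩ := ((Metric.tendsto_nhds.1 (h ν hlim t ht)) ε hε).exists
  exact absurd hn (not_lt.2 (hν4 n))

/-! ### Mixed moments of the input -/

section MixedMoments

variable {Ω : Type w} [MeasurableSpace Ω] {P : Measure Ω} {S : Type u} {T : Type v} {E : Type*}

/-- Independent random variables with second moment `1` and uniformly bounded moments of every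
order. -/
structure HasBoundedMoments (P : Measure Ω) (x : S → Ω → ℝ) : Prop where
  measurable : ∀ s, Measurable (x s)
  indep : iIndepFun x P
  second : ∀ s, ∫ ω, x s ω ^ 2 ∂P = 1
  bound : ∀ k : ℕ, ∃ C : ℝ, ∀ s,
    Integrable (fun ω => |x s ω| ^ k) P ∧ ∫ ω, |x s ω| ^ k ∂P ≤ C

theorem prod_abs_le_sum_pow {F : Finset E} (hF : F.Nonempty) (z : E → ℝ) :
    ∏ e ∈ F, |z e| ≤ ∑ e ∈ F, |z e| ^ F.card := by
  obtain ⟨e₀, he₀, hmax⟩ := F.exists_max_image (fun e => |z e|) hF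
  calc ∏ e ∈ F, |z e| ≤ ∏ _e ∈ F, |z e₀| :=
        Finset.prod_le_prod (fun _ _ => abs_nonneg _) hmax
    _ = |z e₀| ^ F.card := by rw [Finset.prod_const]
    _ ≤ _ := Finset.single_le_sum (f := fun e => |z e| ^ F.card) (fun _ _ => by positivity) he₀

/-- A product is dominated by the sum of the powers of its factors. This needs no independence, so
the bound is uniform over all coincidences among the factors. -/
theorem integrable_prod_of_integrable_pow [IsProbabilityMeasure P] {z : E → Ω → ℝ}
    (hz : ∀ e, Measurable (z e)) (F : Finset E) {C : ℝ}
    (hC : ∀ e, Integrable (fun ω => |z e ω| ^ F.card) P ∧ ∫ ω, |z e ω| ^ F.card ∂P ≤ C) :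
    Integrable (fun ω => ∏ e ∈ F, z e ω) P ∧ |∫ ω, ∏ e ∈ F, z e ω ∂P| ≤ 1 + F.card * C := by
  rcases F.eq_empty_or_nonempty with rfl | hF
  · simp
  have hint : Integrable (fun ω => ∑ e ∈ F, |z e ω| ^ F.card) P :=
    integrable_finsetSum _ fun e _ => (hC e).1
  have hle : ∀ ω, ‖∏ e ∈ F, z e ω‖ ≤ ∑ e ∈ F, |z e ω| ^ F.card := by
    intro ω
    rw [Real.norm_eq_abs, Finset.abs_prod]
    exact prod_abs_le_sum_pow hF _
  refine ⟨hint.mono' ?_ (Eventually.of_forall hle), ?_⟩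
  · exact (Finset.measurable_fun_prod F fun e _ => hz e).aestronglyMeasurable
  · have h1 := norm_integral_le_of_norm_le hint (Eventually.of_forall hle)
    rw [Real.norm_eq_abs, integral_finsetSum _ fun e _ => (hC e).1] at h1
    have h2 : ∑ e ∈ F, ∫ ω, |z e ω| ^ F.card ∂P ≤ F.card * C := by
      rw [← nsmul_eq_mul]
      exact Finset.sum_le_card_nsmul _ _ _ fun e _ => (hC e).2
    linarith

/-- The product of the moments that occur in the word `s` on `F`. -/
noncomputable def wordMoment [DecidableEq S] (P : Measure Ω) (x : S → Ω → ℝ) (F : Finset E)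
    (s : E → S) : ℝ :=
  ∏ σ ∈ F.image s, ∫ ω, x σ ω ^ (F.filter fun e => s e = σ).card ∂P

theorem integral_prod_eq_wordMoment [DecidableEq S] [IsProbabilityMeasure P]
    {x : S → Ω → ℝ} (hx : ∀ s, Measurable (x s)) (hind : iIndepFun x P) (F : Finset E)
    (s : E → S) : ∫ ω, ∏ e ∈ F, x (s e) ω ∂P = wordMoment P x F s := by
  have h1 : ∀ ω, ∏ e ∈ F, x (s e) ω
      = ∏ σ : {σ // σ ∈ F.image s}, x σ ω ^ (F.filter fun e => s e = σ).card := by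
    intro ω
    rw [Finset.prod_comp (fun σ => x σ ω) s, ← Finset.prod_coe_sort (F.image s)]
  have hsub : iIndepFun (fun σ : {σ // σ ∈ F.image s} => x σ) P :=
    hind.precomp Subtype.val_injective
  simp_rw [h1]
  have := iIndepFun.integral_fun_prod_comp (X := fun σ : {σ // σ ∈ F.image s} => x σ) hsub
    (fun σ => (hx σ).aemeasurable)
    (f := fun σ (r : ℝ) => r ^ (F.filter fun e => s e = σ).card)
    (fun σ => by fun_prop)
  rw [this, wordMoment, ← Finset.prod_coe_sort (F.image s)]

/-- A letter that occurs once contributes its mean as a factor. -/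
theorem wordMoment_eq_zero [DecidableEq S] {x : S → Ω → ℝ} (hx : ∀ s, ∫ ω, x s ω ∂P = 0)
    {F : Finset E} {s : E → S} {e₀ : E} (he₀ : e₀ ∈ F) (huniq : ∀ e ∈ F, s e = s e₀ → e = e₀) :
    wordMoment P x F s = 0 := by
  refine Finset.prod_eq_zero (Finset.mem_image_of_mem s he₀) ?_
  have : F.filter (fun e => s e = s e₀) = {e₀} := by
    ext e
    simp only [Finset.mem_filter, Finset.mem_singleton]
    exact ⟨fun h => huniq e h.1 h.2, by rintro rfl; exact ⟨he₀, rfl⟩⟩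
  rw [this]
  simpa using hx (s e₀)

theorem wordMoment_union [DecidableEq S] [DecidableEq E] {x : S → Ω → ℝ} {F G : Finset E}
    {s : E → S} (hdisj : ∀ e ∈ F, ∀ g ∈ G, s e ≠ s g) :
    wordMoment P x (F ∪ G) s = wordMoment P x F s * wordMoment P x G s := by
  unfold wordMoment
  rw [Finset.image_union, Finset.prod_union]
  · congr 1
    · refine Finset.prod_congr rfl fun σ hσ => ?_
      obtain ⟨f, hf, rfl⟩ := Finset.mem_image.1 hσ
      rw [Finset.filter_union, (Finset.filter_eq_empty_iff (s := G)).2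
        (fun g hg h => hdisj f hf g hg h.symm), Finset.union_empty]
    · refine Finset.prod_congr rfl fun σ hσ => ?_
      obtain ⟨g, hg, rfl⟩ := Finset.mem_image.1 hσ
      rw [Finset.filter_union, (Finset.filter_eq_empty_iff (s := F)).2
        (fun f hf h => hdisj f hf g hg h), Finset.empty_union]
  · rw [Finset.disjoint_left]
    rintro σ h1 h2
    obtain ⟨f, hf, rfl⟩ := Finset.mem_image.1 h1
    obtain ⟨g, hg, h⟩ := Finset.mem_image.1 h2
    exact hdisj f hf g hg h.symm

theorem wordMoment_eq_one [DecidableEq S] {x : S → Ω → ℝ} (hx : ∀ s, ∫ ω, x s ω ^ 2 ∂P = 1)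
    {F : Finset E} {s : E → S} (hpair : ∀ e ∈ F, (F.filter fun e' => s e' = s e).card = 2) :
    wordMoment P x F s = 1 := by
  refine Finset.prod_eq_one fun σ hσ => ?_
  obtain ⟨f, hf, rfl⟩ := Finset.mem_image.1 hσ
  rw [hpair f hf, hx]

/-- The joint moments of the entries `x_{s e} y_{t e}`. -/
theorem integral_prod_mul_eq [DecidableEq S] [DecidableEq T] [IsProbabilityMeasure P]
    {x : S → Ω → ℝ} {y : T → Ω → ℝ}
    (hx : ∀ s, Measurable (x s)) (hxi : iIndepFun x P) (hy : ∀ t, Measurable (y t))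
    (hyi : iIndepFun y P) (hxy : IndepFun (fun ω s => x s ω) (fun ω t => y t ω) P)
    (F : Finset E) (s : E → S) (t : E → T) :
    ∫ ω, ∏ e ∈ F, (x (s e) ω * y (t e) ω) ∂P = wordMoment P x F s * wordMoment P y F t := by
  rw [← integral_prod_eq_wordMoment hx hxi, ← integral_prod_eq_wordMoment hy hyi]
  simp_rw [Finset.prod_mul_distrib]
  have hφ : Measurable fun f : S → ℝ => ∏ e ∈ F, f (s e) :=
    Finset.measurable_fun_prod F fun e _ => measurable_pi_apply _
  have hψ : Measurable fun f : T → ℝ => ∏ e ∈ F, f (t e) :=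
    Finset.measurable_fun_prod F fun e _ => measurable_pi_apply _
  exact (hxy.comp hφ hψ).integral_fun_mul_eq_mul_integral
    (hφ.comp (measurable_pi_lambda _ hx)).aestronglyMeasurable
    (hψ.comp (measurable_pi_lambda _ hy)).aestronglyMeasurable

theorem exists_bound_prod_mul [IsProbabilityMeasure P] {x : S → Ω → ℝ} {y : T → Ω → ℝ}
    (hx : HasBoundedMoments P x) (hy : HasBoundedMoments P y) (N : ℕ) :
    ∃ C : ℝ, 1 ≤ C ∧ ∀ (E : Type) (F : Finset E) (s : E → S) (t : E → T), F.card ≤ N →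
      Integrable (fun ω => ∏ e ∈ F, (x (s e) ω * y (t e) ω)) P ∧
      |∫ ω, ∏ e ∈ F, (x (s e) ω * y (t e) ω) ∂P| ≤ C := by
  choose Cx hCx using hx.bound
  choose Cy hCy using hy.bound
  -- A product of `k` factors `x y` is bounded through moments of order `2 * k` of `x` and of `y`;
  -- the sum over `k ≤ N` covers all cardinalities at once, and the summand `1` makes `1 ≤ C`.
  refine ⟨1 + ∑ k ∈ Finset.range (N + 1), k * (|Cx (2 * k)| + |Cy (2 * k)|), ?_, ?_⟩
  · have : 0 ≤ ∑ k ∈ Finset.range (N + 1), (k : ℝ) * (|Cx (2 * k)| + |Cy (2 * k)|) :=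
      Finset.sum_nonneg fun k _ => by positivity
    linarith
  intro E F s t hF
  have hle : ∀ a b : ℝ, ∀ k : ℕ, |a * b| ^ k ≤ |a| ^ (2 * k) + |b| ^ (2 * k) := by
    intro a b k
    rw [abs_mul, mul_pow, mul_comm 2 k, pow_mul, pow_mul]
    nlinarith [sq_nonneg (|a| ^ k - |b| ^ k), sq_nonneg (|a| ^ k), sq_nonneg (|b| ^ k)]
  have hz := integrable_prod_of_integrable_pow (P := P) (z := fun e ω => x (s e) ω * y (t e) ω)
    (fun e => (hx.measurable _).mul (hy.measurable _)) F
    (C := |Cx (2 * F.card)| + |Cy (2 * F.card)|) (fun e => by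
      have i1 := hCx (2 * F.card) (s e)
      have i2 := hCy (2 * F.card) (t e)
      have hint := i1.1.add i2.1
      refine ⟨hint.mono' ?_ (Eventually.of_forall fun ω => ?_), ?_⟩
      · exact ((((hx.measurable _).mul (hy.measurable _)).norm).pow_const _).aestronglyMeasurable
      · rw [Real.norm_of_nonneg (by positivity)]
        exact hle _ _ _
      · calc ∫ ω, |x (s e) ω * y (t e) ω| ^ F.card ∂P
            ≤ ∫ ω, (|x (s e) ω| ^ (2 * F.card) + |y (t e) ω| ^ (2 * F.card)) ∂P :=
              integral_mono_of_nonneg (Eventually.of_forall fun ω => by positivity) hint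
                (Eventually.of_forall fun ω => hle _ _ _)
          _ = _ := integral_add i1.1 i2.1
          _ ≤ _ := add_le_add (i1.2.trans (le_abs_self _)) (i2.2.trans (le_abs_self _)))
  refine ⟨hz.1, hz.2.trans ?_⟩
  have := Finset.single_le_sum (f := fun k : ℕ => (k : ℝ) * (|Cx (2 * k)| + |Cy (2 * k)|))
    (fun k _ => by positivity) (Finset.mem_range.2 (Nat.lt_succ_of_le hF))
  simpa using this

end MixedMoments

/-! ### Counting circuits by exploration -/

section Counting

variable {V : Type*} [DecidableEq V] {n : ℕ}

/-- The restriction of `v` to `D`, extended by `none`. -/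
def maskedRestriction (D : Finset V) (v : V → Fin n) : V → Option (Fin n) :=
  fun x => if x ∈ D then some (v x) else none

/-- The number of different restrictions to `D` of the elements of `C`. -/
def numRestrictions [Fintype V] (C : Finset (V → Fin n)) (D : Finset V) : ℕ :=
  (C.image (maskedRestriction D)).card

variable [Fintype V]

theorem maskedRestriction_eq_iff {D : Finset V} {v v' : V → Fin n} :
    maskedRestriction D v = maskedRestriction D v' ↔ ∀ x ∈ D, v x = v' x := by
  constructor
  · intro h x hx
    simpa [maskedRestriction, hx] using congrFun h x
  · intro h
    funext x
    by_cases hx : x ∈ D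
    · simp [maskedRestriction, hx, h x hx]
    · simp [maskedRestriction, hx]

theorem numRestrictions_empty (C : Finset (V → Fin n)) : numRestrictions C ∅ ≤ 1 := by
  refine Finset.card_le_one.2 fun a ha b hb => ?_
  obtain ⟨v, -, rfl⟩ := Finset.mem_image.1 ha
  obtain ⟨v', -, rfl⟩ := Finset.mem_image.1 hb
  exact maskedRestriction_eq_iff.2 (by simp)

theorem numRestrictions_univ (C : Finset (V → Fin n)) :
    numRestrictions C Finset.univ = C.card := by
  refine Finset.card_image_of_injective _ fun v v' h => ?_
  exact funext fun x => maskedRestriction_eq_iff.1 h x (Finset.mem_univ x)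

/-- The map from restrictions to `insert x D` to restrictions to `D` has fibres of size at most `K`,
an element of a fibre being determined by its value at `x`. -/
theorem numRestrictions_insert_le (C : Finset (V → Fin n)) (D : Finset V) (x : V) (K : ℕ)
    (hK : ∀ v₀ ∈ C, ((C.filter fun v => ∀ y ∈ D, v y = v₀ y).image fun v => v x).card ≤ K) :
    numRestrictions C (insert x D) ≤ K * numRestrictions C D := by
  set φ : (V → Option (Fin n)) → V → Option (Fin n) := fun g y => if y ∈ D then g y else none
  have hφ : ∀ v, φ (maskedRestriction (insert x D) v) = maskedRestriction D v := by
    intro v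
    funext y
    by_cases hy : y ∈ D <;> simp [φ, maskedRestriction, hy]
  have himg : (C.image (maskedRestriction (insert x D))).image φ = C.image (maskedRestriction D) := by
    rw [Finset.image_image]
    exact Finset.image_congr fun v _ => hφ v
  unfold numRestrictions
  rw [← himg]
  refine Finset.card_le_mul_card_image _ _ fun b hb => ?_
  rw [himg] at hb
  obtain ⟨v₀, hv₀, rfl⟩ := Finset.mem_image.1 hb
  refine le_trans ?_ (hK v₀ hv₀)
  rw [← Finset.card_image_of_injective ((C.filter fun v => ∀ y ∈ D, v y = v₀ y).image fun v => v x)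
    (Option.some_injective _)]
  refine Finset.card_le_card_of_injOn (fun g => g x) ?_ ?_
  · intro g hg
    obtain ⟨hg1, hg2⟩ := Finset.mem_filter.1 hg
    obtain ⟨v, hv, rfl⟩ := Finset.mem_image.1 hg1
    rw [hφ, maskedRestriction_eq_iff] at hg2
    have : maskedRestriction (insert x D) v x = some (v x) := by simp [maskedRestriction]
    simp only [this]
    exact Finset.mem_image_of_mem _ (Finset.mem_image_of_mem (fun v => v x)
      (Finset.mem_filter.2 ⟨hv, hg2⟩))
  · intro g hg g' hg' h
    obtain ⟨hg1, hg2⟩ := Finset.mem_filter.1 hg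
    obtain ⟨v, hv, rfl⟩ := Finset.mem_image.1 hg1
    obtain ⟨hg1', hg2'⟩ := Finset.mem_filter.1 hg'
    obtain ⟨v', hv', rfl⟩ := Finset.mem_image.1 hg1'
    rw [hφ, maskedRestriction_eq_iff] at hg2 hg2'
    rw [maskedRestriction_eq_iff]
    intro y hy
    rcases Finset.mem_insert.1 hy with rfl | hy
    · simpa [maskedRestriction] using h
    · rw [hg2 y hy, hg2' y hy]

theorem numRestrictions_insert_le_mul (C : Finset (V → Fin n)) (D : Finset V) (x : V) :
    numRestrictions C (insert x D) ≤ n * numRestrictions C D := by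
  refine numRestrictions_insert_le C D x n fun v₀ _ => ?_
  exact (Finset.card_le_univ _).trans (by simp)

end Counting

section Circuits

variable {S : Type u} {ι : Type*} {m n : ℕ}

/-- The label of the edge `e` of a family of circuits of length `m + 1`, indexed by `ι`; a circuit
is given by its vertices in cyclic order. -/
def edgeLabel (ℓ : Fin n → Fin n → S) (q : ι × Fin (m + 1) → Fin n) (e : ι × Fin (m + 1)) : S :=
  ℓ (q e) (q (e.1, e.2 + 1))

/-- The edge labels of the circuits in `C` match wherever the letters of `f` match. -/
def IsConsistent {A : Type*} (ℓ : Fin n → Fin n → S) (f : ι × Fin (m + 1) → A)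
    (C : Finset (ι × Fin (m + 1) → Fin n)) : Prop :=
  ∀ q ∈ C, ∀ e e', f e = f e' → edgeLabel ℓ q e = edgeLabel ℓ q e'

variable {A : Type*} [DecidableEq A] [Fintype ι] [DecidableEq ι]
  {ℓ : Fin n → Fin n → S} {f : ι × Fin (m + 1) → A} {C : Finset (ι × Fin (m + 1) → Fin n)} {Δ : ℕ}

/-- Both ends of `e'` are already explored, so the common label of `e` and `e'` is known. With the
start of `e` known too, Property B leaves at most `Δ` choices for its end. -/
theorem numRestrictions_insert_determined (hC : IsConsistent ℓ f C)
    (hΔ : ∀ (k : Fin n) (t : S), {l : Fin n | ℓ k l = t}.ncard ≤ Δ)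
    {D : Finset (ι × Fin (m + 1))} {e e' : ι × Fin (m + 1)} (he : e ∈ D) (he1 : e' ∈ D)
    (he2 : (e'.1, e'.2 + 1) ∈ D) (hf : f e = f e') :
    numRestrictions C (insert (e.1, e.2 + 1) D) ≤ Δ * numRestrictions C D := by
  refine numRestrictions_insert_le C D _ Δ fun v₀ hv₀ => ?_
  rw [← Set.ncard_coe_finset]
  refine (Set.ncard_le_ncard ?_ (Set.toFinite _)).trans (hΔ (v₀ e) (edgeLabel ℓ v₀ e'))
  intro l hl
  simp only [Finset.coe_image, Finset.coe_filter, mem_image] at hl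
  obtain ⟨v, ⟨hv, hvD⟩, rfl⟩ := hl
  change ℓ (v₀ e) (v (e.1, e.2 + 1)) = _
  have h1 := hC v hv e e' hf
  simp only [edgeLabel] at h1 ⊢
  rw [← hvD e he, h1, hvD _ he1, hvD _ he2]

theorem Fin.ofNat_add_one_eq (j : ℕ) :
    Fin.ofNat (m + 1) j + 1 = Fin.ofNat (m + 1) (j + 1) := by
  ext
  simp [Fin.val_add, Fin.ofNat]

/-- Exploring the first `j` edges of the circuit `c` from the vertex `i`. -/
theorem numRestrictions_path (hC : IsConsistent ℓ f C) (hΔ0 : 1 ≤ Δ)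
    (hΔ : ∀ (k : Fin n) (t : S), {l : Fin n | ℓ k l = t}.ncard ≤ Δ)
    (D : Finset (ι × Fin (m + 1))) (K : Finset A)
    (hK : ∀ a ∈ K, ∃ e ∈ D, (e.1, e.2 + 1) ∈ D ∧ f e = a) (c : ι) (i : Fin (m + 1)) (j : ℕ) :
    numRestrictions C (D ∪ (Finset.range (j + 1)).image fun l => (c, i + Fin.ofNat (m + 1) l))
      ≤ numRestrictions C D * Δ ^ (j + 1) *
        n ^ (1 + (((Finset.range j).image fun l => f (c, i + Fin.ofNat (m + 1) l)) \ K).card) := by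
  induction j with
  | zero =>
    -- The start vertex costs a factor `n`; it is also charged `Δ ≥ 1`, to keep the exponents
    -- uniform.
    have h1 := numRestrictions_insert_le_mul C D (c, i)
    have h2 : D ∪ (Finset.range (0 + 1)).image (fun l => (c, i + Fin.ofNat (m + 1) l))
        = insert (c, i) D := by
      ext x; simp [or_comm, Fin.ofNat]
    rw [h2]
    calc _ ≤ n * numRestrictions C D := h1
      _ = numRestrictions C D * 1 * n := by ring
      _ ≤ numRestrictions C D * Δ * n := by gcongr
      _ = _ := by simp
  | succ j ih =>
    set D' := D ∪ (Finset.range (j + 1)).image fun l => (c, i + Fin.ofNat (m + 1) l) with hD'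
    set K' := (Finset.range j).image fun l => f (c, i + Fin.ofNat (m + 1) l) with hK'
    set e : ι × Fin (m + 1) := (c, i + Fin.ofNat (m + 1) j) with he
    have hDs : D ∪ (Finset.range (j + 1 + 1)).image (fun l => (c, i + Fin.ofNat (m + 1) l))
        = insert (e.1, e.2 + 1) D' := by
      rw [Finset.range_add_one, Finset.image_insert, Finset.union_insert]
      congr 2
      rw [he, add_assoc, Fin.ofNat_add_one_eq]
    have hKs : (Finset.range (j + 1)).image (fun l => f (c, i + Fin.ofNat (m + 1) l))
        = insert (f e) K' := by
      rw [Finset.range_add_one, Finset.image_insert]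
    rw [hDs, hKs]
    have heD : e ∈ D' := by
      rw [hD', Finset.mem_union]
      exact Or.inr (Finset.mem_image.2 ⟨j, by simp, rfl⟩)
    -- A letter known from `K` or seen earlier on the path costs a factor `Δ`; a new letter costs a
    -- factor `n` and enters the exponent.
    by_cases hfe : f e ∈ K ∪ K'
    · have hex : ∃ e' ∈ D', (e'.1, e'.2 + 1) ∈ D' ∧ f e = f e' := by
        rcases Finset.mem_union.1 hfe with h | h
        · obtain ⟨e', h1, h2, h3⟩ := hK _ h
          exact ⟨e', Finset.mem_union_left _ h1, Finset.mem_union_left _ h2, h3.symm⟩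
        · obtain ⟨l, hl, h3⟩ := Finset.mem_image.1 h
          have hl' := Finset.mem_range.1 hl
          refine ⟨(c, i + Fin.ofNat (m + 1) l), ?_, ?_, h3.symm⟩
          · exact Finset.mem_union_right _ (Finset.mem_image.2 ⟨l, by simp; omega, rfl⟩)
          · refine Finset.mem_union_right _ (Finset.mem_image.2 ⟨l + 1, by simp; omega, ?_⟩)
            rw [add_assoc, Fin.ofNat_add_one_eq]
      obtain ⟨e', h1, h2, h3⟩ := hex
      have h4 := numRestrictions_insert_determined hC hΔ heD h1 h2 h3
      have h5 : (insert (f e) K') \ K = K' \ K := by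
        rcases Finset.mem_union.1 hfe with h | h
        · rw [Finset.insert_sdiff_of_mem _ h]
        · rw [Finset.insert_eq_of_mem h]
      rw [h5]
      calc _ ≤ Δ * numRestrictions C D' := h4
        _ ≤ Δ * (numRestrictions C D * Δ ^ (j + 1) * n ^ (1 + (K' \ K).card)) := by gcongr
        _ = _ := by ring
    · have h4 := numRestrictions_insert_le_mul C D' (e.1, e.2 + 1)
      rw [Finset.mem_union, not_or] at hfe
      have h5 : ((insert (f e) K') \ K).card = (K' \ K).card + 1 := by
        rw [Finset.insert_sdiff_of_notMem _ hfe.1, Finset.card_insert_of_notMem]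
        simp [hfe.2]
      rw [h5]
      calc _ ≤ n * numRestrictions C D' := h4
        _ ≤ n * (numRestrictions C D * Δ ^ (j + 1) * n ^ (1 + (K' \ K).card)) := by gcongr
        _ = numRestrictions C D * Δ ^ (j + 1) * 1 * n ^ (1 + ((K' \ K).card + 1)) := by ring
        _ ≤ numRestrictions C D * Δ ^ (j + 1) * Δ * n ^ (1 + ((K' \ K).card + 1)) := by gcongr
        _ = _ := by ring

/-- The vertices of the circuits in `B`. -/
def circuitVertices (m : ℕ) (B : Finset ι) : Finset (ι × Fin (m + 1)) := B ×ˢ Finset.univ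

theorem range_image_add_cast (c : ι) (i : Fin (m + 1)) :
    ((Finset.range (m + 1)).image fun l : ℕ => (c, i + Fin.ofNat (m + 1) l))
      = circuitVertices m {c} := by
  ext ⟨c', k⟩
  simp only [Finset.mem_image, Finset.mem_range, circuitVertices, Finset.mem_product,
    Finset.mem_singleton, Finset.mem_univ, and_true, Prod.mk.injEq]
  constructor
  · rintro ⟨l, -, rfl, -⟩; rfl
  · rintro rfl
    exact ⟨(k - i : Fin (m + 1)).val, (k - i).isLt, rfl, by rw [Fin.ofNat_val_eq_self]; abel⟩

theorem circuitVertices_insert (B : Finset ι) (c : ι) :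
    circuitVertices m (insert c B) = circuitVertices m B ∪ circuitVertices m {c} := by
  ext ⟨c', k⟩
  simp only [circuitVertices, Finset.mem_product, Finset.mem_insert, Finset.mem_univ, and_true,
    Finset.mem_union, Finset.mem_singleton]
  exact or_comm

/-- The bound for the number of circuits `B` with `r` savings. -/
def ExplorationBound (f : ι × Fin (m + 1) → A) (C : Finset (ι × Fin (m + 1) → Fin n)) (Δ : ℕ)
    (B : Finset ι) (r : ℕ) : Prop :=
  numRestrictions C (circuitVertices m B) * n ^ r
    ≤ Δ ^ ((m + 1) * B.card) * n ^ (B.card + ((circuitVertices m B).image f).card)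

theorem explorationBound_empty : ExplorationBound f C Δ ∅ 0 := by
  simpa [ExplorationBound, circuitVertices] using numRestrictions_empty C

theorem card_letters_insert (B : Finset ι) (c : ι) :
    ((circuitVertices m (insert c B)).image f).card = ((circuitVertices m B).image f).card +
      (((circuitVertices m {c}).image f) \ ((circuitVertices m B).image f)).card := by
  rw [circuitVertices_insert, Finset.image_union, ← Finset.union_sdiff_self_eq_union,
    Finset.card_union_of_disjoint Finset.disjoint_sdiff]

theorem exists_edge_of_mem_letters {B : Finset ι} :
    ∀ a ∈ (circuitVertices m B).image f, ∃ e ∈ circuitVertices m B,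
      (e.1, e.2 + 1) ∈ circuitVertices m B ∧ f e = a := by
  intro a ha
  obtain ⟨e, he, rfl⟩ := Finset.mem_image.1 ha
  refine ⟨e, he, ?_, rfl⟩
  simpa [circuitVertices] using he

/-- Exploring `m` edges from the vertex `0` reaches every vertex of the new circuit: one factor `n`
for the start and at most one for each new letter. Savings stand as a factor `n ^ r` on the left to
avoid subtraction in exponents. -/
theorem ExplorationBound.insert (hC : IsConsistent ℓ f C) (hΔ0 : 1 ≤ Δ)
    (hΔ : ∀ (k : Fin n) (t : S), {l : Fin n | ℓ k l = t}.ncard ≤ Δ) {B : Finset ι} {r : ℕ}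
    (h : ExplorationBound f C Δ B r) {c : ι} (hc : c ∉ B) :
    ExplorationBound f C Δ (insert c B) r := by
  unfold ExplorationBound at h ⊢
  have h1 := numRestrictions_path hC hΔ0 hΔ (circuitVertices m B) _ exists_edge_of_mem_letters c 0 m
  rw [range_image_add_cast, ← circuitVertices_insert] at h1
  rw [Finset.card_insert_of_notMem hc, card_letters_insert]
  set K := (circuitVertices m B).image f
  rcases Nat.eq_zero_or_pos n with rfl | hn
  · have : numRestrictions C (circuitVertices m (Insert.insert c B)) = 0 := by
      refine Nat.le_zero.1 (h1.trans ?_)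
      simp
    simp [this]
  have h2 : (((Finset.range m).image fun l : ℕ => f (c, 0 + Fin.ofNat (m + 1) l)) \ K).card
      ≤ (((circuitVertices m {c}).image f) \ K).card := by
    refine Finset.card_le_card (Finset.sdiff_subset_sdiff ?_ le_rfl)
    intro a ha
    obtain ⟨l, -, rfl⟩ := Finset.mem_image.1 ha
    exact Finset.mem_image_of_mem _ (by simp [circuitVertices])
  calc _ ≤ numRestrictions C (circuitVertices m B) * Δ ^ (m + 1) *
        n ^ (1 + (((circuitVertices m {c}).image f) \ K).card) * n ^ r := by
          refine Nat.mul_le_mul_right _ (h1.trans (Nat.mul_le_mul_left _ ?_))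
          exact Nat.pow_le_pow_right hn (by omega)
    _ = (numRestrictions C (circuitVertices m B) * n ^ r) * (Δ ^ (m + 1) *
        n ^ (1 + (((circuitVertices m {c}).image f) \ K).card)) := by ring
    _ ≤ (Δ ^ ((m + 1) * B.card) * n ^ (B.card + K.card)) * (Δ ^ (m + 1) *
        n ^ (1 + (((circuitVertices m {c}).image f) \ K).card)) := Nat.mul_le_mul_right _ h
    _ = _ := by ring

/-- A letter that occurs once in the new circuit, and not before, is determined by the closing of
the circuit. -/
theorem ExplorationBound.insert_saving (hC : IsConsistent ℓ f C) (hΔ0 : 1 ≤ Δ)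
    (hΔ : ∀ (k : Fin n) (t : S), {l : Fin n | ℓ k l = t}.ncard ≤ Δ) {B : Finset ι} {r : ℕ}
    (h : ExplorationBound f C Δ B r) {c : ι} (hc : c ∉ B) (i : Fin (m + 1))
    (hi : ∀ k, f (c, k) = f (c, i) → k = i) (hiB : ∀ e, e.1 ∈ B → f e ≠ f (c, i)) :
    ExplorationBound f C Δ (Insert.insert c B) (r + 1) := by
  unfold ExplorationBound at h ⊢
  -- Starting at `i + 1`, the `m` explored edges are all edges except `i`. The letter of `i` occurs
  -- only there, so it is never paid for.
  have h1 := numRestrictions_path hC hΔ0 hΔ (circuitVertices m B) _ exists_edge_of_mem_letters c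
    (i + 1) m
  rw [range_image_add_cast, ← circuitVertices_insert] at h1
  rw [Finset.card_insert_of_notMem hc, card_letters_insert]
  set K := (circuitVertices m B).image f
  rcases Nat.eq_zero_or_pos n with rfl | hn
  · simp
  have h2 : (((Finset.range m).image fun l : ℕ => f (c, i + 1 + Fin.ofNat (m + 1) l)) \ K).card + 1
      ≤ (((circuitVertices m {c}).image f) \ K).card := by
    have hmem : f (c, i) ∈ ((circuitVertices m {c}).image f) \ K := by
      rw [Finset.mem_sdiff]
      refine ⟨Finset.mem_image_of_mem _ (by simp [circuitVertices]), fun hK => ?_⟩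
      obtain ⟨e, he, hfe⟩ := Finset.mem_image.1 hK
      exact hiB e (by simpa [circuitVertices] using he) hfe
    rw [← Finset.card_erase_add_one hmem]
    refine Nat.add_le_add_right (Finset.card_le_card ?_) 1
    intro a ha
    obtain ⟨ha1, ha2⟩ := Finset.mem_sdiff.1 ha
    obtain ⟨l, hl, rfl⟩ := Finset.mem_image.1 ha1
    refine Finset.mem_erase.2 ⟨fun heq => ?_, Finset.mem_sdiff.2
      ⟨Finset.mem_image_of_mem _ (by simp [circuitVertices]), ha2⟩⟩
    -- An explored edge with the letter of `i` would be `i` itself, that is `1 + l = 0` modulo `m +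
    -- 1`, which is impossible for `l < m`.
    have h3 := hi _ heq
    have hlm := Finset.mem_range.1 hl
    have h4 : (1 : Fin (m + 1)) + Fin.ofNat (m + 1) l = 0 := by
      have : i + (1 + Fin.ofNat (m + 1) l) = i + 0 := by rw [← add_assoc, h3, add_zero]
      exact add_left_cancel this
    rw [add_comm (1 : Fin (m + 1)), Fin.ofNat_add_one_eq] at h4
    have h5 := congrArg Fin.val h4
    simp only [Fin.val_ofNat, Fin.val_zero] at h5
    rw [Nat.mod_eq_of_lt (by omega)] at h5
    omega
  calc _ ≤ numRestrictions C (circuitVertices m B) * Δ ^ (m + 1) *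
        n ^ ((((circuitVertices m {c}).image f) \ K).card) * n ^ (r + 1) := by
          refine Nat.mul_le_mul_right _ (h1.trans (Nat.mul_le_mul_left _ ?_))
          exact Nat.pow_le_pow_right hn (by omega)
    _ = (numRestrictions C (circuitVertices m B) * n ^ r) * (Δ ^ (m + 1) *
        n ^ (1 + (((circuitVertices m {c}).image f) \ K).card)) := by ring
    _ ≤ (Δ ^ ((m + 1) * B.card) * n ^ (B.card + K.card)) * (Δ ^ (m + 1) *
        n ^ (1 + (((circuitVertices m {c}).image f) \ K).card)) := Nat.mul_le_mul_right _ h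
    _ = _ := by ring

theorem ExplorationBound.card_mul_le {r : ℕ} (h : ExplorationBound f C Δ Finset.univ r) :
    C.card * n ^ r ≤ Δ ^ ((m + 1) * Fintype.card ι) *
      n ^ (Fintype.card ι + (Finset.univ.image f).card) := by
  have : circuitVertices m (Finset.univ : Finset ι) = Finset.univ := by
    ext; simp [circuitVertices]
  simpa [ExplorationBound, this, numRestrictions_univ] using h

theorem explorationBound_of_forall (hC : IsConsistent ℓ f C) (hΔ0 : 1 ≤ Δ)
    (hΔ : ∀ (k : Fin n) (t : S), {l : Fin n | ℓ k l = t}.ncard ≤ Δ) {B B' : Finset ι} {r : ℕ}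
    (hBB : Disjoint B B') (h : ExplorationBound f C Δ B r) : ExplorationBound f C Δ (B' ∪ B) r := by
  induction B' using Finset.induction_on with
  | empty => simpa using h
  | insert c B' hc ih =>
    rw [Finset.disjoint_insert_right] at hBB
    rw [Finset.insert_union]
    exact (ih hBB.2).insert hC hΔ0 hΔ (by simp [hc, hBB.1])

end Circuits

/-! ### The number of circuits with given matches -/

section CircuitCounts

variable {S : Type u} {m n : ℕ}

theorem card_image_le_of_factors {E A B : Type*} [Fintype E] [DecidableEq A] [DecidableEq B]
    {f : E → A} {g : E → B} (h : ∀ e e', f e = f e' → g e = g e') :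
    (Finset.univ.image g).card ≤ (Finset.univ.image f).card := by
  rcases isEmpty_or_nonempty E with hE | hE
  · simp
  choose! r hr using fun b (hb : b ∈ Finset.univ.image g) => Finset.mem_image.1 hb
  refine Finset.card_le_card_of_injOn (fun b => f (r b)) (fun b _ => by simp) ?_
  intro b hb b' hb' hbb
  rw [← (hr b hb).2, ← (hr b' hb').2]
  exact h _ _ hbb

theorem card_image_eq_of_ker_eq {E A B : Type*} [Fintype E] [DecidableEq A] [DecidableEq B]
    {f : E → A} {g : E → B} (h : ∀ e e', f e = f e' ↔ g e = g e') :
    (Finset.univ.image f).card = (Finset.univ.image g).card :=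
  le_antisymm (card_image_le_of_factors fun e e' => (h e e').2)
    (card_image_le_of_factors fun e e' => (h e e').1)

/-- Using the positions themselves as letters, a representative for each class, leaves only finitely
many patterns, whose number does not depend on `n`. -/
theorem exists_pattern {E B : Type*} (g : E → B) :
    ∃ f : E → E, ∀ e e', f e = f e' ↔ g e = g e' := by
  rcases isEmpty_or_nonempty E with hE | hE
  · exact ⟨id, fun e => isEmptyElim e⟩
  refine ⟨fun e => Function.invFun g (g e), fun e e' => ⟨fun h => ?_, fun h => by simp [h]⟩⟩
  have h1 := Function.invFun_eq (f := g) (b := g e) ⟨e, rfl⟩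
  have h2 := Function.invFun_eq (f := g) (b := g e') ⟨e', rfl⟩
  rw [← h1, ← h2]
  exact congrArg g h

theorem card_le_mul_of_patterns {E X B : Type*} [Fintype E] (Y : Finset X)
    (g : X → E → B) (b : ℕ)
    (h : ∀ (f : E → E) (Z : Finset X), Z ⊆ Y → (∀ z ∈ Z, ∀ e e', f e = f e' ↔ g z e = g z e') →
      Z.card ≤ b) :
    Y.card ≤ (Fintype.card E) ^ (Fintype.card E) * b := by
  classical
  have hsub : Y ⊆ Finset.univ.biUnion fun f : E → E =>
      Y.filter fun z => ∀ e e', f e = f e' ↔ g z e = g z e' := by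
    intro z hz
    obtain ⟨f, hf⟩ := exists_pattern (g z)
    exact Finset.mem_biUnion.2 ⟨f, Finset.mem_univ _, Finset.mem_filter.2 ⟨hz, hf⟩⟩
  refine (Finset.card_le_card hsub).trans (Finset.card_biUnion_le.trans ?_)
  refine (Finset.sum_le_card_nsmul _ _ b fun f _ => h f _ (Finset.filter_subset _ _)
    fun z hz => (Finset.mem_filter.1 hz).2).trans ?_
  simp

/-- The label of the `i`-th edge of the closed walk `q`. -/
def walkLabel (ℓ : Fin n → Fin n → S) (q : Fin (m + 1) → Fin n) (i : Fin (m + 1)) : S :=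
  ℓ (q i) (q (i + 1))

/-- The exploration of a single circuit: one free start vertex and one free vertex per letter. -/
theorem card_walks_le_of_pattern {A : Type*} [DecidableEq A] {ℓ : Fin n → Fin n → S} {Δ : ℕ}
    (hΔ0 : 1 ≤ Δ) (hΔ : ∀ (k : Fin n) (t : S), {l : Fin n | ℓ k l = t}.ncard ≤ Δ)
    (f : Fin (m + 1) → A) (C : Finset (Fin (m + 1) → Fin n))
    (hC : ∀ q ∈ C, ∀ e e', f e = f e' → walkLabel ℓ q e = walkLabel ℓ q e') :
    C.card ≤ Δ ^ (m + 1) * n ^ (1 + (Finset.univ.image f).card) := by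
  set C' : Finset (Unit × Fin (m + 1) → Fin n) := C.image fun q e => q e.2 with hC'
  have hcard : C'.card = C.card := by
    refine Finset.card_image_of_injective _ fun q q' h => ?_
    funext i
    exact congrFun h ((), i)
  have hcons : IsConsistent ℓ (fun e : Unit × Fin (m + 1) => f e.2) C' := by
    intro q' hq' e e' hee
    obtain ⟨q, hq, rfl⟩ := Finset.mem_image.1 hq'
    exact hC q hq e.2 e'.2 hee
  have h1 := explorationBound_of_forall hcons hΔ0 hΔ (B' := Finset.univ)
    (Finset.disjoint_empty_left _) explorationBound_empty
  rw [Finset.union_empty] at h1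
  have h2 := h1.card_mul_le
  have h3 : Finset.univ.image (fun e : Unit × Fin (m + 1) => f e.2) = Finset.univ.image f := by
    ext a; simp
  rw [h3, hcard] at h2
  simpa using h2

theorem card_walks_few_labels [DecidableEq S] {ℓ : Fin n → Fin n → S} {Δ : ℕ} (hΔ0 : 1 ≤ Δ)
    (hΔ : ∀ (k : Fin n) (t : S), {l : Fin n | ℓ k l = t}.ncard ≤ Δ) (u : ℕ)
    (C : Finset (Fin (m + 1) → Fin n))
    (hC : ∀ q ∈ C, (Finset.univ.image (walkLabel ℓ q)).card ≤ u) :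
    C.card ≤ (m + 1) ^ (m + 1) * (Δ ^ (m + 1) * n ^ (1 + u)) := by
  have := card_le_mul_of_patterns C (walkLabel ℓ) (Δ ^ (m + 1) * n ^ (1 + u)) ?_
  · simpa using this
  intro f Z hZ hf
  rcases Z.eq_empty_or_nonempty with rfl | ⟨q, hq⟩
  · simp
  have hn : 0 < n := Fin.pos (q 0)
  refine (card_walks_le_of_pattern hΔ0 hΔ f Z fun q hq e e' => (hf q hq e e').1).trans ?_
  refine Nat.mul_le_mul_left _ (Nat.pow_le_pow_right hn ?_)
  rw [card_image_eq_of_ker_eq (hf q hq)]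
  exact Nat.add_le_add_left (hC q (hZ hq)) 1

/-- Every letter of a family of circuits occurs at least twice. -/
def IsJointlyMatched {E A : Type*} (f : E → A) : Prop := ∀ e, ∃ e', e' ≠ e ∧ f e' = f e

/-- Every circuit of a family shares a letter with another circuit. -/
def IsCrossMatched {ι K A : Type*} (f : ι × K → A) : Prop :=
  ∀ c, ∃ i, ∃ e : ι × K, e.1 ≠ c ∧ f e = f (c, i)

/-- Four circuits have at most `4 + #letters` free vertices before savings. The target exponent is
`2 * (m + 1) + 2`, so `hr` says exactly that `r` savings are enough. -/
theorem card_le_of_explorationBound {A : Type*} [DecidableEq A] {f : Fin 4 × Fin (m + 1) → A}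
    {C : Finset (Fin 4 × Fin (m + 1) → Fin n)} {Δ : ℕ} {r : ℕ}
    (h : ExplorationBound f C Δ Finset.univ r)
    (hr : (Finset.univ.image f).card + 2 ≤ 2 * (m + 1) + r) :
    C.card ≤ Δ ^ ((m + 1) * 4) * n ^ (2 * (m + 1) + 2) := by
  have h1 := h.card_mul_le
  rcases Nat.eq_zero_or_pos n with rfl | hn
  · have : C.card = 0 := by
      rw [Finset.card_eq_zero, Finset.eq_empty_iff_forall_notMem]
      exact fun q _ => (q (0, 0)).elim0
    simp [this]
  rw [Fintype.card_fin] at h1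
  refine Nat.le_of_mul_le_mul_right (h1.trans ?_) (Nat.pow_pos (n := r) hn)
  rw [mul_assoc, ← pow_add]
  exact Nat.mul_le_mul_left _ (Nat.pow_le_pow_right hn (by omega))

/-- The number of quadruples of circuits that are jointly and cross matched. -/
theorem card_quadruples_le_of_pattern {A : Type*} [DecidableEq A] {ℓ : Fin n → Fin n → S} {Δ : ℕ}
    (hΔ0 : 1 ≤ Δ) (hΔ : ∀ (k : Fin n) (t : S), {l : Fin n | ℓ k l = t}.ncard ≤ Δ)
    {f : Fin 4 × Fin (m + 1) → A} {C : Finset (Fin 4 × Fin (m + 1) → Fin n)}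
    (hC : IsConsistent ℓ f C) (hj : IsJointlyMatched f) (hx : IsCrossMatched f) :
    C.card ≤ Δ ^ ((m + 1) * 4) * n ^ (2 * (m + 1) + 2) := by
  have hbase := explorationBound_of_forall hC hΔ0 hΔ (B' := Finset.univ)
    (Finset.disjoint_empty_left _) explorationBound_empty
  rw [Finset.union_empty] at hbase
  set mult : A → ℕ := fun a => (Finset.univ.filter fun e => f e = a).card with hmult
  set U := Finset.univ.image f with hU
  have hsum : ∑ a ∈ U, mult a = 4 * (m + 1) := by
    rw [← Finset.card_eq_sum_card_image f Finset.univ]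
    simp
  have hm2 : ∀ a ∈ U, 2 ≤ mult a := by
    intro a ha
    obtain ⟨e, -, rfl⟩ := Finset.mem_image.1 ha
    obtain ⟨e', hne, he'⟩ := hj e
    exact Finset.one_lt_card.2 ⟨e, by simp, e', by simp [he'], hne.symm⟩
  have hle : 2 * U.card ≤ 4 * (m + 1) := by
    rw [← hsum, mul_comm, ← smul_eq_mul]
    exact Finset.card_nsmul_le_sum _ _ _ hm2
  -- The multiplicities add up to `4 * (m + 1)` and are at least `2`, so their total excess over `2`
  -- is `4 * (m + 1) - 2 * U.card`.
  have hexc : ∀ B ⊆ U, ∑ a ∈ B, (mult a - 2) + 2 * U.card ≤ 4 * (m + 1) := by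
    intro B hB
    have h1 : ∑ a ∈ B, (mult a - 2) ≤ ∑ a ∈ U, (mult a - 2) := Finset.sum_le_sum_of_subset hB
    have h2 : ∑ a ∈ U, (mult a - 2) + 2 * U.card = ∑ a ∈ U, mult a := by
      rw [mul_comm, ← smul_eq_mul, ← Finset.sum_const, ← Finset.sum_add_distrib]
      exact Finset.sum_congr rfl fun a ha => Nat.sub_add_cancel (hm2 a ha)
    omega
  have hfU : ∀ e, f e ∈ U := fun e => Finset.mem_image_of_mem _ (Finset.mem_univ e)
  by_cases h2 : U.card + 2 ≤ 2 * (m + 1)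
  · exact card_le_of_explorationBound hbase (by omega)
  by_cases h1 : U.card + 1 ≤ 2 * (m + 1)
  · -- one saving is needed: some letter occurs once in its circuit
    obtain ⟨c, i, hci⟩ : ∃ c i, ∀ k, f (c, k) = f (c, i) → k = i := by
      -- If every letter of a circuit is repeated in that circuit, a letter shared by two circuits
      -- occurs at least four times and has excess at least `2`, which is all the excess available.
      by_contra! hcon
      choose i e he1 he2 using hx
      choose k hk1 hk2 using hcon
      have htwo : ∀ c, 4 ≤ mult (f (c, i c)) := by
        intro c
        have hsub : ({(c, i c), (c, k c (i c)), e c, ((e c).1, k (e c).1 (e c).2)} :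
            Finset (Fin 4 × Fin (m + 1))) ⊆ Finset.univ.filter fun e' => f e' = f (c, i c) := by
          intro x hx
          simp only [Finset.mem_insert, Finset.mem_singleton] at hx
          rw [Finset.mem_filter]
          refine ⟨Finset.mem_univ _, ?_⟩
          rcases hx with rfl | rfl | rfl | rfl
          · rfl
          · exact hk1 c (i c)
          · exact he2 c
          · exact (hk1 _ _).trans (he2 c)
        refine le_trans (le_of_eq ?_) (Finset.card_le_card hsub)
        rw [Finset.card_insert_of_notMem, Finset.card_insert_of_notMem,
          Finset.card_insert_of_notMem, Finset.card_singleton]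
        · simp only [Finset.mem_singleton]
          intro h
          exact hk2 _ _ (congrArg Prod.snd h).symm
        · simp only [Finset.mem_insert, Finset.mem_singleton, not_or]
          exact ⟨fun h => he1 c (congrArg Prod.fst h).symm, fun h => he1 c (congrArg Prod.fst h).symm⟩
        · simp only [Finset.mem_insert, Finset.mem_singleton, not_or]
          exact ⟨fun h => hk2 _ _ (congrArg Prod.snd h).symm,
            fun h => he1 c (congrArg Prod.fst h).symm, fun h => he1 c (congrArg Prod.fst h).symm⟩
      -- Two different shared letters would need excess `4`. So one letter is shared by all circuits
      -- and repeated in each of them, which again gives too large an excess.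
      have hsame : ∀ c, f (c, i c) = f (0, i 0) := by
        intro c
        by_contra hne
        have := hexc {f (c, i c), f (0, i 0)} (by
          intro a ha
          simp only [Finset.mem_insert, Finset.mem_singleton] at ha
          rcases ha with rfl | rfl <;> exact hfU _)
        rw [Finset.sum_pair hne] at this
        have a1 := htwo c
        have a2 := htwo 0
        omega
      have hsix : 6 ≤ mult (f (0, i 0)) := by
        have hsub : ((Finset.univ : Finset (Fin 4)).image fun c => (c, i c)) ∪
            ((Finset.univ : Finset (Fin 4)).image fun c => (c, k c (i c))) ⊆
            Finset.univ.filter fun e' => f e' = f (0, i 0) := by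
          intro x hx
          rw [Finset.mem_filter]
          refine ⟨Finset.mem_univ _, ?_⟩
          rcases Finset.mem_union.1 hx with hx | hx
          · obtain ⟨c, -, rfl⟩ := Finset.mem_image.1 hx
            exact hsame c
          · obtain ⟨c, -, rfl⟩ := Finset.mem_image.1 hx
            exact (hk1 _ _).trans (hsame c)
        refine le_trans ?_ (Finset.card_le_card hsub)
        rw [Finset.card_union_of_disjoint, Finset.card_image_of_injective,
          Finset.card_image_of_injective]
        · simp
        · exact fun a b h => congrArg Prod.fst h
        · exact fun a b h => congrArg Prod.fst h
        · rw [Finset.disjoint_left]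
          intro x hx hx'
          obtain ⟨c, -, rfl⟩ := Finset.mem_image.1 hx
          obtain ⟨c', -, h⟩ := Finset.mem_image.1 hx'
          obtain rfl := congrArg Prod.fst h
          exact hk2 _ _ (congrArg Prod.snd h)
      have := hexc {f (0, i 0)} (by simp [hfU])
      rw [Finset.sum_singleton] at this
      omega
    have hs := explorationBound_empty.insert_saving (c := c) hC hΔ0 hΔ (by simp) i hci (by simp)
    have hs' := explorationBound_of_forall hC hΔ0 hΔ (B' := Finset.univ \ {c})
      (B := {c}) Finset.disjoint_sdiff (by simpa using hs)
    rw [Finset.sdiff_union_of_subset (Finset.subset_univ _)] at hs'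
    exact card_le_of_explorationBound hs' (show U.card + 2 ≤ _ by omega)
  · -- every letter occurs exactly twice
    have hpair : ∀ e e', e ≠ e' → f e = f e' → ∀ e'', f e'' = f e → e'' = e ∨ e'' = e' := by
      intro e e' hne hee e'' he''
      by_contra! hcon
      have h3 : 3 ≤ mult (f e) := by
        have hsub : ({e, e', e''} : Finset _) ⊆ Finset.univ.filter fun x => f x = f e := by
          intro x hx
          simp only [Finset.mem_insert, Finset.mem_singleton] at hx
          rcases hx with rfl | rfl | rfl <;> simp [hee, he'']
        refine le_trans (le_of_eq ?_) (Finset.card_le_card hsub)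
        rw [Finset.card_insert_of_notMem, Finset.card_insert_of_notMem, Finset.card_singleton]
        · simpa using hcon.2.symm
        · simpa using ⟨hne, hcon.1.symm⟩
      have := hexc {f e} (by simp [hfU])
      rw [Finset.sum_singleton] at this
      omega
    choose i p hp1 hp2 using hx
    have honce : ∀ c k, f (c, k) = f (c, i c) → k = i c := by
      intro c k hk
      have hne : (c, i c) ≠ p c := fun h => hp1 c (congrArg Prod.fst h).symm
      rcases hpair _ _ hne (hp2 c).symm (c, k) hk with h | h
      · exact congrArg Prod.snd h
      · exact absurd (congrArg Prod.fst h).symm (hp1 c)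
    have hother : ∀ c e, e.1 ≠ c → f e = f (c, i c) → e = p c := by
      intro c e hec he
      have hne : (c, i c) ≠ p c := fun h => hp1 c (congrArg Prod.fst h).symm
      rcases hpair _ _ hne (hp2 c).symm e he with h | h
      · exact absurd (congrArg Prod.fst h) hec
      · exact h
    -- Adding the circuits in increasing order, the shared letter of `c` is new, and hence saves a
    -- factor, whenever its partner lies in a later circuit. The decreasing order treats the other
    -- case.
    have hup : ∀ B : Finset (Fin 4),
        ExplorationBound f C Δ B (B.filter fun c => c < (p c).1).card := by
      intro B
      induction B using Finset.induction_on_max with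
      | empty => simpa using explorationBound_empty
      | insert c B hcB ih =>
        have hc : c ∉ B := fun h => lt_irrefl _ (hcB c h)
        rw [Finset.filter_insert]
        split_ifs with hcp
        · rw [Finset.card_insert_of_notMem (by simp [hc])]
          refine ih.insert_saving hC hΔ0 hΔ hc (i c) (honce c) fun e he hfe => ?_
          have h3 := hother c e (fun h => hc (h ▸ he)) hfe
          have h4 := hcB _ he
          rw [h3] at h4
          exact lt_asymm h4 hcp
        · exact ih.insert hC hΔ0 hΔ hc
    have hdown : ∀ B : Finset (Fin 4),
        ExplorationBound f C Δ B (B.filter fun c => (p c).1 < c).card := by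
      intro B
      induction B using Finset.induction_on_min with
      | empty => simpa using explorationBound_empty
      | insert c B hcB ih =>
        have hc : c ∉ B := fun h => lt_irrefl _ (hcB c h)
        rw [Finset.filter_insert]
        split_ifs with hcp
        · rw [Finset.card_insert_of_notMem (by simp [hc])]
          refine ih.insert_saving hC hΔ0 hΔ hc (i c) (honce c) fun e he hfe => ?_
          have h3 := hother c e (fun h => hc (h ▸ he)) hfe
          have h4 := hcB _ he
          rw [h3] at h4
          exact lt_asymm h4 hcp
        · exact ih.insert hC hΔ0 hΔ hc
    -- Each of the four circuits saves in exactly one of the two orders, so one of the orders has at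
    -- least two savings.
    have htot : (Finset.univ.filter fun c => c < (p c).1).card +
        (Finset.univ.filter fun c => (p c).1 < c).card = 4 := by
      rw [← Finset.card_union_of_disjoint, ← Finset.filter_or, Finset.filter_true_of_mem]
      · simp
      · intro c _
        exact lt_or_gt_of_ne (hp1 c).symm
      · rw [Finset.disjoint_filter]
        exact fun c _ h => lt_asymm h
    rcases le_or_gt 2 (Finset.univ.filter fun c => c < (p c).1).card with h3 | h3
    · exact card_le_of_explorationBound (hup Finset.univ) (show U.card + 2 ≤ _ by omega)
    · exact card_le_of_explorationBound (hdown Finset.univ) (show U.card + 2 ≤ _ by omega)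

theorem card_quadruples_le {ℓ : Fin n → Fin n → S} {Δ : ℕ} (hΔ0 : 1 ≤ Δ)
    (hΔ : ∀ (k : Fin n) (t : S), {l : Fin n | ℓ k l = t}.ncard ≤ Δ)
    (C : Finset (Fin 4 × Fin (m + 1) → Fin n))
    (hC : ∀ q ∈ C, IsJointlyMatched (edgeLabel ℓ q) ∧ IsCrossMatched (edgeLabel ℓ q)) :
    C.card ≤ (4 * (m + 1)) ^ (4 * (m + 1)) * (Δ ^ ((m + 1) * 4) * n ^ (2 * (m + 1) + 2)) := by
  have := card_le_mul_of_patterns C (edgeLabel ℓ) (Δ ^ ((m + 1) * 4) * n ^ (2 * (m + 1) + 2)) ?_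
  · simpa using this
  intro f Z hZ hf
  rcases Z.eq_empty_or_nonempty with rfl | ⟨q, hq⟩
  · simp
  refine card_quadruples_le_of_pattern hΔ0 hΔ (f := f) (fun q hq e e' => (hf q hq e e').1) ?_ ?_
  · intro e
    obtain ⟨e', h1, h2⟩ := (hC q (hZ hq)).1 e
    exact ⟨e', h1, (hf q hq _ _).2 h2⟩
  · intro c
    obtain ⟨i, e, h1, h2⟩ := (hC q (hZ hq)).2 c
    exact ⟨i, e, h1, (hf q hq _ _).2 h2⟩

end CircuitCounts

/-! ### Moments of the spectral distributions -/

/-- Every letter of `g` occurs exactly twice. -/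
def PairMatched {E A : Type*} (g : E → A) : Prop := ∀ e, {e' | g e' = g e}.ncard = 2

/-- The number of pair-matched closed walks of length `m + 1`. -/
noncomputable def LinkFunction.numPairMatched {S : Type u} (L : LinkFunction S) (m n : ℕ) : ℕ :=
  {q : Fin (m + 1) → Fin n | PairMatched (walkLabel (L n) q)}.ncard

/-- The normalised numbers of pair-matched closed walks of length `h` converge to `β h`. -/
def LinkFunction.HasPairLimits {S : Type u} (L : LinkFunction S) (β : ℕ → ℝ) : Prop :=
  β 0 = 1 ∧ ∀ m : ℕ, Tendsto
    (fun n : ℕ => (L.numPairMatched m n : ℝ) / (n * Real.sqrt n ^ (m + 1))) atTop (𝓝 (β (m + 1)))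

theorem pairMatched_iff_card {E A : Type*} [Fintype E] [DecidableEq A] {g : E → A} :
    PairMatched g ↔ ∀ e, (Finset.univ.filter fun e' => g e' = g e).card = 2 := by
  refine forall_congr' fun e => ?_
  rw [← Set.ncard_coe_finset]
  simp

section Products

variable {Ω : Type w} [MeasurableSpace Ω] {P : Measure Ω} [IsProbabilityMeasure P]
  {S : Type u} {T : Type v} {x : S → Ω → ℝ} {y : T → Ω → ℝ}

/-- This is where `LY` drops out. If no letter of `s` is single, each class of `t = r ∘ s` has at
least two elements. By `hmany` there are too many classes of `t` for any of them to be larger, so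
the classes of `s` and `t` are the same pairs and only second moments occur. A single letter of `s`
makes the expectation vanish. -/
theorem integral_prod_eq_ite {E : Type*} [Fintype E] [DecidableEq S] [DecidableEq T]
    (hx : HasBoundedMoments P x) (hx0 : ∀ s, ∫ ω, x s ω ∂P = 0) (hy : HasBoundedMoments P y)
    (hxy : IndepFun (fun ω s => x s ω) (fun ω t => y t ω) P)
    (s : E → S) (t : E → T) (r : S → T) (hr : ∀ e, t e = r (s e))
    (hmany : Fintype.card E ≤ 2 * (Finset.univ.image t).card) :
    (PairMatched s → ∫ ω, ∏ e, (x (s e) ω * y (t e) ω) ∂P = 1) ∧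
    (¬ PairMatched s → ∫ ω, ∏ e, (x (s e) ω * y (t e) ω) ∂P = 0) := by
  rw [integral_prod_mul_eq hx.measurable hx.indep hy.measurable hy.indep hxy]
  by_cases hj : IsJointlyMatched s
  · -- then both words are pair matched
    have hsub : ∀ e, (Finset.univ.filter fun e' => s e' = s e) ⊆
        (Finset.univ.filter fun e' => t e' = t e) := by
      intro e e' he'
      simp only [Finset.mem_filter, Finset.mem_univ, true_and] at he' ⊢
      rw [hr, hr, he']
    have htwo : ∀ e, 2 ≤ (Finset.univ.filter fun e' => s e' = s e).card := by
      intro e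
      obtain ⟨e', hne, he'⟩ := hj e
      exact Finset.one_lt_card.2 ⟨e, by simp, e', by simp [he'], hne.symm⟩
    have ht2 : ∀ a ∈ Finset.univ.image t, 2 ≤ (Finset.univ.filter fun e' => t e' = a).card := by
      intro a ha
      obtain ⟨e, -, rfl⟩ := Finset.mem_image.1 ha
      exact (htwo e).trans (Finset.card_le_card (hsub e))
    have hsum : ∑ a ∈ Finset.univ.image t, (Finset.univ.filter fun e' => t e' = a).card
        = ∑ _a ∈ Finset.univ.image t, 2 := by
      refine le_antisymm ?_ (Finset.sum_le_sum ht2)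
      rw [← Finset.card_eq_sum_card_image, Finset.sum_const, smul_eq_mul, mul_comm]
      exact hmany
    have ht : ∀ e, (Finset.univ.filter fun e' => t e' = t e).card = 2 := by
      intro e
      exact ((Finset.sum_eq_sum_iff_of_le ht2).1 hsum.symm (t e)
        (Finset.mem_image_of_mem _ (Finset.mem_univ _))).symm
    have hs : ∀ e, (Finset.univ.filter fun e' => s e' = s e).card = 2 := fun e =>
      le_antisymm ((Finset.card_le_card (hsub e)).trans (ht e).le) (htwo e)
    refine ⟨fun _ => ?_, fun h => absurd (pairMatched_iff_card.2 hs) h⟩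
    rw [wordMoment_eq_one hx.second fun e _ => hs e, wordMoment_eq_one hy.second fun e _ => ht e,
      one_mul]
  · unfold IsJointlyMatched at hj
    push Not at hj
    obtain ⟨e₀, he₀⟩ := hj
    have h0 : wordMoment P x Finset.univ s = 0 :=
      wordMoment_eq_zero hx0 (Finset.mem_univ e₀) fun e _ h => by
        by_contra hne
        exact he₀ e hne h
    refine ⟨fun h => ?_, fun _ => by rw [h0, zero_mul]⟩
    have h2 := pairMatched_iff_card.1 h e₀
    have h1 : (Finset.univ.filter fun e' => s e' = s e₀) = {e₀} := by
      ext e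
      simp only [Finset.mem_filter, Finset.mem_univ, true_and, Finset.mem_singleton]
      exact ⟨fun h => by_contra fun hne => he₀ e hne h, fun h => h ▸ rfl⟩
    rw [h1] at h2
    simp at h2

/-- The integral of a product of four centred circuit products. -/
theorem integral_prod_centered {m : ℕ} {C : ℝ} {z : Fin 4 × Fin (m + 1) → Ω → ℝ}
    (hC : ∀ F : Finset (Fin 4 × Fin (m + 1)), Integrable (fun ω => ∏ e ∈ F, z e ω) P ∧
      |∫ ω, ∏ e ∈ F, z e ω ∂P| ≤ C) :
    Integrable (fun ω => ∏ c, ((∏ i, z (c, i) ω) - ∫ ω, ∏ i, z (c, i) ω ∂P)) P ∧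
    ∫ ω, ∏ c, ((∏ i, z (c, i) ω) - ∫ ω, ∏ i, z (c, i) ω ∂P) ∂P
      = ∑ B : Finset (Fin 4), (∫ ω, ∏ e ∈ circuitVertices m B, z e ω ∂P) *
        ∏ c ∈ Finset.univ \ B, (-∫ ω, ∏ e ∈ circuitVertices m {c}, z e ω ∂P) := by
  have h1 : ∀ ω, ∏ c, ((∏ i, z (c, i) ω) - ∫ ω, ∏ i, z (c, i) ω ∂P)
      = ∑ B : Finset (Fin 4), (∏ e ∈ circuitVertices m B, z e ω) *
        ∏ c ∈ Finset.univ \ B, (-∫ ω, ∏ e ∈ circuitVertices m {c}, z e ω ∂P) := by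
    intro ω
    simp_rw [sub_eq_add_neg]
    rw [Finset.prod_add, Finset.powerset_univ]
    refine Finset.sum_congr rfl fun B _ => ?_
    congr 1
    · rw [circuitVertices, Finset.prod_product]
    · refine Finset.prod_congr rfl fun c _ => ?_
      simp [circuitVertices, Finset.prod_product]
  simp_rw [h1]
  have hint : ∀ B : Finset (Fin 4), Integrable (fun ω => (∏ e ∈ circuitVertices m B, z e ω) *
        ∏ c ∈ Finset.univ \ B, (-∫ ω, ∏ e ∈ circuitVertices m {c}, z e ω ∂P)) P :=
    fun B => (hC _).1.mul_const _
  refine ⟨integrable_finsetSum _ fun B _ => hint B, ?_⟩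
  rw [integral_finsetSum _ fun B _ => hint B]
  exact Finset.sum_congr rfl fun B _ => integral_mul_const _ _

/-- The expansion has `2 ^ 4` terms, each bounded by one factor `C` for the circuits in `B` and at
most four more for the centrings. -/
theorem abs_integral_prod_centered_le {m : ℕ} {C : ℝ} (hC1 : 1 ≤ C)
    {z : Fin 4 × Fin (m + 1) → Ω → ℝ}
    (hC : ∀ F : Finset (Fin 4 × Fin (m + 1)), Integrable (fun ω => ∏ e ∈ F, z e ω) P ∧
      |∫ ω, ∏ e ∈ F, z e ω ∂P| ≤ C) :
    |∫ ω, ∏ c, ((∏ i, z (c, i) ω) - ∫ ω, ∏ i, z (c, i) ω ∂P) ∂P| ≤ 16 * C ^ 5 := by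
  rw [(integral_prod_centered hC).2]
  refine (Finset.abs_sum_le_sum_abs _ _).trans ?_
  have hB : ∀ B ∈ (Finset.univ : Finset (Finset (Fin 4))),
      |(∫ ω, ∏ e ∈ circuitVertices m B, z e ω ∂P) *
        ∏ c ∈ Finset.univ \ B, (-∫ ω, ∏ e ∈ circuitVertices m {c}, z e ω ∂P)| ≤ C ^ 5 := by
    intro B _
    rw [abs_mul, Finset.abs_prod]
    have h1 : ∏ c ∈ Finset.univ \ B, |-∫ ω, ∏ e ∈ circuitVertices m {c}, z e ω ∂P| ≤ C ^ 4 := by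
      calc _ ≤ ∏ _c ∈ Finset.univ \ B, C :=
            Finset.prod_le_prod (fun _ _ => abs_nonneg _) fun c _ => by
              rw [abs_neg]; exact (hC _).2
        _ = C ^ (Finset.univ \ B).card := by rw [Finset.prod_const]
        _ ≤ C ^ 4 := pow_le_pow_right₀ hC1 ((Finset.card_le_univ _).trans (by simp))
    calc _ ≤ C * C ^ 4 := mul_le_mul (hC _).2 h1
            (Finset.prod_nonneg fun _ _ => abs_nonneg _) (by linarith)
      _ = C ^ 5 := by ring
  refine (Finset.sum_le_card_nsmul _ _ _ hB).trans (le_of_eq ?_)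
  rw [Finset.card_univ, Fintype.card_finset, Fintype.card_fin, nsmul_eq_mul]
  norm_num

/-- A letter of `s` that occurs only once annihilates every term of the expansion. A circuit that
shares no letter of `t` with the others shares no letter of `s` either; its product then splits off,
and its centring cancels it. -/
theorem integral_prod_centered_eq_zero {m : ℕ} {C : ℝ}
    (hx : HasBoundedMoments P x) (hx0 : ∀ s, ∫ ω, x s ω ∂P = 0) (hy : HasBoundedMoments P y)
    (hxy : IndepFun (fun ω s => x s ω) (fun ω t => y t ω) P)
    (s : Fin 4 × Fin (m + 1) → S) (t : Fin 4 × Fin (m + 1) → T) (r : S → T)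
    (hr : ∀ e, t e = r (s e))
    (hC : ∀ F : Finset (Fin 4 × Fin (m + 1)),
      Integrable (fun ω => ∏ e ∈ F, (x (s e) ω * y (t e) ω)) P ∧
      |∫ ω, ∏ e ∈ F, (x (s e) ω * y (t e) ω) ∂P| ≤ C)
    (h : ¬ (IsJointlyMatched s ∧ IsCrossMatched t)) :
    ∫ ω, ∏ c, ((∏ i, (x (s (c, i)) ω * y (t (c, i)) ω)) -
      ∫ ω, ∏ i, (x (s (c, i)) ω * y (t (c, i)) ω) ∂P) ∂P = 0 := by
  classical
  rw [(integral_prod_centered (z := fun e ω => x (s e) ω * y (t e) ω) hC).2]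
  simp_rw [integral_prod_mul_eq hx.measurable hx.indep hy.measurable hy.indep hxy]
  rw [not_and_or] at h
  rcases h with h | h
  · unfold IsJointlyMatched at h
    push Not at h
    obtain ⟨e₀, he₀⟩ := h
    have hz : ∀ F : Finset (Fin 4 × Fin (m + 1)), e₀ ∈ F → wordMoment P x F s = 0 := fun F hF =>
      wordMoment_eq_zero hx0 hF fun e _ h => by_contra fun hne => he₀ e hne h
    refine Finset.sum_eq_zero fun B _ => ?_
    by_cases hB : e₀.1 ∈ B
    · rw [hz _ (by simpa [circuitVertices] using hB), zero_mul, zero_mul]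
    · refine mul_eq_zero_of_right _ (Finset.prod_eq_zero (i := e₀.1) (by simpa using hB) ?_)
      rw [hz _ (by simp [circuitVertices]), zero_mul, neg_zero]
  · unfold IsCrossMatched at h
    push Not at h
    obtain ⟨c, hc⟩ := h
    set J : Finset (Fin 4) → ℝ := fun B =>
      wordMoment P x (circuitVertices m B) s * wordMoment P y (circuitVertices m B) t with hJ
    have hmul : ∀ B, c ∉ B → J (insert c B) = J B * J {c} := by
      intro B hB
      have ht : ∀ e ∈ circuitVertices m B, ∀ g ∈ circuitVertices m {c}, t e ≠ t g := by
        intro e he g hg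
        have h1 : e.1 ∈ B := by simpa [circuitVertices] using he
        have h2 : g.1 = c := Finset.mem_singleton.1 (Finset.mem_product.1 hg).1
        have h3 := hc g.2 e (fun h => hB (h ▸ h1))
        rwa [← h2] at h3
      have hs : ∀ e ∈ circuitVertices m B, ∀ g ∈ circuitVertices m {c}, s e ≠ s g := by
        intro e he g hg heq
        exact ht e he g hg (by rw [hr, hr, heq])
      simp only [hJ]
      rw [circuitVertices_insert, wordMoment_union hs, wordMoment_union ht]
      ring
    change ∑ B : Finset (Fin 4), J B * ∏ c ∈ Finset.univ \ B, (-J {c}) = 0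
    -- The terms of `B` and of `insert c B`, for `c ∉ B`, are opposite.
    rw [← Finset.powerset_univ, ← Finset.insert_erase (Finset.mem_univ c),
      Finset.sum_powerset_insert (Finset.notMem_erase _ _), ← Finset.sum_add_distrib]
    refine Finset.sum_eq_zero fun B hB => ?_
    have hcB : c ∉ B := fun h => Finset.notMem_erase c _ (Finset.mem_powerset.1 hB h)
    rw [Finset.insert_erase (Finset.mem_univ c), hmul B hcB]
    have : Finset.univ \ B = insert c (Finset.univ \ insert c B) := by
      ext a
      by_cases h : a = c
      · simp [h, hcB]
      · simp [h]
    rw [this, Finset.prod_insert (by simp)]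
    ring

end Products

/-- Random variables whose fourth moments are `O(n⁻²)` tend to zero almost surely. -/
theorem ae_tendsto_zero_of_fourth_moment {Ω : Type w} [MeasurableSpace Ω] {P : Measure Ω}
    {f : ℕ → Ω → ℝ} (hint : ∀ n, Integrable (fun ω => f n ω ^ 4) P) {C : ℝ}
    (hf : ∀ n, ∫ ω, f n ω ^ 4 ∂P ≤ C / (n : ℝ) ^ 2) :
    ∀ᵐ ω ∂P, Tendsto (fun n => f n ω) atTop (𝓝 0) := by
  have hpos : ∀ n ω, 0 ≤ f n ω ^ 4 := fun n ω => by positivity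
  have h1 : ∫⁻ ω, ∑' n, ENNReal.ofReal (f n ω ^ 4) ∂P ≠ ⊤ := by
    rw [lintegral_tsum fun n => (hint n).aestronglyMeasurable.aemeasurable.ennreal_ofReal]
    have h2 : ∀ n, ∫⁻ ω, ENNReal.ofReal (f n ω ^ 4) ∂P = ENNReal.ofReal (∫ ω, f n ω ^ 4 ∂P) :=
      fun n => (ofReal_integral_eq_lintegral_ofReal (hint n)
        (Eventually.of_forall fun ω => hpos n ω)).symm
    simp_rw [h2]
    have hs : Summable fun n : ℕ => C / (n : ℝ) ^ 2 := by
      simpa [div_eq_mul_inv] using (Real.summable_nat_pow_inv.2 one_lt_two).mul_left C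
    have hs' : Summable fun n => ∫ ω, f n ω ^ 4 ∂P :=
      Summable.of_nonneg_of_le (fun n => integral_nonneg fun ω => hpos n ω) hf hs
    rw [← ENNReal.ofReal_tsum_of_nonneg (fun n => integral_nonneg fun ω => hpos n ω) hs']
    exact ENNReal.ofReal_ne_top
  have hmeas : AEMeasurable (fun ω => ∑' n, ENNReal.ofReal (f n ω ^ 4)) P :=
    AEMeasurable.ennreal_tsum fun n => (hint n).aestronglyMeasurable.aemeasurable.ennreal_ofReal
  filter_upwards [ae_lt_top' hmeas h1] with ω hω
  have h3 := ENNReal.tendsto_atTop_zero_of_tsum_ne_top hω.ne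
  have h4 : Tendsto (fun n => f n ω ^ 4) atTop (𝓝 0) := by
    have := (ENNReal.tendsto_toReal ENNReal.zero_ne_top).comp h3
    refine this.congr fun n => ?_
    simp [ENNReal.toReal_ofReal (hpos n ω)]
  rw [tendsto_zero_iff_abs_tendsto_zero]
  have h5 := (Real.continuous_sqrt.comp Real.continuous_sqrt).tendsto 0 |>.comp h4
  simp only [Function.comp_apply, Real.sqrt_zero] at h5
  refine h5.congr fun n => ?_
  simp only [Function.comp_apply]
  rw [show f n ω ^ 4 = (f n ω ^ 2) ^ 2 by ring, Real.sqrt_sq (sq_nonneg _), Real.sqrt_sq_eq_abs]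

/-! ### Convergence of the moments -/

section MomentConvergence

variable {Ω : Type w} [MeasurableSpace Ω] {P : Measure Ω}
  {S : Type u} {T : Type v} {x : S → Ω → ℝ} {y : T → Ω → ℝ}
  {LX : LinkFunction S} {LY : LinkFunction T} {ρ : ℕ → S → T}

/-- The normalised Schur-Hadamard product of two patterned matrices. -/
noncomputable def hadamardMatrix (LX : LinkFunction S) (LY : LinkFunction T) (x : S → Ω → ℝ)
    (y : T → Ω → ℝ) (n : ℕ) (ω : Ω) : Matrix (Fin n) (Fin n) ℝ :=
  (Real.sqrt n)⁻¹ • (patterned LX x n ω ⊙ patterned LY y n ω)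

/-- The contribution of the closed walk `q` to the trace of a power. -/
def walkProduct (LX : LinkFunction S) (LY : LinkFunction T) (x : S → Ω → ℝ) (y : T → Ω → ℝ)
    {m n : ℕ} (q : Fin (m + 1) → Fin n) (ω : Ω) : ℝ :=
  ∏ i, (x (walkLabel (LX n) q i) ω * y (walkLabel (LY n) q i) ω)

theorem trace_hadamardMatrix_pow (m n : ℕ) (ω : Ω) :
    (hadamardMatrix LX LY x y n ω ^ (m + 1)).trace / n
      = (∑ q : Fin (m + 1) → Fin n, walkProduct LX LY x y q ω) / (n * Real.sqrt n ^ (m + 1)) := by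
  rw [trace_pow_eq_sum_closed]
  have : ∀ q : Fin (m + 1) → Fin n,
      ∏ k, hadamardMatrix LX LY x y n ω (q k) (q (k + 1))
        = ((Real.sqrt n)⁻¹) ^ (m + 1) * walkProduct LX LY x y q ω := by
    intro q
    have h1 : ∀ k, hadamardMatrix LX LY x y n ω (q k) (q (k + 1)) = (Real.sqrt n)⁻¹ *
        (x (walkLabel (LX n) q k) ω * y (walkLabel (LY n) q k) ω) := fun k => rfl
    simp_rw [h1]
    rw [Finset.prod_mul_distrib, Finset.prod_const]
    simp [walkProduct]
  simp_rw [this]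
  rw [← Finset.mul_sum, inv_pow, mul_comm (n : ℝ), ← div_div]
  congr 1
  rw [div_eq_inv_mul]

theorem isHermitian_hadamardMatrix (hX : LX.IsSymmetric)
    (hρ : ∀ (n : ℕ) (i j : Fin n), LY n i j = ρ n (LX n i j)) (n : ℕ) (ω : Ω) :
    (hadamardMatrix LX LY x y n ω).IsHermitian := by
  ext i j
  change (Real.sqrt n)⁻¹ * (x (LX n j i) ω * y (LY n j i) ω)
    = (Real.sqrt n)⁻¹ * (x (LX n i j) ω * y (LY n i j) ω)
  rw [hρ n i j, hρ n j i, hX n i j]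

theorem exists_pos_propertyB {L : LinkFunction S} (h : L.PropertyB) :
    ∃ Δ : ℕ, 1 ≤ Δ ∧ ∀ (n : ℕ) (k : Fin n) (t : S), {l : Fin n | L n k l = t}.ncard ≤ Δ := by
  obtain ⟨Δ, hΔ⟩ := h
  exact ⟨Δ + 1, by omega, fun n k t => (hΔ n k t).trans (Nat.le_succ _)⟩

variable [IsProbabilityMeasure P]

theorem measurable_walkProduct (hx : HasBoundedMoments P x) (hy : HasBoundedMoments P y) {m n : ℕ}
    (q : Fin (m + 1) → Fin n) : Measurable (walkProduct LX LY x y q) :=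
  Finset.measurable_fun_prod _ fun _ _ => (hx.measurable _).mul (hy.measurable _)

/-- A walk with more than `m / 2` labels of `LY` contributes exactly `1` or `0`, according to
whether it is pair-matched for `LX`. Each of the remaining walks has an error at most `C + 1`, and
they are few by `card_walks_few_labels`. -/
theorem exists_bound_integral_sum_walkProduct (hx : HasBoundedMoments P x)
    (hx0 : ∀ s, ∫ ω, x s ω ∂P = 0) (hy : HasBoundedMoments P y)
    (hxy : IndepFun (fun ω s => x s ω) (fun ω t => y t ω) P)
    (hρ : ∀ (n : ℕ) (i j : Fin n), LY n i j = ρ n (LX n i j)) (hB : LY.PropertyB) (m : ℕ) :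
    ∃ C : ℝ, ∀ n : ℕ, |∫ ω, ∑ q : Fin (m + 1) → Fin n, walkProduct LX LY x y q ω ∂P
      - LX.numPairMatched m n| ≤ C * (n : ℝ) ^ (1 + m / 2) := by
  classical
  obtain ⟨Δ, hΔ0, hΔ⟩ := exists_pos_propertyB hB
  obtain ⟨C, hC1, hC⟩ := exists_bound_prod_mul hx hy (m + 1)
  refine ⟨(C + 1) * ((m + 1) ^ (m + 1) * Δ ^ (m + 1) : ℕ), fun n => ?_⟩
  have hCq : ∀ q : Fin (m + 1) → Fin n, Integrable (walkProduct LX LY x y q) P ∧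
      |∫ ω, walkProduct LX LY x y q ω ∂P| ≤ C := fun q =>
    hC (Fin (m + 1)) Finset.univ (walkLabel (LX n) q) (walkLabel (LY n) q) (by simp)
  rw [integral_finsetSum _ fun q _ => (hCq q).1]
  have hnum : (LX.numPairMatched m n : ℝ)
      = ∑ q : Fin (m + 1) → Fin n, if PairMatched (walkLabel (LX n) q) then 1 else 0 := by
    rw [LinkFunction.numPairMatched, Finset.sum_boole, ← Set.ncard_coe_finset]
    simp
  rw [hnum, ← Finset.sum_sub_distrib]
  set few : Finset (Fin (m + 1) → Fin n) := Finset.univ.filter fun q =>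
    (Finset.univ.image (walkLabel (LY n) q)).card ≤ m / 2 with hfew
  have hterm : ∀ q : Fin (m + 1) → Fin n,
      |∫ ω, walkProduct LX LY x y q ω ∂P - if PairMatched (walkLabel (LX n) q) then 1 else 0|
        ≤ if q ∈ few then C + 1 else 0 := by
    intro q
    split_ifs with h1 h2 h2
    · refine (abs_sub _ _).trans ?_
      have := (hCq q).2
      simp only [abs_one]
      linarith
    · have h3 : m + 1 ≤ 2 * (Finset.univ.image (walkLabel (LY n) q)).card := by
        simp only [hfew, Finset.mem_filter, Finset.mem_univ, true_and, not_le] at h2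
        omega
      have h4 := (integral_prod_eq_ite hx hx0 hy hxy (walkLabel (LX n) q) (walkLabel (LY n) q)
        (ρ n) (fun e => hρ n _ _) (by simpa using h3)).1 h1
      have h5 : ∫ ω, walkProduct LX LY x y q ω ∂P = 1 := h4
      simp [h5]
    · have := (hCq q).2
      simp only [sub_zero]
      linarith
    · have h3 : m + 1 ≤ 2 * (Finset.univ.image (walkLabel (LY n) q)).card := by
        simp only [hfew, Finset.mem_filter, Finset.mem_univ, true_and, not_le] at h2
        omega
      have h4 := (integral_prod_eq_ite hx hx0 hy hxy (walkLabel (LX n) q) (walkLabel (LY n) q)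
        (ρ n) (fun e => hρ n _ _) (by simpa using h3)).2 h1
      have h5 : ∫ ω, walkProduct LX LY x y q ω ∂P = 0 := h4
      simp [h5]
  refine (Finset.abs_sum_le_sum_abs _ _).trans ((Finset.sum_le_sum fun q _ => hterm q).trans ?_)
  rw [← Finset.sum_filter, Finset.sum_const, nsmul_eq_mul, Finset.filter_univ_mem, mul_comm,
    mul_assoc]
  refine mul_le_mul_of_nonneg_left ?_ (by linarith)
  have := card_walks_few_labels hΔ0 (hΔ n) (m / 2) few fun q hq => by
    simpa [hfew] using hq
  calc (few.card : ℝ) ≤ (((m + 1) ^ (m + 1) * (Δ ^ (m + 1) * n ^ (1 + m / 2)) : ℕ) : ℝ) := by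
        exact_mod_cast this
    _ = _ := by push_cast; ring

/-- The fourth power expands over quadruples of closed walks, and only the jointly and cross matched
ones contribute. -/
theorem exists_bound_fourth_moment (hx : HasBoundedMoments P x)
    (hx0 : ∀ s, ∫ ω, x s ω ∂P = 0) (hy : HasBoundedMoments P y)
    (hxy : IndepFun (fun ω s => x s ω) (fun ω t => y t ω) P)
    (hρ : ∀ (n : ℕ) (i j : Fin n), LY n i j = ρ n (LX n i j)) (hB : LY.PropertyB) (m : ℕ) :
    ∃ C : ℝ, 0 ≤ C ∧ ∀ n : ℕ,
      Integrable (fun ω => (∑ q : Fin (m + 1) → Fin n, walkProduct LX LY x y q ω -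
        ∫ ω, ∑ q : Fin (m + 1) → Fin n, walkProduct LX LY x y q ω ∂P) ^ 4) P ∧
      ∫ ω, (∑ q : Fin (m + 1) → Fin n, walkProduct LX LY x y q ω -
        ∫ ω, ∑ q : Fin (m + 1) → Fin n, walkProduct LX LY x y q ω ∂P) ^ 4 ∂P
        ≤ C * (n : ℝ) ^ (2 * (m + 1) + 2) := by
  classical
  obtain ⟨Δ, hΔ0, hΔ⟩ := exists_pos_propertyB hB
  obtain ⟨C, hC1, hC⟩ := exists_bound_prod_mul hx hy (4 * (m + 1))
  refine ⟨16 * C ^ 5 * ((4 * (m + 1)) ^ (4 * (m + 1)) * Δ ^ ((m + 1) * 4) : ℕ), by positivity,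
    fun n => ?_⟩
  have hCq : ∀ q : Fin (m + 1) → Fin n, Integrable (walkProduct LX LY x y q) P := fun q =>
    (hC (Fin (m + 1)) Finset.univ (walkLabel (LX n) q) (walkLabel (LY n) q) (by simp)).1
  set W : (Fin (m + 1) → Fin n) → Ω → ℝ := fun q ω =>
    walkProduct LX LY x y q ω - ∫ ω, walkProduct LX LY x y q ω ∂P with hW
  have hexp : ∀ ω, (∑ q : Fin (m + 1) → Fin n, walkProduct LX LY x y q ω -
        ∫ ω, ∑ q : Fin (m + 1) → Fin n, walkProduct LX LY x y q ω ∂P) ^ 4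
      = ∑ Q : Fin 4 → Fin (m + 1) → Fin n, ∏ c, W (Q c) ω := by
    intro ω
    rw [integral_finsetSum _ fun q _ => hCq q, ← Finset.sum_sub_distrib, Fintype.sum_pow]
  have hz : ∀ (Q : Fin 4 → Fin (m + 1) → Fin n) (F : Finset (Fin 4 × Fin (m + 1))),
      Integrable (fun ω => ∏ e ∈ F, (x (edgeLabel (LX n) (fun e => Q e.1 e.2) e) ω *
        y (edgeLabel (LY n) (fun e => Q e.1 e.2) e) ω)) P ∧
      |∫ ω, ∏ e ∈ F, (x (edgeLabel (LX n) (fun e => Q e.1 e.2) e) ω *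
        y (edgeLabel (LY n) (fun e => Q e.1 e.2) e) ω) ∂P| ≤ C := fun Q F =>
    hC _ F _ _ ((Finset.card_le_univ _).trans (by simp))
  have hint : ∀ Q : Fin 4 → Fin (m + 1) → Fin n, Integrable (fun ω => ∏ c, W (Q c) ω) P :=
    fun Q => (integral_prod_centered (hz Q)).1
  simp_rw [hexp]
  refine ⟨integrable_finsetSum _ fun Q _ => hint Q, ?_⟩
  rw [integral_finsetSum _ fun Q _ => hint Q]
  set good : Finset (Fin 4 → Fin (m + 1) → Fin n) := Finset.univ.filter fun Q =>
    IsJointlyMatched (edgeLabel (LX n) (fun e : Fin 4 × Fin (m + 1) => Q e.1 e.2)) ∧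
    IsCrossMatched (edgeLabel (LY n) (fun e : Fin 4 × Fin (m + 1) => Q e.1 e.2)) with hgood
  have hterm : ∀ Q : Fin 4 → Fin (m + 1) → Fin n,
      ∫ ω, ∏ c, W (Q c) ω ∂P ≤ if Q ∈ good then 16 * C ^ 5 else 0 := by
    intro Q
    split_ifs with hQ
    · exact (le_abs_self _).trans (abs_integral_prod_centered_le hC1 (hz Q))
    · have h0 := integral_prod_centered_eq_zero hx hx0 hy hxy
        (edgeLabel (LX n) (fun e : Fin 4 × Fin (m + 1) => Q e.1 e.2))
        (edgeLabel (LY n) (fun e : Fin 4 × Fin (m + 1) => Q e.1 e.2)) (ρ n)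
        (fun e => hρ n _ _) (hz Q) (fun h => hQ (Finset.mem_filter.2 ⟨Finset.mem_univ _, h⟩))
      exact le_of_eq h0
  refine (Finset.sum_le_sum fun Q _ => hterm Q).trans ?_
  rw [← Finset.sum_filter, Finset.sum_const, nsmul_eq_mul, Finset.filter_univ_mem, mul_comm,
    mul_assoc (16 * C ^ 5)]
  refine mul_le_mul_of_nonneg_left ?_ (by positivity)
  -- Joint matching passes from `LX` to `LY`, so the counting is done with the labels of `LY`, for
  -- which Property B is available.
  have h1 := card_quadruples_le hΔ0 (hΔ n)
    (good.image fun Q (e : Fin 4 × Fin (m + 1)) => Q e.1 e.2) (by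
      intro q hq
      obtain ⟨Q, hQ, rfl⟩ := Finset.mem_image.1 hq
      obtain ⟨hj, hcross⟩ := (Finset.mem_filter.1 hQ).2
      refine ⟨fun e => ?_, hcross⟩
      obtain ⟨e', hne, he'⟩ := hj e
      refine ⟨e', hne, ?_⟩
      have h2 : ∀ e, edgeLabel (LY n) (fun e : Fin 4 × Fin (m + 1) => Q e.1 e.2) e
        = ρ n (edgeLabel (LX n) (fun e : Fin 4 × Fin (m + 1) => Q e.1 e.2) e) := fun e => hρ n _ _
      rw [h2, h2, he'])
  rw [Finset.card_image_of_injective _ (fun Q Q' h => by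
    funext c i
    exact congrFun h (c, i))] at h1
  calc (good.card : ℝ) ≤ (((4 * (m + 1)) ^ (4 * (m + 1)) *
        (Δ ^ ((m + 1) * 4) * n ^ (2 * (m + 1) + 2)) : ℕ) : ℝ) := by exact_mod_cast h1
    _ = _ := by push_cast; ring

/-- The error `C n ^ (1 + m / 2)` is smaller than the normalisation by a factor of order `√n`,
because `2 * (m / 2) ≤ m`. -/
theorem tendsto_integral_moment (hx : HasBoundedMoments P x)
    (hx0 : ∀ s, ∫ ω, x s ω ∂P = 0) (hy : HasBoundedMoments P y)
    (hxy : IndepFun (fun ω s => x s ω) (fun ω t => y t ω) P)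
    (hρ : ∀ (n : ℕ) (i j : Fin n), LY n i j = ρ n (LX n i j)) (hB : LY.PropertyB)
    {β : ℕ → ℝ} (hβ : LX.HasPairLimits β) (m : ℕ) :
    Tendsto (fun n : ℕ => (∫ ω, ∑ q : Fin (m + 1) → Fin n, walkProduct LX LY x y q ω ∂P) /
      (n * Real.sqrt n ^ (m + 1))) atTop (𝓝 (β (m + 1))) := by
  obtain ⟨C, hC⟩ := exists_bound_integral_sum_walkProduct hx hx0 hy hxy hρ hB m
  have hdiff : Tendsto (fun n : ℕ => (∫ ω, ∑ q : Fin (m + 1) → Fin n, walkProduct LX LY x y q ω ∂P) /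
      (n * Real.sqrt n ^ (m + 1)) - LX.numPairMatched m n / (n * Real.sqrt n ^ (m + 1))) atTop
      (𝓝 0) := by
    have hlim : Tendsto (fun n : ℕ => C / Real.sqrt n) atTop (𝓝 0) :=
      tendsto_const_nhds.div_atTop (Real.tendsto_sqrt_atTop.comp tendsto_natCast_atTop_atTop)
    refine squeeze_zero_norm' ?_ hlim
    filter_upwards [eventually_ge_atTop 1] with n hn
    have hn1 : (1 : ℝ) ≤ n := by exact_mod_cast hn
    have hr1 : 1 ≤ Real.sqrt n := Real.one_le_sqrt.2 hn1
    have hr0 : 0 < Real.sqrt n := by linarith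
    have hC0 : 0 ≤ C := by
      have h1 := (abs_nonneg _).trans (hC 1)
      simpa using h1
    rw [← sub_div, norm_div, Real.norm_eq_abs, Real.norm_of_nonneg (by positivity),
      div_le_div_iff₀ (by positivity) hr0]
    have hpow : (n : ℝ) ^ (m / 2) ≤ Real.sqrt n ^ m := by
      conv_lhs => rw [← Real.sq_sqrt (show (0 : ℝ) ≤ n by linarith), ← pow_mul]
      exact pow_le_pow_right₀ hr1 (by omega)
    calc _ ≤ C * (n : ℝ) ^ (1 + m / 2) * Real.sqrt n := mul_le_mul_of_nonneg_right (hC n) hr0.le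
      _ = C * (n * ((n : ℝ) ^ (m / 2) * Real.sqrt n)) := by ring
      _ ≤ C * (n * (Real.sqrt n ^ m * Real.sqrt n)) := by gcongr
      _ = _ := by ring
  have := hdiff.add (hβ.2 m)
  simpa using this

/-- The moments of the spectral distributions converge almost surely. -/
theorem ae_tendsto_trace_pow (hx : HasBoundedMoments P x)
    (hx0 : ∀ s, ∫ ω, x s ω ∂P = 0) (hy : HasBoundedMoments P y)
    (hxy : IndepFun (fun ω s => x s ω) (fun ω t => y t ω) P)
    (hρ : ∀ (n : ℕ) (i j : Fin n), LY n i j = ρ n (LX n i j)) (hB : LY.PropertyB)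
    {β : ℕ → ℝ} (hβ : LX.HasPairLimits β) (h : ℕ) :
    ∀ᵐ ω ∂P, Tendsto (fun n : ℕ => (hadamardMatrix LX LY x y n ω ^ h).trace / n) atTop
      (𝓝 (β h)) := by
  rcases h with _ | m
  · refine Eventually.of_forall fun ω => ?_
    rw [hβ.1]
    refine tendsto_const_nhds.congr' ?_
    filter_upwards [eventually_ge_atTop 1] with n hn
    have : (n : ℝ) ≠ 0 := by
      have : n ≠ 0 := by omega
      exact_mod_cast this
    simp [this]
  obtain ⟨C, hC0, hC⟩ := exists_bound_fourth_moment hx hx0 hy hxy hρ hB m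
  set Z : ℕ → Ω → ℝ := fun n ω => ∑ q : Fin (m + 1) → Fin n, walkProduct LX LY x y q ω with hZ
  set a : ℕ → ℝ := fun n => n * Real.sqrt n ^ (m + 1) with ha
  have hmain := ae_tendsto_zero_of_fourth_moment (P := P)
    (f := fun n ω => (Z n ω - ∫ ω, Z n ω ∂P) / a n) (C := C)
    (fun n => by
      simp_rw [div_pow]
      exact (hC n).1.div_const _)
    (fun n => by
      simp_rw [div_pow]
      rw [integral_div]
      rcases Nat.eq_zero_or_pos n with rfl | hn
      · simp [ha]
      have hn0 : (0 : ℝ) < n := by exact_mod_cast hn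
      -- Dividing the fourth moment bound, of order `n ^ (2 * (m + 1) + 2)`, by this power leaves `C
      -- / n ^ 2`, which is summable.
      have hpow : a n ^ 4 = (n : ℝ) ^ (2 * (m + 1) + 4) := by
        have h2 : Real.sqrt n ^ (m + 1) * Real.sqrt n ^ (m + 1) = (n : ℝ) ^ (m + 1) := by
          rw [← mul_pow, Real.mul_self_sqrt hn0.le]
        calc a n ^ 4 = (n : ℝ) ^ 4 * ((Real.sqrt n ^ (m + 1) * Real.sqrt n ^ (m + 1)) *
              (Real.sqrt n ^ (m + 1) * Real.sqrt n ^ (m + 1))) := by simp only [ha]; ring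
          _ = _ := by rw [h2]; ring
      rw [hpow, div_le_div_iff₀ (by positivity) (by positivity)]
      calc _ ≤ C * (n : ℝ) ^ (2 * (m + 1) + 2) * (n : ℝ) ^ 2 :=
            mul_le_mul_of_nonneg_right (hC n).2 (by positivity)
        _ = _ := by ring)
  filter_upwards [hmain] with ω hω
  have hlim := hω.add (tendsto_integral_moment hx hx0 hy hxy hρ hB hβ m)
  rw [zero_add] at hlim
  refine hlim.congr fun n => ?_
  rw [trace_hadamardMatrix_pow, ← add_div]
  congr 1
  simp only [hZ]
  ring

theorem measurable_trace_hadamardMatrix_pow (hx : HasBoundedMoments P x)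
    (hy : HasBoundedMoments P y) (h n : ℕ) :
    Measurable fun ω => (hadamardMatrix LX LY x y n ω ^ h).trace / n := by
  rcases h with _ | m
  · simp
  simp_rw [trace_hadamardMatrix_pow]
  exact (Finset.measurable_fun_sum _ fun q _ => measurable_walkProduct hx hy q).div_const _

/-! ### From moments to spectral distributions -/

theorem esd_eq_empiricalMeasure {n : ℕ} {A : Matrix (Fin n) (Fin n) ℝ} (hA : A.IsHermitian)
    (t : ℝ) : esd A t = (empiricalMeasure hA.eigenvalues).real (Iic t) := by
  rw [esd_eq_card_eigenvalues hA, empiricalMeasure_real_Iic]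

theorem integral_pow_empiricalMeasure {n : ℕ} {A : Matrix (Fin n) (Fin n) ℝ} (hA : A.IsHermitian)
    (h : ℕ) : ∫ r, r ^ h ∂empiricalMeasure hA.eigenvalues = (A ^ h).trace / n := by
  rw [integral_empiricalMeasure, trace_pow_eq_sum_eigenvalues_pow hA]

/-- The index is shifted by one because a `0 × 0` matrix has no eigenvalues to carry a probability
measure. -/
theorem hasMomentLimits_eigenvalues {A : (n : ℕ) → Matrix (Fin n) (Fin n) ℝ}
    (hA : ∀ n, (A n).IsHermitian) {β : ℕ → ℝ}
    (h : ∀ k : ℕ, Tendsto (fun n : ℕ => (A n ^ k).trace / n) atTop (𝓝 (β k))) :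
    HasMomentLimits β fun n => empiricalMeasure (hA (n + 1)).eigenvalues := by
  refine ⟨fun n => isProbabilityMeasure_empiricalMeasure (by omega) _,
    fun n k => integrable_empiricalMeasure (by omega) _ _, fun k => ?_⟩
  simp_rw [integral_pow_empiricalMeasure]
  exact (tendsto_add_atTop_iff_nat (f := fun n : ℕ => (A n ^ k).trace / n) 1).2 (h k)

theorem hasLSDAlmostSurely_hadamardMatrix (hx : HasBoundedMoments P x)
    (hx0 : ∀ s, ∫ ω, x s ω ∂P = 0) (hy : HasBoundedMoments P y)
    (hxy : IndepFun (fun ω s => x s ω) (fun ω t => y t ω) P) (hX : LX.IsSymmetric)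
    (hρ : ∀ (n : ℕ) (i j : Fin n), LY n i j = ρ n (LX n i j)) (hB : LY.PropertyB)
    {β : ℕ → ℝ} (hβ : LX.HasPairLimits β) {μ : Measure ℝ} (hμ : MomentsDetermine β μ) :
    HasLSDAlmostSurely P (hadamardMatrix LX LY x y) μ := by
  have h1 : ∀ᵐ ω ∂P, ∀ h : ℕ, Tendsto (fun n : ℕ => (hadamardMatrix LX LY x y n ω ^ h).trace / n)
      atTop (𝓝 (β h)) := ae_all_iff.2 fun h => ae_tendsto_trace_pow hx hx0 hy hxy hρ hB hβ h
  filter_upwards [h1] with ω hω t ht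
  have hA := fun n => isHermitian_hadamardMatrix (x := x) (y := y) hX hρ n ω
  have h2 := hμ _ (hasMomentLimits_eigenvalues hA hω) t ht
  refine (tendsto_add_atTop_iff_nat 1).1 (h2.congr fun n => ?_)
  rw [esd_eq_empiricalMeasure (hA (n + 1))]

/-- The argument goes through finitely many moments, which are visibly measurable functions of `ω`;
the almost sure statement alone would require measurability of the spectral distribution function.
-/
theorem hasLSDInProbability_hadamardMatrix (hx : HasBoundedMoments P x)
    (hx0 : ∀ s, ∫ ω, x s ω ∂P = 0) (hy : HasBoundedMoments P y)
    (hxy : IndepFun (fun ω s => x s ω) (fun ω t => y t ω) P) (hX : LX.IsSymmetric)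
    (hρ : ∀ (n : ℕ) (i j : Fin n), LY n i j = ρ n (LX n i j)) (hB : LY.PropertyB)
    {β : ℕ → ℝ} (hβ : LX.HasPairLimits β) {μ : Measure ℝ} (hμ : MomentsDetermine β μ) :
    HasLSDInProbability P (hadamardMatrix LX LY x y) μ := by
  intro t ht
  rw [tendstoInMeasure_iff_dist]
  intro ε hε
  obtain ⟨H, η, hη, hclose⟩ := hμ.exists_finite ht hε
  have hmoment : ∀ h : ℕ, Tendsto (fun n => P {ω | η ≤
      dist ((hadamardMatrix LX LY x y n ω ^ h).trace / n) (β h)}) atTop (𝓝 0) := by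
    intro h
    have h1 := tendstoInMeasure_of_tendsto_ae
      (fun n => (measurable_trace_hadamardMatrix_pow (LX := LX) (LY := LY) hx hy h n).aestronglyMeasurable)
      (ae_tendsto_trace_pow hx hx0 hy hxy hρ hB hβ h)
    rw [tendstoInMeasure_iff_dist] at h1
    exact h1 η hη
  have hsum : Tendsto (fun n => ∑ h ∈ Finset.range (H + 1), P {ω | η ≤
      dist ((hadamardMatrix LX LY x y n ω ^ h).trace / n) (β h)}) atTop (𝓝 0) := by
    have := tendsto_finsetSum (Finset.range (H + 1)) fun h _ => hmoment h
    simpa using this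
  refine tendsto_of_tendsto_of_tendsto_of_le_of_le' tendsto_const_nhds hsum
    (Eventually.of_forall fun _ => zero_le) ?_
  filter_upwards [eventually_ge_atTop 1] with n hn
  refine le_trans (measure_mono ?_) (measure_biUnion_finset_le _ _)
  intro ω hω
  by_contra hcon
  simp only [mem_iUnion, mem_ofPred_eq, not_exists, not_le, Finset.mem_range] at hcon
  have hA := isHermitian_hadamardMatrix (x := x) (y := y) hX hρ n ω
  have h2 := hclose (empiricalMeasure hA.eigenvalues)
    (isProbabilityMeasure_empiricalMeasure (by omega) _)
    (fun h => integrable_empiricalMeasure (by omega) _ _) (fun h hh => by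
      rw [integral_pow_empiricalMeasure]
      exact hcon h (by omega))
  rw [← esd_eq_empiricalMeasure] at h2
  exact absurd h2 (not_lt.2 hω)

end MomentConvergence

/-! ### Approximation of the input by inputs with bounded moments -/

section Approximation

variable {Ω : Type w} [MeasurableSpace Ω] {P : Measure Ω}
  {S : Type u} {T : Type v} {x : S → Ω → ℝ} {y : T → Ω → ℝ}
  {LX : LinkFunction S} {LY : LinkFunction T} {ρ : ℕ → S → T}

/-- Inputs that can be approximated in mean square, uniformly, by inputs with bounded moments. -/
structure IsApproximable (P : Measure Ω) (x : S → Ω → ℝ) : Prop where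
  measurable : ∀ s, Measurable (x s)
  integrable_sq : ∀ s, Integrable (fun ω => x s ω ^ 2) P
  second : ∀ s, ∫ ω, x s ω ^ 2 ∂P = 1
  approx : ∀ ε > 0, ∃ g : S → ℝ → ℝ, (∀ s, Measurable (g s)) ∧
    HasBoundedMoments P (fun s ω => g s (x s ω)) ∧
    (∀ s, ∫ ω, g s (x s ω) ∂P = ∫ ω, x s ω ∂P) ∧
    ∀ s, ∫ ω, (x s ω - g s (x s ω)) ^ 2 ∂P ≤ ε

theorem HasBoundedMoments.integrable_sq (hx : HasBoundedMoments P x) (s : S) :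
    Integrable (fun ω => x s ω ^ 2) P := by
  obtain ⟨C, hC⟩ := hx.bound 2
  simpa [sq_abs] using (hC s).1

theorem HasBoundedMoments.isApproximable (hx : HasBoundedMoments P x) : IsApproximable P x :=
  ⟨hx.measurable, hx.integrable_sq, hx.second, fun ε hε =>
    ⟨fun _ r => r, fun _ => measurable_id, hx, fun _ => rfl, fun s => by simpa using hε.le⟩⟩

theorem IsStandardInput.integral_sq (hx : IsStandardInput P x) (s : S) :
    ∫ ω, x s ω ^ 2 ∂P = 1 := by
  rw [← variance_of_integral_eq_zero (hx.measurable s).aemeasurable (hx.mean s), hx.variance s]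

theorem AssumptionA3.hasBoundedMoments (hx : AssumptionA3 P x) : HasBoundedMoments P x :=
  ⟨hx.1.measurable, hx.1.indep, hx.1.integral_sq, hx.2⟩

theorem integrable_pow_of_bounded [IsFiniteMeasure P] {f : Ω → ℝ} (hf : Measurable f) {B : ℝ}
    (hB : ∀ᵐ ω ∂P, |f ω| ≤ B) (k : ℕ) : Integrable (fun ω => |f ω| ^ k) P := by
  refine Integrable.of_bound (C := B ^ k) (by fun_prop) ?_
  filter_upwards [hB] with ω hω
  rw [Real.norm_of_nonneg (by positivity)]
  exact pow_le_pow_left₀ (abs_nonneg _) hω k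

theorem integral_pow_le_of_bounded [IsProbabilityMeasure P] {f : Ω → ℝ} (hf : Measurable f) {B : ℝ}
    (hB : ∀ᵐ ω ∂P, |f ω| ≤ B) (k : ℕ) : ∫ ω, |f ω| ^ k ∂P ≤ B ^ k := by
  have h1 : ∫ ω, |f ω| ^ k ∂P ≤ ∫ _ω, B ^ k ∂P := by
    refine integral_mono_ae (integrable_pow_of_bounded hf hB k) (integrable_const _) ?_
    filter_upwards [hB] with ω hω
    exact pow_le_pow_left₀ (abs_nonneg _) hω k
  simpa using h1

theorem AssumptionA1.hasBoundedMoments [IsProbabilityMeasure P] (hx : AssumptionA1 P x) :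
    HasBoundedMoments P x := by
  obtain ⟨hs, B, hB⟩ := hx
  exact ⟨hs.measurable, hs.indep, hs.integral_sq, fun k => ⟨B ^ k, fun s =>
    ⟨integrable_pow_of_bounded (hs.measurable s) (hB s) k,
      integral_pow_le_of_bounded (hs.measurable s) (hB s) k⟩⟩⟩

/-- The truncation of a real number at level `M`. -/
noncomputable def truncate (M : ℕ) (r : ℝ) : ℝ := if |r| ≤ M then r else 0

theorem measurable_truncate (M : ℕ) : Measurable (truncate M) :=
  Measurable.ite (measurableSet_le (by fun_prop) measurable_const) measurable_id measurable_const

theorem abs_truncate_le (M : ℕ) (r : ℝ) : |truncate M r| ≤ M := by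
  unfold truncate
  split_ifs with h
  · exact h
  · simp

theorem abs_truncate_le_abs (M : ℕ) (r : ℝ) : |truncate M r| ≤ |r| := by
  unfold truncate
  split_ifs with h
  · rfl
  · simp

theorem tendsto_truncate (r : ℝ) : Tendsto (fun M => truncate M r) atTop (𝓝 r) := by
  obtain ⟨M, hM⟩ := exists_nat_ge |r|
  refine tendsto_const_nhds.congr' ?_
  filter_upwards [eventually_ge_atTop M] with N hN
  have : |r| ≤ N := hM.trans (by exact_mod_cast hN)
  simp [truncate, this]

theorem mul_truncate (M : ℕ) (r : ℝ) : r * truncate M r = truncate M r ^ 2 := by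
  unfold truncate
  split_ifs <;> ring

/-- Truncate at a level `M`, then recentre and rescale to variance `1`. As all variables have the
same law, one level and one function `g` serve for all labels. -/
theorem AssumptionA2.isApproximable [IsProbabilityMeasure P] [Nonempty S]
    (hx : AssumptionA2 P x) : IsApproximable P x := by
  obtain ⟨hs, hid⟩ := hx
  have hsq : ∀ s, Integrable (fun ω => x s ω ^ 2) P := fun s => (hs.memLp s).integrable_sq
  have hint : ∀ s, Integrable (x s) P := fun s => (hs.memLp s).integrable (by norm_num)
  refine ⟨hs.measurable, hsq, hs.integral_sq, fun ε hε => ?_⟩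
  obtain ⟨s₀⟩ := ‹Nonempty S›
  set X := x s₀ with hX
  have hXm : Measurable X := hs.measurable s₀
  set a : ℕ → ℝ := fun M => ∫ ω, truncate M (X ω) ∂P with ha
  set b : ℕ → ℝ := fun M => ∫ ω, truncate M (X ω) ^ 2 ∂P with hb
  have hal : Tendsto a atTop (𝓝 0) := by
    rw [← hs.mean s₀]
    refine tendsto_integral_of_dominated_convergence (fun ω => |X ω|)
      (fun M => ((measurable_truncate M).comp hXm).aestronglyMeasurable) (hint s₀).abs
      (fun M => Eventually.of_forall fun ω => abs_truncate_le_abs M _)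
      (Eventually.of_forall fun ω => tendsto_truncate _)
  have hbl : Tendsto b atTop (𝓝 1) := by
    rw [← hs.integral_sq s₀]
    refine tendsto_integral_of_dominated_convergence (fun ω => X ω ^ 2)
      (fun M => (((measurable_truncate M).comp hXm).pow_const 2).aestronglyMeasurable) (hsq s₀)
      (fun M => Eventually.of_forall fun ω => ?_)
      (Eventually.of_forall fun ω => (tendsto_truncate _).pow 2)
    rw [Real.norm_of_nonneg (sq_nonneg _)]
    exact sq_le_sq.2 (abs_truncate_le_abs M _)
  have hvl : Tendsto (fun M => b M - a M ^ 2) atTop (𝓝 1) := by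
    simpa using hbl.sub (hal.pow 2)
  -- This is the mean square error `E (X - g X)²`: both second moments are `1`, and `E (X g X) = b M
  -- / σ` because `r * truncate M r = truncate M r ^ 2` and `E X = 0`.
  have hel : Tendsto (fun M => 2 - 2 * (b M / Real.sqrt (b M - a M ^ 2))) atTop (𝓝 0) := by
    have h1 : Tendsto (fun M => Real.sqrt (b M - a M ^ 2)) atTop (𝓝 1) := by
      have := (Real.continuous_sqrt.tendsto 1).comp hvl
      rwa [Real.sqrt_one] at this
    have h2 := ((hbl.div h1 one_ne_zero).const_mul 2).const_sub 2
    simpa using h2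
  obtain ⟨M, hM1, hM2⟩ := ((hvl.eventually (lt_mem_nhds (show (1 / 2 : ℝ) < 1 by norm_num))).and
    (hel.eventually (gt_mem_nhds hε))).exists
  set σ := Real.sqrt (b M - a M ^ 2) with hσ
  have hv0 : 0 < b M - a M ^ 2 := by linarith
  have hσ0 : 0 < σ := Real.sqrt_pos.2 hv0
  have hσ2 : σ ^ 2 = b M - a M ^ 2 := Real.sq_sqrt hv0.le
  set g : ℝ → ℝ := fun r => (truncate M r - a M) / σ with hg
  have hgm : Measurable g := ((measurable_truncate M).sub_const _).div_const _
  have hgb : ∀ r, |g r| ≤ (M + |a M|) / σ := by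
    intro r
    rw [hg, abs_div, abs_of_pos hσ0]
    refine div_le_div_of_nonneg_right ((abs_sub _ _).trans ?_) hσ0.le
    exact add_le_add (abs_truncate_le M r) le_rfl
  have hht : Integrable (fun ω => truncate M (X ω)) P :=
    Integrable.of_bound (C := M) ((measurable_truncate M).comp hXm).aestronglyMeasurable
      (Eventually.of_forall fun ω => abs_truncate_le M _)
  have hht2 : Integrable (fun ω => truncate M (X ω) ^ 2) P := by
    refine (hsq s₀).mono' (((measurable_truncate M).comp hXm).pow_const 2).aestronglyMeasurable
      (Eventually.of_forall fun ω => ?_)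
    rw [Real.norm_of_nonneg (sq_nonneg _)]
    exact sq_le_sq.2 (abs_truncate_le_abs M _)
  have htr : ∀ (φ : ℝ → ℝ), Measurable φ → ∀ s, ∫ ω, φ (x s ω) ∂P = ∫ ω, φ (X ω) ∂P :=
    fun φ hφ s => ((hid s s₀).comp hφ).integral_eq
  have hmean : ∫ ω, g (X ω) ∂P = 0 := by
    simp only [hg]
    rw [integral_div, integral_sub hht (integrable_const _)]
    simp [ha]
  have hsec : ∫ ω, g (X ω) ^ 2 ∂P = 1 := by
    have h1 : ∀ ω, g (X ω) ^ 2 = (truncate M (X ω) ^ 2 - 2 * a M * truncate M (X ω) + a M ^ 2) /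
        σ ^ 2 := by
      intro ω
      simp only [hg]
      rw [div_pow]
      congr 1
      ring
    simp_rw [h1]
    have k1 : Integrable (fun ω => truncate M (X ω) ^ 2 - 2 * a M * truncate M (X ω)) P :=
      hht2.sub (hht.const_mul _)
    rw [integral_div, integral_add k1 (integrable_const _), integral_sub hht2 (hht.const_mul _), integral_const_mul]
    simp only [integral_const, probReal_univ, one_smul]
    rw [div_eq_one_iff_eq (by positivity), hσ2]
    simp only [ha, hb]
    ring
  have herr : ∫ ω, (X ω - g (X ω)) ^ 2 ∂P = 2 - 2 * (b M / σ) := by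
    have hgi : Integrable (fun ω => g (X ω)) P := (hht.sub (integrable_const _)).div_const _
    have hg2 : Integrable (fun ω => g (X ω) ^ 2) P := by
      have := integrable_pow_of_bounded (P := P) (hgm.comp hXm)
        (Eventually.of_forall fun ω => hgb (X ω)) 2
      simpa [sq_abs] using this
    have hXh : ∀ ω, X ω * g (X ω) = truncate M (X ω) ^ 2 / σ - a M / σ * X ω := by
      intro ω
      simp only [hg]
      rw [← mul_truncate]
      ring
    have h1 : ∀ ω, (X ω - g (X ω)) ^ 2 = X ω ^ 2 - 2 * (X ω * g (X ω)) + g (X ω) ^ 2 := fun ω => by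
      ring
    have hXg : Integrable (fun ω => X ω * g (X ω)) P := by
      simp_rw [hXh]
      exact (hht2.div_const _).sub ((hint s₀).const_mul _)
    simp_rw [h1]
    have k1 : Integrable (fun ω => X ω ^ 2 - 2 * (X ω * g (X ω))) P :=
      (hsq s₀).sub (hXg.const_mul _)
    rw [integral_add k1 hg2, integral_sub (hsq s₀) (hXg.const_mul _),
      hsec, integral_const_mul, hs.integral_sq s₀]
    simp_rw [hXh]
    rw [integral_sub (hht2.div_const _) ((hint s₀).const_mul _), integral_div, integral_const_mul,
      hs.mean s₀]
    simp only [hb]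
    ring
  refine ⟨fun _ => g, fun _ => hgm, ⟨fun s => hgm.comp (hs.measurable s), ?_, fun s => ?_,
    fun k => ⟨((M + |a M|) / σ) ^ k, fun s => ⟨?_, ?_⟩⟩⟩, fun s => ?_, fun s => ?_⟩
  · exact hs.indep.comp (fun _ => g) fun _ => hgm
  · rw [htr (fun r => g r ^ 2) (hgm.pow_const 2) s, hsec]
  · exact integrable_pow_of_bounded (hgm.comp (hs.measurable s))
      (Eventually.of_forall fun ω => hgb _) k
  · exact integral_pow_le_of_bounded (hgm.comp (hs.measurable s))
      (Eventually.of_forall fun ω => hgb _) k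
  · rw [htr g hgm s, hmean, hs.mean s]
  · rw [htr (fun r => (r - g r) ^ 2) ((measurable_id.sub hgm).pow_const 2) s, herr]
    exact hM2.le

/-- A monotone function has countably many discontinuities. Convergence for the approximating
matrices is available only at continuity points, and it is needed at `t ± δ`. -/
theorem exists_continuityPoints (μ : Measure ℝ) [IsFiniteMeasure μ] {t : ℝ}
    (ht : ContinuousAt (fun s => μ.real (Iic s)) t) {ε : ℝ} (hε : 0 < ε) :
    ∃ δ > 0, ContinuousAt (fun s => μ.real (Iic s)) (t + δ) ∧
      ContinuousAt (fun s => μ.real (Iic s)) (t - δ) ∧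
      |μ.real (Iic (t + δ)) - μ.real (Iic t)| < ε ∧
      |μ.real (Iic (t - δ)) - μ.real (Iic t)| < ε := by
  have hmono : Monotone fun s => μ.real (Iic s) := fun s s' h =>
    measureReal_mono (Iic_subset_Iic.2 h)
  have hD := hmono.countable_not_continuousAt
  set D := {s | ¬ ContinuousAt (fun s => μ.real (Iic s)) s}
  obtain ⟨δ₀, hδ₀, hclose⟩ := Metric.continuousAt_iff.1 ht ε hε
  have hcount : ((fun δ => t + δ) ⁻¹' D ∪ (fun δ => t - δ) ⁻¹' D).Countable :=
    (hD.preimage (add_right_injective t)).union (hD.preimage (sub_right_injective (b := t)))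
  obtain ⟨δ, hδ1, hδ2⟩ := (hcount.dense_compl ℝ).exists_mem_open isOpen_Ioo
    (nonempty_Ioo.2 hδ₀)
  simp only [mem_compl_iff, mem_union, mem_preimage, not_or] at hδ1
  refine ⟨δ, hδ2.1, not_not.1 hδ1.1, not_not.1 hδ1.2, ?_, ?_⟩
  · have := hclose (x := t + δ) (by simp [Real.dist_eq, abs_of_pos hδ2.1, hδ2.2])
    exact this
  · have := hclose (x := t - δ) (by simp [Real.dist_eq, abs_of_pos hδ2.1, hδ2.2])
    exact this

/-- Write `XY - X'Y' = (X - X')Y + X'(Y - Y')`. Independence turns the second moment of each summand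
into a product, and `(a + b)² ≤ 2a² + 2b²` gives the factor `4`. -/
theorem integral_sq_mul_sub_mul_le [IsProbabilityMeasure P] {X X' Y Y' : Ω → ℝ}
    (hX : Measurable X) (hX' : Measurable X') (hY : Measurable Y) (hY' : Measurable Y')
    (iX : Integrable (fun ω => X ω ^ 2) P) (iX' : Integrable (fun ω => X' ω ^ 2) P)
    (iY : Integrable (fun ω => Y ω ^ 2) P) (iY' : Integrable (fun ω => Y' ω ^ 2) P)
    (h1 : IndepFun (fun ω => X ω - X' ω) Y P) (h2 : IndepFun X' (fun ω => Y ω - Y' ω) P)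
    (hY1 : ∫ ω, Y ω ^ 2 ∂P = 1) (hX1 : ∫ ω, X' ω ^ 2 ∂P = 1) {ε : ℝ}
    (hXX : ∫ ω, (X ω - X' ω) ^ 2 ∂P ≤ ε) (hYY : ∫ ω, (Y ω - Y' ω) ^ 2 ∂P ≤ ε) :
    Integrable (fun ω => (X ω * Y ω - X' ω * Y' ω) ^ 2) P ∧
      ∫ ω, (X ω * Y ω - X' ω * Y' ω) ^ 2 ∂P ≤ 4 * ε := by
  have hsub : ∀ {U V : Ω → ℝ}, Measurable U → Measurable V → Integrable (fun ω => U ω ^ 2) P →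
      Integrable (fun ω => V ω ^ 2) P → Integrable (fun ω => (U ω - V ω) ^ 2) P := by
    intro U V hU hV iU iV
    refine ((iU.const_mul 2).add (iV.const_mul 2)).mono' (by fun_prop)
      (Eventually.of_forall fun ω => ?_)
    rw [Real.norm_of_nonneg (sq_nonneg _)]
    simp only [Pi.add_apply]
    nlinarith [sq_nonneg (U ω + V ω)]
  have sqm : Measurable fun r : ℝ => r ^ 2 := by fun_prop
  have h1' := h1.comp sqm sqm
  have h2' := h2.comp sqm sqm
  have j1 : Integrable (fun ω => (X ω - X' ω) ^ 2 * Y ω ^ 2) P :=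
    h1'.integrable_mul (hsub hX hX' iX iX') iY
  have j2 : Integrable (fun ω => X' ω ^ 2 * (Y ω - Y' ω) ^ 2) P :=
    h2'.integrable_mul iX' (hsub hY hY' iY iY')
  have e1 : ∫ ω, (X ω - X' ω) ^ 2 * Y ω ^ 2 ∂P = ∫ ω, (X ω - X' ω) ^ 2 ∂P := by
    have := h1'.integral_fun_mul_eq_mul_integral (by fun_prop) (by fun_prop)
    simp only [Function.comp_apply] at this
    rw [this, hY1, mul_one]
  have e2 : ∫ ω, X' ω ^ 2 * (Y ω - Y' ω) ^ 2 ∂P = ∫ ω, (Y ω - Y' ω) ^ 2 ∂P := by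
    have := h2'.integral_fun_mul_eq_mul_integral (by fun_prop) (by fun_prop)
    simp only [Function.comp_apply] at this
    rw [this, hX1, one_mul]
  have hle : ∀ ω, (X ω * Y ω - X' ω * Y' ω) ^ 2
      ≤ 2 * ((X ω - X' ω) ^ 2 * Y ω ^ 2) + 2 * (X' ω ^ 2 * (Y ω - Y' ω) ^ 2) := by
    intro ω
    nlinarith [sq_nonneg ((X ω - X' ω) * Y ω - X' ω * (Y ω - Y' ω))]
  have hbd := (j1.const_mul 2).add (j2.const_mul 2)
  have hi : Integrable (fun ω => (X ω * Y ω - X' ω * Y' ω) ^ 2) P := by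
    refine hbd.mono' (by fun_prop) (Eventually.of_forall fun ω => ?_)
    rw [Real.norm_of_nonneg (sq_nonneg _)]
    exact hle ω
  refine ⟨hi, (integral_mono hi hbd hle).trans ?_⟩
  simp only [Pi.add_apply]
  rw [integral_add (j1.const_mul 2) (j2.const_mul 2), integral_const_mul, integral_const_mul, e1, e2]
  linarith

/-- The spectral distribution function at `t` is enclosed between those of the approximating matrix
at `t - δ` and `t + δ`, up to the normalised Frobenius error `R`. The expectation of `R` is small
uniformly in `n`, so Markov's inequality applies. -/
theorem hasLSDInProbability_of_isApproximable [IsProbabilityMeasure P] (hx : IsApproximable P x)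
    (hx0 : ∀ s, ∫ ω, x s ω ∂P = 0) (hy : IsApproximable P y)
    (hxy : IndepFun (fun ω s => x s ω) (fun ω t => y t ω) P) (hX : LX.IsSymmetric)
    (hρ : ∀ (n : ℕ) (i j : Fin n), LY n i j = ρ n (LX n i j)) (hB : LY.PropertyB)
    {β : ℕ → ℝ} (hβ : LX.HasPairLimits β) {μ : Measure ℝ} [IsProbabilityMeasure μ]
    (hμ : MomentsDetermine β μ) :
    HasLSDInProbability P (hadamardMatrix LX LY x y) μ := by
  intro t ht
  rw [tendstoInMeasure_iff_dist]
  intro ε hε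
  obtain ⟨δ, hδ, hc1, hc2, hF1, hF2⟩ := exists_continuityPoints μ ht (show 0 < ε / 3 by linarith)
  rw [ENNReal.tendsto_nhds_zero]
  intro θ hθ
  -- The bound `θ` may be infinite; `θ'` is a real substitute for its half.
  obtain ⟨θ', hθ', hθθ⟩ : ∃ θ' : ℝ, 0 < θ' ∧ ENNReal.ofReal θ' ≤ θ / 2 := by
    obtain ⟨r, hr0, hr⟩ := ENNReal.lt_iff_exists_nnreal_btwn.1 (ENNReal.half_pos hθ.ne')
    exact ⟨r, by exact_mod_cast hr0, by simpa using hr.le⟩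
  -- The `n ^ 2` entries have mean square error at most `4 * κ / n` each, so the expectation of `R`
  -- is at most `4 * κ / δ ^ 2 = θ' * (ε / 3)`.
  set κ := θ' * (ε / 3) * δ ^ 2 / 4 with hκ
  have hκ0 : 0 < κ := by positivity
  obtain ⟨g, hgm, hgB, hg0, hgε⟩ := hx.approx κ hκ0
  obtain ⟨k, hkm, hkB, -, hkε⟩ := hy.approx κ hκ0
  set x' : S → Ω → ℝ := fun s ω => g s (x s ω) with hx'
  set y' : T → Ω → ℝ := fun s ω => k s (y s ω) with hy'
  have hgg : Measurable fun (f : S → ℝ) s => g s (f s) :=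
    measurable_pi_lambda _ fun s => (hgm s).comp (measurable_pi_apply s)
  have hkk : Measurable fun (f : T → ℝ) s => k s (f s) :=
    measurable_pi_lambda _ fun s => (hkm s).comp (measurable_pi_apply s)
  have hxy' : IndepFun (fun ω s => x' s ω) (fun ω t => y' t ω) P := hxy.comp hgg hkk
  have hlim := hasLSDInProbability_hadamardMatrix hgB (fun s => by rw [hg0, hx0]) hkB hxy' hX hρ hB
    hβ hμ
  have hl1 := hlim _ hc1
  have hl2 := hlim _ hc2
  rw [tendstoInMeasure_iff_dist] at hl1 hl2
  have hsum := (hl1 (ε / 3) (by linarith)).add (hl2 (ε / 3) (by linarith))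
  rw [add_zero] at hsum
  set A := hadamardMatrix LX LY x y with hA
  set A' := hadamardMatrix LX LY x' y' with hA'
  set R : ℕ → Ω → ℝ := fun n ω => (∑ i, ∑ j, (A n ω i j - A' n ω i j) ^ 2) / (n * δ ^ 2) with hR
  have hR0 : ∀ n ω, 0 ≤ R n ω := fun n ω => by
    simp only [hR]
    positivity
  have hRint : ∀ n, Integrable (R n) P ∧ ∫ ω, R n ω ∂P ≤ θ' * (ε / 3) := by
    intro n
    have hent : ∀ i j : Fin n, Integrable (fun ω => (A n ω i j - A' n ω i j) ^ 2) P ∧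
        ∫ ω, (A n ω i j - A' n ω i j) ^ 2 ∂P ≤ (n : ℝ)⁻¹ * (4 * κ) := by
      intro i j
      have hp1 : IndepFun (fun ω => x (LX n i j) ω - x' (LX n i j) ω) (y (LY n i j)) P := by
        have hφ : Measurable fun f : S → ℝ => f (LX n i j) - g (LX n i j) (f (LX n i j)) :=
          (measurable_pi_apply _).sub ((hgm _).comp (measurable_pi_apply _))
        exact hxy.comp hφ (measurable_pi_apply (LY n i j))
      have hp2 : IndepFun (x' (LX n i j)) (fun ω => y (LY n i j) ω - y' (LY n i j) ω) P := by
        have hφ : Measurable fun f : T → ℝ => f (LY n i j) - k (LY n i j) (f (LY n i j)) :=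
          (measurable_pi_apply _).sub ((hkm _).comp (measurable_pi_apply _))
        have hψ : Measurable fun f : S → ℝ => g (LX n i j) (f (LX n i j)) :=
          (hgm _).comp (measurable_pi_apply _)
        exact hxy.comp hψ hφ
      have hq := integral_sq_mul_sub_mul_le (hx.measurable (LX n i j)) (hgB.measurable (LX n i j))
        (hy.measurable (LY n i j)) (hkB.measurable (LY n i j)) (hx.integrable_sq _)
        (hgB.integrable_sq _) (hy.integrable_sq _) (hkB.integrable_sq _) hp1 hp2 (hy.second _)
        (hgB.second _) (hgε _) (hkε _)
      have he : ∀ ω, (A n ω i j - A' n ω i j) ^ 2 = (n : ℝ)⁻¹ *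
          (x (LX n i j) ω * y (LY n i j) ω - x' (LX n i j) ω * y' (LY n i j) ω) ^ 2 := by
        intro ω
        have h1 : A n ω i j = (Real.sqrt n)⁻¹ * (x (LX n i j) ω * y (LY n i j) ω) := rfl
        have h2 : A' n ω i j = (Real.sqrt n)⁻¹ * (x' (LX n i j) ω * y' (LY n i j) ω) := rfl
        rw [h1, h2, ← mul_sub, mul_pow, inv_pow, Real.sq_sqrt (Nat.cast_nonneg n)]
      simp_rw [he]
      refine ⟨hq.1.const_mul _, ?_⟩
      rw [integral_const_mul]
      exact mul_le_mul_of_nonneg_left hq.2 (by positivity)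
    have hi : ∀ i : Fin n, Integrable (fun ω => ∑ j, (A n ω i j - A' n ω i j) ^ 2) P := fun i =>
      integrable_finsetSum _ fun j _ => (hent i j).1
    refine ⟨(integrable_finsetSum _ fun i _ => hi i).div_const _, ?_⟩
    simp only [hR]
    rw [integral_div, integral_finsetSum _ fun i _ => hi i]
    simp_rw [integral_finsetSum _ fun j _ => (hent _ j).1]
    rcases Nat.eq_zero_or_pos n with rfl | hn
    · simp
      positivity
    have hn0 : (0 : ℝ) < n := by exact_mod_cast hn
    rw [div_le_iff₀ (by positivity)]
    calc _ ≤ ∑ _i : Fin n, ∑ _j : Fin n, (n : ℝ)⁻¹ * (4 * κ) :=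
          Finset.sum_le_sum fun i _ => Finset.sum_le_sum fun j _ => (hent i j).2
      _ = n * (4 * κ) := by
          rw [Finset.sum_const, Finset.sum_const, Finset.card_univ, Fintype.card_fin, nsmul_eq_mul,
            nsmul_eq_mul, mul_inv_cancel_left₀ hn0.ne']
      _ = _ := by rw [hκ]; ring
  have hR3 : ∀ n, P {ω | ε / 3 ≤ R n ω} ≤ θ / 2 := by
    intro n
    refine le_trans ?_ hθθ
    rw [← ofReal_measureReal]
    refine ENNReal.ofReal_le_ofReal ?_
    have h1 := mul_meas_ge_le_integral_of_nonneg (Eventually.of_forall (hR0 n)) (hRint n).1 (ε / 3)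
    have h2 := h1.trans (hRint n).2
    nlinarith
  filter_upwards [(ENNReal.tendsto_nhds_zero.1 hsum) (θ / 2) (ENNReal.half_pos hθ.ne')] with n hn
  calc P {ω | ε ≤ dist (esd (A n ω) t) (μ.real (Iic t))}
      ≤ P (({ω | ε / 3 ≤ dist (esd (A' n ω) (t + δ)) (μ.real (Iic (t + δ)))} ∪
          {ω | ε / 3 ≤ dist (esd (A' n ω) (t - δ)) (μ.real (Iic (t - δ)))}) ∪
          {ω | ε / 3 ≤ R n ω}) := by
        refine measure_mono fun ω hω => ?_
        by_contra hcon
        simp only [mem_union, mem_ofPred_eq, not_or, not_le] at hcon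
        obtain ⟨⟨k1, k2⟩, k3⟩ := hcon
        have hH := isHermitian_hadamardMatrix (x := x) (y := y) hX hρ n ω
        have hH' := isHermitian_hadamardMatrix (x := x') (y := y') hX hρ n ω
        have u1 := esd_le_esd_add hH hH' t hδ
        have u2 := esd_le_esd_add hH' hH (t - δ) hδ
        have u3 : ∑ i, ∑ j, (hadamardMatrix LX LY x' y' n ω i j - hadamardMatrix LX LY x y n ω i j) ^ 2
            = ∑ i, ∑ j, (hadamardMatrix LX LY x y n ω i j -
              hadamardMatrix LX LY x' y' n ω i j) ^ 2 :=
          Finset.sum_congr rfl fun i _ => Finset.sum_congr rfl fun j _ => by ring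
        rw [u3, sub_add_cancel] at u2
        have u4 : (∑ i, ∑ j, (hadamardMatrix LX LY x y n ω i j -
              hadamardMatrix LX LY x' y' n ω i j) ^ 2) / (n * δ ^ 2) = R n ω := rfl
        rw [u4] at u1 u2
        have hω' : ε ≤ |esd (A n ω) t - μ.real (Iic t)| := hω
        rw [Real.dist_eq] at k1 k2
        rw [abs_lt] at k1 k2 hF1 hF2
        rcases le_abs.1 hω' with h | h
        · linarith [k1.2, hF1.2]
        · linarith [k2.1, hF2.1]
    _ ≤ _ := measure_union_le _ _
    _ ≤ _ := add_le_add (measure_union_le _ _) le_rfl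
    _ ≤ θ / 2 + θ / 2 := add_le_add hn (hR3 n)
    _ = θ := ENNReal.add_halves θ

theorem isApproximable_of_assumption [IsProbabilityMeasure P] [Nonempty S]
    (hx : AssumptionA1 P x ∨ AssumptionA2 P x ∨ AssumptionA3 P x) : IsApproximable P x := by
  rcases hx with h | h | h
  · exact h.hasBoundedMoments.isApproximable
  · exact h.isApproximable
  · exact h.hasBoundedMoments.isApproximable

theorem hasBoundedMoments_of_assumption [IsProbabilityMeasure P]
    (hx : AssumptionA1 P x ∨ AssumptionA3 P x) : HasBoundedMoments P x :=
  hx.elim (fun h => h.hasBoundedMoments) fun h => h.hasBoundedMoments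

theorem LinkFunction.nonempty (L : LinkFunction S) : Nonempty S := ⟨L 1 0 0⟩

theorem LinkFunction.HasPairLimits.isHadamardLSD (hX : LX.IsSymmetric)
    (hρ : ∀ (n : ℕ) (i j : Fin n), LY n i j = ρ n (LX n i j)) (hB : LY.PropertyB)
    {β : ℕ → ℝ} (hβ : LX.HasPairLimits β) {μ : Measure ℝ} [IsProbabilityMeasure μ]
    (hμ : MomentsDetermine β μ) : LinkFunction.IsHadamardLSD.{u, v, w} LX LY μ := by
  intro Ω _ P _ x y hxy
  have := LX.nonempty
  have := LY.nonempty
  refine ⟨fun h1 h2 => ?_, fun h1 h2 => ?_⟩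
  · have hx0 : ∀ s, ∫ ω, x s ω ∂P = 0 := h1.elim (fun h => h.1.mean) fun h => h.1.mean
    exact hasLSDAlmostSurely_hadamardMatrix (hasBoundedMoments_of_assumption h1) hx0
      (hasBoundedMoments_of_assumption h2) hxy hX hρ hB hβ hμ
  · have hx0 : ∀ s, ∫ ω, x s ω ∂P = 0 :=
      h1.elim (fun h => h.1.mean) fun h => h.elim (fun h => h.1.mean) fun h => h.1.mean
    exact hasLSDInProbability_of_isApproximable (isApproximable_of_assumption h1) hx0
      (isApproximable_of_assumption h2) hxy hX hρ hB hβ hμ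

/-- With this second input, a patterned matrix is its own Schur-Hadamard product with the all-ones
matrix, so the statement about `X` alone is a case of the one about products. -/
theorem hasBoundedMoments_one [IsProbabilityMeasure P] :
    HasBoundedMoments P (fun (_ : S) (_ : Ω) => (1 : ℝ)) := by
  refine ⟨fun _ => measurable_const, ?_, fun _ => by simp, fun k => ⟨1, fun _ => by simp⟩⟩
  rw [iIndepFun_iff_measure_inter_preimage_eq_mul]
  intro F sets _
  by_cases h : ∀ i ∈ F, (1 : ℝ) ∈ sets i
  · rw [Finset.prod_congr rfl fun i hi => by rw [preimage_const_of_mem (h i hi)],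
      show (⋂ i ∈ F, (fun _ : Ω => (1 : ℝ)) ⁻¹' sets i) = univ from
        univ_subset_iff.1 (subset_iInter₂ fun i hi => (preimage_const_of_mem (h i hi)).ge)]
    simp
  · push Not at h
    obtain ⟨i, hi, hi'⟩ := h
    have h0 : (fun _ : Ω => (1 : ℝ)) ⁻¹' sets i = ∅ := preimage_const_of_notMem hi'
    rw [Finset.prod_eq_zero hi (by rw [h0, measure_empty])]
    refine measure_mono_null (iInter₂_subset i hi) (by rw [h0, measure_empty])

theorem hadamardMatrix_one (n : ℕ) (ω : Ω) :
    hadamardMatrix LX LX x (fun _ _ => 1) n ω = (Real.sqrt n)⁻¹ • patterned LX x n ω := by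
  ext i j
  simp [hadamardMatrix, patterned]

theorem LinkFunction.HasPairLimits.isLSD (hX : LX.IsSymmetric) (hB : LX.PropertyB)
    {β : ℕ → ℝ} (hβ : LX.HasPairLimits β) {μ : Measure ℝ} [IsProbabilityMeasure μ]
    (hμ : MomentsDetermine β μ) : LinkFunction.IsLSD.{u, w} LX μ := by
  intro Ω _ P _ x
  have := LX.nonempty
  have hxy : IndepFun (fun ω s => x s ω) (fun (_ : Ω) (_ : S) => (1 : ℝ)) P :=
    indepFun_const_right _ _
  have hρ : ∀ (n : ℕ) (i j : Fin n), LX n i j = (fun _ => id : ℕ → S → S) n (LX n i j) :=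
    fun _ _ _ => rfl
  simp_rw [← hadamardMatrix_one]
  refine ⟨fun h1 => ?_, fun h1 => ?_⟩
  · have hx0 : ∀ s, ∫ ω, x s ω ∂P = 0 := h1.elim (fun h => h.1.mean) fun h => h.1.mean
    exact hasLSDAlmostSurely_hadamardMatrix (hasBoundedMoments_of_assumption h1) hx0
      hasBoundedMoments_one hxy hX hρ hB hβ hμ
  · have hx0 : ∀ s, ∫ ω, x s ω ∂P = 0 :=
      h1.elim (fun h => h.1.mean) fun h => h.elim (fun h => h.1.mean) fun h => h.1.mean
    exact hasLSDInProbability_of_isApproximable (isApproximable_of_assumption h1) hx0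
      hasBoundedMoments_one.isApproximable hxy hX hρ hB hβ hμ

end Approximation

/-! ### Words and patterns -/

/-- Every word over an arbitrary alphabet can be relabelled alphabetically. -/
theorem exists_isWord {B : Type*} {h : ℕ} (g : Fin h → B) :
    ∃ w : Fin h → ℕ, IsWord w ∧ ∀ i j, w i = w j ↔ g i = g j := by
  classical
  have hf : ∀ i, ∃ k, g k = g i ∧ ∀ j, g j = g i → k ≤ j := by
    intro i
    have hne : (Finset.univ.filter fun j => g j = g i).Nonempty := ⟨i, by simp⟩
    refine ⟨Finset.min' _ hne, ?_, fun j hj => Finset.min'_le _ _ (by simpa using hj)⟩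
    simpa using Finset.min'_mem _ hne
  choose f hf1 hf2 using hf
  have hfg : ∀ i j, g i = g j → f i = f j := fun i j hij =>
    le_antisymm (hf2 i _ ((hf1 j).trans hij.symm)) (hf2 j _ ((hf1 i).trans hij))
  -- `p` marks the positions of first occurrences. The new letter at `i` is the number of marked
  -- positions before the first occurrence of the old one.
  set p : ℕ → Prop := fun n => ∃ i, (f i : ℕ) = n with hp
  have hcount : ∀ i j, Nat.count p (f i) = Nat.count p (f j) ↔ g i = g j := by
    intro i j
    refine ⟨fun h => ?_, fun h => by rw [hfg i j h]⟩
    have := Nat.count_injective (p := p) ⟨i, rfl⟩ ⟨j, rfl⟩ h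
    rw [← hf1 i, ← hf1 j, Fin.ext this]
  refine ⟨fun i => Nat.count p (f i), fun i a ha => ?_, hcount⟩
  have hfin : ∀ hs : (Set.ofPred p).Finite, a < hs.toFinset.card := fun hs =>
    ha.trans_le (Nat.count_le_card hs _)
  have hlt := Nat.nth_lt_of_lt_count ha
  obtain ⟨j, hj⟩ : p (Nat.nth p a) := Nat.nth_mem a hfin
  refine ⟨f j, ?_, ?_⟩
  · rw [Fin.lt_def, hj]
    exact hlt.trans_le (Fin.le_def.1 (hf2 i i rfl))
  · have : Nat.count p (Nat.nth p a) = a := Nat.count_nth hfin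
    rw [← hj] at this
    change Nat.count p (f (f j)) = a
    rw [hfg (f j) j (hf1 j), this]

instance finite_setoid {α : Type*} [Finite α] : Finite (Setoid α) :=
  Finite.of_injective (fun r : Setoid α => r.r) fun r s h => by
    ext a b
    exact iff_of_eq (congrFun (congrFun h a) b)

theorem PairMatched.congr_ker {E A B : Type*} {f : E → A} {g : E → B} (hf : PairMatched f)
    (h : ∀ e e', f e = f e' ↔ g e = g e') : PairMatched g := by
  intro e
  rw [← hf e]
  congr 1
  ext e'
  exact (h e' e).symm

/-- A pair-matched word uses half as many letters as its length. -/
theorem PairMatched.card_eq {E A : Type*} [Fintype E] [DecidableEq A] {f : E → A}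
    (hf : PairMatched f) : Fintype.card E = 2 * (Finset.univ.image f).card := by
  rw [pairMatched_iff_card] at hf
  rw [← Finset.card_univ, Finset.card_eq_sum_card_image f Finset.univ, mul_comm, ← smul_eq_mul,
    ← Finset.sum_const]
  refine Finset.sum_congr rfl fun a ha => ?_
  obtain ⟨e, -, rfl⟩ := Finset.mem_image.1 ha
  exact hf e

/-- The equivalence relation `r` has classes with two elements. -/
def Setoid.IsPairing {E : Type*} (r : Setoid E) : Prop :=
  PairMatched (Quotient.mk r)

theorem Setoid.isPairing_ker {E A : Type*} {g : E → A} :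
    (Setoid.ker g).IsPairing ↔ PairMatched g := by
  have h : ∀ e e', Quotient.mk (Setoid.ker g) e = Quotient.mk (Setoid.ker g) e' ↔ g e = g e' :=
    fun e e' => Quotient.eq (r := Setoid.ker g)
  exact ⟨fun hr => hr.congr_ker h, fun hg => hg.congr_ker fun e e' => (h e e').symm⟩

namespace LinkFunction

variable {S : Type u} {L : LinkFunction S}

/-- The closed walks with coinciding labels at exactly the pairs of positions given by `r`. -/
def walksWithPattern (L : LinkFunction S) {m : ℕ} (r : Setoid (Fin (m + 1))) (n : ℕ) :
    Set (Fin (m + 1) → Fin n) :=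
  {q | Setoid.ker (walkLabel (L n) q) = r}

theorem numPairMatched_eq_sum {m : ℕ} [Fintype (Setoid (Fin (m + 1)))]
    [DecidablePred (Setoid.IsPairing (E := Fin (m + 1)))] (n : ℕ) :
    L.numPairMatched m n = ∑ r : Setoid (Fin (m + 1)) with r.IsPairing,
      (L.walksWithPattern r n).ncard := by
  classical
  rw [numPairMatched, Set.ncard_eq_toFinset_card', Finset.card_eq_sum_card_fiberwise
    (f := fun q => Setoid.ker (walkLabel (L n) q))
    (t := Finset.univ.filter fun r : Setoid (Fin (m + 1)) => r.IsPairing)]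
  · refine Finset.sum_congr rfl fun r hr => ?_
    rw [← Set.ncard_coe_finset]
    congr 1
    ext q
    simp only [Finset.coe_filter, Set.mem_toFinset, walksWithPattern, Set.mem_ofPred_eq,
      and_iff_right_iff_imp]
    intro h
    rw [← Setoid.isPairing_ker, h]
    exact (Finset.mem_filter.1 hr).2
  · intro q hq
    simpa [Setoid.isPairing_ker] using hq

/-- A pairing of `m + 1` points has `(m + 1) / 2` classes. -/
theorem card_image_mk {m : ℕ} {r : Setoid (Fin (m + 1))} (hr : r.IsPairing)
    [DecidableEq (Quotient r)] :
    m + 1 = 2 * (Finset.univ.image (Quotient.mk r)).card := by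
  simpa using PairMatched.card_eq hr

theorem tendsto_numPairMatched {m k : ℕ} (hk : m + 1 = 2 * k)
    (h : ∀ r : Setoid (Fin (m + 1)), r.IsPairing → ∃ p : ℝ, Tendsto
      (fun n : ℕ => ((L.walksWithPattern r n).ncard : ℝ) / (n : ℝ) ^ (k + 1)) atTop (𝓝 p)) :
    ∃ b : ℝ, Tendsto (fun n : ℕ => (L.numPairMatched m n : ℝ) / (n * Real.sqrt n ^ (m + 1)))
      atTop (𝓝 b) := by
  classical
  haveI := Fintype.ofFinite (Setoid (Fin (m + 1)))
  choose! p hp using h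
  refine ⟨∑ r : Setoid (Fin (m + 1)) with r.IsPairing, p r, ?_⟩
  have := tendsto_finsetSum (Finset.univ.filter fun r : Setoid (Fin (m + 1)) => r.IsPairing)
    fun r hr => hp r (Finset.mem_filter.1 hr).2
  refine this.congr fun n => ?_
  have h2 : (n : ℝ) * Real.sqrt n ^ (m + 1) = (n : ℝ) ^ (k + 1) := by
    rw [hk, pow_mul, Real.sq_sqrt (Nat.cast_nonneg n), pow_succ']
  rw [h2, numPairMatched_eq_sum, ← Finset.sum_div]
  push_cast
  rfl

theorem numPairMatched_eq_zero {m : ℕ} (hm : ¬ Even (m + 1)) (n : ℕ) :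
    L.numPairMatched m n = 0 := by
  classical
  haveI := Fintype.ofFinite (Setoid (Fin (m + 1)))
  rw [numPairMatched_eq_sum]
  refine Finset.sum_eq_zero fun r hr => absurd ?_ hm
  rw [card_image_mk (Finset.mem_filter.1 hr).2]
  exact even_two_mul _

/-- Pair-matched walks are sorted by their pairing, and the limits are added up. There are none of
odd length. -/
theorem exists_hasPairLimits
    (h : ∀ m k : ℕ, m + 1 = 2 * k → ∀ r : Setoid (Fin (m + 1)), r.IsPairing → ∃ p : ℝ, Tendsto
      (fun n : ℕ => ((L.walksWithPattern r n).ncard : ℝ) / (n : ℝ) ^ (k + 1)) atTop (𝓝 p)) :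
    ∃ β, L.HasPairLimits β := by
  have hb : ∀ m : ℕ, ∃ b : ℝ, Tendsto (fun n : ℕ =>
      (L.numPairMatched m n : ℝ) / (n * Real.sqrt n ^ (m + 1))) atTop (𝓝 b) := by
    intro m
    by_cases hm : Even (m + 1)
    · obtain ⟨k, hk⟩ := hm
      exact tendsto_numPairMatched (by omega : m + 1 = 2 * k) (h m k (by omega))
    · exact ⟨0, by simp [numPairMatched_eq_zero hm]⟩
  choose b hb using hb
  exact ⟨fun j => Nat.casesOn j 1 b, rfl, hb⟩

/-- A circuit repeats its first vertex at the end; appending `q 0` to a cyclic walk `q` is a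
bijection between the two descriptions. -/
theorem ncard_circuits {m : ℕ} (w : Fin (m + 1) → ℕ) (n : ℕ) :
    (L.circuits w n).ncard = (L.walksWithPattern (Setoid.ker w) n).ncard := by
  set F : (Fin (m + 1) → Fin n) → (Fin (m + 1 + 1) → Fin n) :=
    fun q => Fin.snoc (α := fun _ => Fin n) q (q 0) with hF
  have hinj : Function.Injective F := by
    intro q q' h
    funext i
    have := congrFun h i.castSucc
    simpa [hF] using this
  have hF1 : ∀ q i, F q (Fin.castSucc i) = q i := fun q i => by simp [hF]
  have hF2 : ∀ q i, F q (Fin.succ i) = q (i + 1) := by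
    intro q i
    rcases eq_or_ne i (Fin.last m) with rfl | hi
    · rw [Fin.succ_last, Fin.last_add_one]
      simp [hF]
    · have : i.succ = (i + 1).castSucc := by
        rw [Fin.ext_iff, Fin.val_castSucc, Fin.val_succ, Fin.val_add_one_of_lt]
        exact lt_of_le_of_ne (Fin.le_last _) hi
      rw [this, hF1]
  rw [← Set.ncard_image_of_injective _ hinj]
  congr 1
  ext π
  simp only [circuits, walksWithPattern, Set.mem_ofPred_eq, Set.mem_image]
  constructor
  · rintro ⟨h0, h⟩
    have hπ : F (fun i => π i.castSucc) = π := by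
      funext i
      refine Fin.lastCases ?_ (fun i => ?_) i
      · simpa [hF] using h0
      · rw [hF1]
    refine ⟨fun i => π i.castSucc, ?_, hπ⟩
    rw [← hπ] at h
    simp_rw [hF1, hF2] at h
    ext i j
    exact (h i j).symm
  · rintro ⟨q, hq, rfl⟩
    refine ⟨?_, fun i j => ?_⟩
    · rw [← Fin.castSucc_zero, hF1]
      simp [hF]
    · simp_rw [hF1, hF2]
      have := congrArg (fun r : Setoid (Fin (m + 1)) => r i j) hq
      exact (iff_of_eq this).symm

theorem WordLimitsExist.exists_hasPairLimits (hL : L.WordLimitsExist) :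
    ∃ β, L.HasPairLimits β := by
  -- The length is freed from the form `2 * k` so that it can be instantiated with `m + 1`.
  have hL' : ∀ (h k : ℕ), h = 2 * k → ∀ w : Fin h → ℕ, IsWord w → IsPairMatched w → ∃ p : ℝ,
      Tendsto (fun n : ℕ => ((L.circuits w n).ncard : ℝ) / (n : ℝ) ^ (k + 1)) atTop (𝓝 p) := by
    rintro _ k rfl w hw hw'
    exact hL k w hw hw'
  refine LinkFunction.exists_hasPairLimits fun m k hk r hr => ?_
  obtain ⟨w, hw, hker⟩ := exists_isWord (Quotient.mk r)
  have hr' : Setoid.ker w = r := by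
    ext i j
    exact (hker i j).trans Quotient.eq
  obtain ⟨p, hp⟩ := hL' (m + 1) k hk w hw (PairMatched.congr_ker hr fun e e' => (hker e e').symm)
  refine ⟨p, hp.congr fun n => ?_⟩
  rw [ncard_circuits, hr']

/-! ### Growth of the limiting moments -/

theorem ncard_walksWithPattern_le {Δ : ℕ} (hΔ0 : 1 ≤ Δ)
    (hΔ : ∀ (n : ℕ) (k : Fin n) (t : S), {l : Fin n | L n k l = t}.ncard ≤ Δ)
    {m k : ℕ} (hk : m + 1 = 2 * k) {r : Setoid (Fin (m + 1))} (hr : r.IsPairing) (n : ℕ) :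
    (L.walksWithPattern r n).ncard ≤ Δ ^ (m + 1) * n ^ (1 + k) := by
  classical
  have hc := card_image_mk hr
  rw [Set.ncard_eq_toFinset_card']
  have := card_walks_le_of_pattern hΔ0 (hΔ n) (Quotient.mk r)
    (L.walksWithPattern r n).toFinset ?_
  · rwa [show (Finset.univ.image (Quotient.mk r)).card = k by omega] at this
  · intro q hq e e' h
    rw [Set.mem_toFinset] at hq
    have hq' : Setoid.ker (walkLabel (L n) q) = r := hq
    have h1 : r e e' := Quotient.eq.1 h
    rw [← hq'] at h1
    exact h1

end LinkFunction

theorem exists_equiv_of_pairMatched {m k : ℕ} {g : Fin m → Fin k}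
    (hg : ∀ a, {i | g i = a}.ncard = 2) : ∃ e : Fin m ≃ Fin k × Fin 2, ∀ i, (e i).1 = g i := by
  have h2 : ∀ a, Nonempty ({i // g i = a} ≃ Fin 2) := by
    intro a
    rw [← Finite.card_eq, Nat.card_fin, ← hg a]
    rfl
  refine ⟨(Equiv.sigmaFiberEquiv g).symm.trans ((Equiv.sigmaCongrRight fun a => (h2 a).some).trans
    (Equiv.sigmaEquivProd _ _)), fun i => rfl⟩

/-- A pairing with an enumeration of its `k` classes yields a bijection of the `2k` points with `Fin
k × Fin 2`, once each class is ordered by choice. The first components of the bijection recover the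
pairing and the enumeration. -/
theorem card_pairings_mul_factorial_le {m k : ℕ} (hk : m + 1 = 2 * k)
    [Fintype (Setoid (Fin (m + 1)))] [DecidablePred (Setoid.IsPairing (E := Fin (m + 1)))] :
    (Finset.univ.filter fun r : Setoid (Fin (m + 1)) => r.IsPairing).card * k.factorial
      ≤ (m + 1).factorial := by
  classical
  have hQ : ∀ r : {r : Setoid (Fin (m + 1)) // r.IsPairing},
      Fintype.card (Quotient r.1) = k := by
    intro r
    have h1 := LinkFunction.card_image_mk r.2
    rw [Finset.image_univ_of_surjective Quotient.mk_surjective, Finset.card_univ] at h1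
    omega
  have he : ∀ x : Σ r : {r : Setoid (Fin (m + 1)) // r.IsPairing}, (Quotient r.1 ≃ Fin k),
      ∃ e : Fin (m + 1) ≃ Fin k × Fin 2, ∀ i, (e i).1 = x.2 (Quotient.mk x.1.1 i) := by
    intro x
    refine exists_equiv_of_pairMatched fun a => ?_
    obtain ⟨i, hi⟩ := Quotient.mk_surjective (x.2.symm a)
    rw [← x.1.2 i]
    congr 1
    ext j
    simp only [Set.mem_ofPred_eq]
    rw [hi, Equiv.eq_symm_apply]
  choose e he using he
  have hinj : Function.Injective e := by
    rintro ⟨⟨r, hr⟩, τ⟩ ⟨⟨r', hr'⟩, τ'⟩ h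
    have h1 : ∀ i, τ (Quotient.mk r i) = τ' (Quotient.mk r' i) := by
      intro i
      rw [← he ⟨⟨r, hr⟩, τ⟩ i, ← he ⟨⟨r', hr'⟩, τ'⟩ i, h]
    have h2 : r = r' := by
      ext i j
      rw [← Quotient.eq (r := r), ← Quotient.eq (r := r'), ← τ.apply_eq_iff_eq, h1, h1,
        τ'.apply_eq_iff_eq]
    subst h2
    congr 1
    ext q
    obtain ⟨i, rfl⟩ := Quotient.mk_surjective q
    rw [h1]
  have hcard := Fintype.card_le_of_injective e hinj
  rw [Fintype.card_sigma, Fintype.card_equiv (Fintype.equivOfCardEq (by simp [hk, mul_comm])),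
    Fintype.card_fin] at hcard
  have : ∀ r : {r : Setoid (Fin (m + 1)) // r.IsPairing},
      Fintype.card (Quotient r.1 ≃ Fin k) = k.factorial := by
    intro r
    rw [Fintype.card_equiv (Fintype.equivOfCardEq (by simp [hQ r])), hQ r]
  rw [Finset.sum_congr rfl fun r _ => this r, Finset.sum_const, smul_eq_mul, Finset.card_univ,
    Fintype.card_subtype] at hcard
  exact hcard

/-- There are at most `(2k)! / k!` pairings, and for each of them at most `Δ ^ (2k) * n ^ (k + 1)`
walks. -/
theorem LinkFunction.HasPairLimits.le {S : Type u} {L : LinkFunction S} {β : ℕ → ℝ}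
    (hβ : L.HasPairLimits β) {Δ : ℕ} (hΔ0 : 1 ≤ Δ)
    (hΔ : ∀ (n : ℕ) (k : Fin n) (t : S), {l : Fin n | L n k l = t}.ncard ≤ Δ) (k : ℕ) :
    0 ≤ β (2 * k) ∧ β (2 * k) * k.factorial ≤ (2 * k).factorial * (Δ : ℝ) ^ (2 * k) := by
  classical
  rcases k with _ | k
  · simp [hβ.1]
  obtain ⟨m, hm⟩ : ∃ m, 2 * (k + 1) = m + 1 := ⟨2 * k + 1, by ring⟩
  haveI := Fintype.ofFinite (Setoid (Fin (m + 1)))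
  rw [hm]
  refine ⟨ge_of_tendsto' (hβ.2 m) fun n => by positivity, ?_⟩
  set R := (Finset.univ.filter fun r : Setoid (Fin (m + 1)) => r.IsPairing).card with hR
  have hle : β (m + 1) ≤ R * (Δ : ℝ) ^ (m + 1) := by
    refine le_of_tendsto (hβ.2 m) ?_
    filter_upwards [eventually_gt_atTop 0] with n hn
    have hn' : (0 : ℝ) < n := by exact_mod_cast hn
    rw [div_le_iff₀ (by positivity)]
    have h1 : L.numPairMatched m n ≤ R * (Δ ^ (m + 1) * n ^ (1 + (k + 1))) := by
      rw [numPairMatched_eq_sum, ← smul_eq_mul]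
      exact Finset.sum_le_card_nsmul _ _ _ fun r hr =>
        ncard_walksWithPattern_le hΔ0 hΔ hm.symm (Finset.mem_filter.1 hr).2 n
    have h2 : (n : ℝ) * Real.sqrt n ^ (m + 1) = (n : ℝ) ^ (1 + (k + 1)) := by
      rw [← hm, pow_mul, Real.sq_sqrt hn'.le]; ring
    rw [h2]
    calc (L.numPairMatched m n : ℝ) ≤ (R * (Δ ^ (m + 1) * n ^ (1 + (k + 1))) : ℕ) := by
          exact_mod_cast h1
      _ = _ := by push_cast; ring
  have h3 := card_pairings_mul_factorial_le hm.symm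
  rw [← hR] at h3
  calc β (m + 1) * (k + 1).factorial ≤ R * (Δ : ℝ) ^ (m + 1) * (k + 1).factorial := by gcongr
    _ = (R * (k + 1).factorial : ℕ) * (Δ : ℝ) ^ (m + 1) := by push_cast; ring
    _ ≤ _ := by gcongr

/-- The bound on `β (2k)` leaves a term at most `(t² Δ²) ^ k / k!`, which tends to `0`. -/
theorem LinkFunction.HasPairLimits.momentGrowth {S : Type u} {L : LinkFunction S} {β : ℕ → ℝ}
    (hβ : L.HasPairLimits β) (hB : L.PropertyB) : MomentGrowth β := by
  obtain ⟨Δ, hΔ0, hΔ⟩ := exists_pos_propertyB hB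
  intro t
  have h1 := FloorSemiring.tendsto_pow_div_factorial_atTop (t ^ 2 * (Δ : ℝ) ^ 2)
  refine squeeze_zero (fun k => ?_) (fun k => ?_) h1
  · have := (hβ.le hΔ0 hΔ k).1
    rw [pow_mul]
    positivity
  · have h2 := (hβ.le hΔ0 hΔ k).2
    have h3 : (0 : ℝ) < k.factorial := by exact_mod_cast k.factorial_pos
    have h4 : (0 : ℝ) < (2 * k).factorial := by exact_mod_cast (2 * k).factorial_pos
    rw [div_mul_eq_mul_div, div_le_div_iff₀ h4 h3, mul_pow, ← pow_mul, ← pow_mul]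
    have h5 : 0 ≤ t ^ (2 * k) := by rw [pow_mul]; positivity
    calc t ^ (2 * k) * β (2 * k) * k.factorial = t ^ (2 * k) * (β (2 * k) * k.factorial) := by ring
      _ ≤ t ^ (2 * k) * ((2 * k).factorial * (Δ : ℝ) ^ (2 * k)) := by gcongr
      _ = _ := by ring

/-! ### Existence of the limit law -/

/-- Some sequence of probability measures with moment limits `β` is needed. It is supplied by the
spectra for independent random signs, at one outcome `ω` outside the null set. -/
theorem LinkFunction.HasPairLimits.exists_momentsDetermine {S : Type u} {L : LinkFunction S}
    {β : ℕ → ℝ} (hβ : L.HasPairLimits β) (hL : L.IsSymmetric) (hB : L.PropertyB) :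
    ∃ μ : Measure ℝ, IsProbabilityMeasure μ ∧ MomentsDetermine β μ := by
  have := L.nonempty
  set ν : Measure ℝ := empiricalMeasure ![1, -1] with hν
  haveI : IsProbabilityMeasure ν := isProbabilityMeasure_empiricalMeasure (by omega) _
  have hνint : ∀ f : ℝ → ℝ, ∫ r, f r ∂ν = (f 1 + f (-1)) / 2 := by
    intro f
    rw [hν, integral_empiricalMeasure]
    simp
  set P : Measure (S → ℝ) := Measure.infinitePi fun _ => ν with hP
  set x : S → (S → ℝ) → ℝ := fun s ω => ω s with hx
  have hmap : ∀ s, MeasurePreserving (x s) P ν := fun s =>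
    measurePreserving_eval_infinitePi (fun _ : S => ν) s
  have hint : ∀ (f : ℝ → ℝ), Continuous f → ∀ s,
      Integrable (fun ω => f (x s ω)) P ∧ ∫ ω, f (x s ω) ∂P = (f 1 + f (-1)) / 2 := by
    intro f hf s
    refine ⟨(hmap s).integrable_comp_of_integrable (integrable_empiricalMeasure (by omega) _ _), ?_⟩
    rw [← hνint, ← (hmap s).map_eq, integral_map (hmap s).measurable.aemeasurable
      hf.aestronglyMeasurable]
  have hxB : HasBoundedMoments P x := by
    refine ⟨fun s => measurable_pi_apply s,
      iIndepFun_infinitePi (P := fun _ : S => ν) (X := fun _ r => r) fun _ => measurable_id,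
      fun s => ?_, fun k => ⟨1, fun s => ?_⟩⟩
    · rw [(hint (fun r => r ^ 2) (by fun_prop) s).2]; norm_num
    · obtain ⟨h1, h2⟩ := hint (fun r => |r| ^ k) (by fun_prop) s
      exact ⟨h1, by rw [h2]; norm_num⟩
  have hx0 : ∀ s, ∫ ω, x s ω ∂P = 0 := fun s => by
    rw [(hint (fun r => r) continuous_id s).2]; norm_num
  have h1 : ∀ᵐ ω ∂P, ∀ h : ℕ, Tendsto (fun n : ℕ =>
      (hadamardMatrix L L x (fun _ _ => 1) n ω ^ h).trace / n) atTop (𝓝 (β h)) :=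
    ae_all_iff.2 fun h => ae_tendsto_trace_pow (ρ := fun _ => id) hxB hx0 hasBoundedMoments_one
      (indepFun_const_right _ _) (fun _ _ _ => rfl) hB hβ h
  obtain ⟨ω, hω⟩ := h1.exists
  exact _root_.exists_momentsDetermine (hβ.momentGrowth hB) (hasMomentLimits_eigenvalues
    (fun n => isHermitian_hadamardMatrix (ρ := fun _ => id) hL (fun _ _ _ => rfl) n ω) hω)

/-! ### The moments of the semicircular law -/

/-- The number of paths with `r` steps `±1` from `d` to `0` that stay nonnegative. -/
def numDyckPaths : ℕ → ℕ → ℕ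
  | 0, 0 => 1
  | 0, _ + 1 => 0
  | r + 1, 0 => numDyckPaths r 1
  | r + 1, d + 1 => numDyckPaths r (d + 2) + numDyckPaths r d

theorem integral_cos_nat_mul (d : ℕ) :
    ∫ θ in (0 : ℝ)..Real.pi, Real.cos (d * θ) = if d = 0 then Real.pi else 0 := by
  rcases eq_or_ne d 0 with rfl | hd
  · simp
  · rw [if_neg hd]
    have hd' : (d : ℝ) ≠ 0 := by exact_mod_cast hd
    rw [intervalIntegral.integral_comp_mul_left (fun θ => Real.cos θ) hd', integral_cos]
    simp [Real.sin_nat_mul_pi]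

/-- The identity `2 cos θ sin ((d + 1) θ) = sin ((d + 2) θ) + sin (d θ)` is the recursion of the
path numbers, with `sin 0 = 0` as the barrier at height `0`. The case `r = 0` is the orthogonality
of the sines. -/
theorem integral_cos_pow_mul_sin (r d : ℕ) :
    ∫ θ in (0 : ℝ)..Real.pi, (2 * Real.cos θ) ^ r * (Real.sin ((d + 1) * θ) * Real.sin θ)
      = Real.pi / 2 * numDyckPaths r d := by
  induction r generalizing d with
  | zero =>
    have h1 : ∀ θ : ℝ, (2 * Real.cos θ) ^ 0 * (Real.sin ((d + 1) * θ) * Real.sin θ)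
        = (Real.cos ((d : ℕ) * θ) - Real.cos ((d + 2 : ℕ) * θ)) / 2 := by
      intro θ
      have e1 : ((d : ℕ) : ℝ) * θ = (d + 1) * θ - θ := by ring
      have e2 : ((d + 2 : ℕ) : ℝ) * θ = (d + 1) * θ + θ := by push_cast; ring
      rw [e1, e2, Real.cos_sub, Real.cos_add]
      ring
    simp_rw [h1]
    rw [intervalIntegral.integral_div, intervalIntegral.integral_sub
      (Continuous.intervalIntegrable (by fun_prop) _ _)
      (Continuous.intervalIntegrable (by fun_prop) _ _), integral_cos_nat_mul, integral_cos_nat_mul]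
    rcases d with _ | d
    · simp [numDyckPaths]
    · simp [numDyckPaths]
  | succ r ih =>
    rcases d with _ | d
    · rw [numDyckPaths, ← ih 1]
      refine intervalIntegral.integral_congr fun θ _ => ?_
      have e2 : (((1 : ℕ) : ℝ) + 1) * θ = 2 * θ := by push_cast; ring
      simp only [e2, Real.sin_two_mul]
      simp
      ring
    · rw [numDyckPaths]
      push_cast
      rw [mul_add, ← ih d]
      have h2 := ih (d + 2)
      push_cast at h2
      rw [← h2, ← intervalIntegral.integral_add (Continuous.intervalIntegrable (by fun_prop) _ _)
        (Continuous.intervalIntegrable (by fun_prop) _ _)]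
      refine intervalIntegral.integral_congr fun θ _ => ?_
      have e1 : ((d : ℝ) + 1) * θ = (d + 1 + 1) * θ - θ := by ring
      have e2 : ((d : ℝ) + 2 + 1) * θ = (d + 1 + 1) * θ + θ := by ring
      simp only [e1, e2, Real.sin_sub, Real.sin_add]
      ring

theorem integral_mul_sqrt (r : ℕ) :
    ∫ t in (-2 : ℝ)..2, t ^ r * (Real.sqrt (4 - t ^ 2) / (2 * Real.pi)) = numDyckPaths r 0 := by
  -- Substitution `t = 2 cos θ`; it reverses the orientation, and the square root becomes `2 sin θ ≥
  -- 0`.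
  have hsub := intervalIntegral.integral_comp_mul_deriv (a := 0) (b := Real.pi)
    (f := fun θ => 2 * Real.cos θ) (f' := fun θ => -(2 * Real.sin θ))
    (g := fun t => t ^ r * (Real.sqrt (4 - t ^ 2) / (2 * Real.pi)))
    (fun θ _ => ((Real.hasDerivAt_cos θ).const_mul 2).congr_deriv (by ring)) (by fun_prop)
    (by fun_prop)
  simp only [Real.cos_zero, Real.cos_pi, mul_one, mul_neg, Function.comp_apply] at hsub
  rw [intervalIntegral.integral_symm, ← hsub, intervalIntegral.integral_neg, neg_neg]
  have h1 : ∫ θ in (0 : ℝ)..Real.pi, (2 * Real.cos θ) ^ r *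
      (Real.sqrt (4 - (2 * Real.cos θ) ^ 2) / (2 * Real.pi)) * (2 * Real.sin θ)
      = ∫ θ in (0 : ℝ)..Real.pi, (2 / Real.pi) *
        ((2 * Real.cos θ) ^ r * (Real.sin (((0 : ℕ) + 1) * θ) * Real.sin θ)) := by
    refine intervalIntegral.integral_congr fun θ hθ => ?_
    rw [Set.uIcc_of_le Real.pi_pos.le] at hθ
    have hs := Real.sin_nonneg_of_mem_Icc hθ
    have : 4 - (2 * Real.cos θ) ^ 2 = (2 * Real.sin θ) ^ 2 := by
      nlinarith [Real.sin_sq_add_cos_sq θ]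
    simp only [this, Real.sqrt_sq (by positivity : (0 : ℝ) ≤ 2 * Real.sin θ)]
    have := Real.pi_pos
    field_simp
    simp
    ring
  rw [h1, intervalIntegral.integral_const_mul, integral_cos_pow_mul_sin]
  have := Real.pi_pos
  field_simp

theorem sqrt_eq_zero_of_notMem {t : ℝ} (ht : t ∉ Set.Ioc (-2 : ℝ) 2) :
    Real.sqrt (4 - t ^ 2) = 0 := by
  rw [Real.sqrt_eq_zero']
  rw [Set.mem_Ioc, not_and_or, not_lt, not_le] at ht
  rcases ht with h | h <;> nlinarith

theorem integrable_pow_mul_sqrt (r : ℕ) :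
    Integrable fun t : ℝ => t ^ r * (Real.sqrt (4 - t ^ 2) / (2 * Real.pi)) := by
  refine Continuous.integrable_of_hasCompactSupport (by fun_prop)
    (HasCompactSupport.of_support_subset_isCompact (isCompact_Icc (a := (-2 : ℝ)) (b := 2)) ?_)
  intro t ht
  by_contra h
  exact ht (by simp [sqrt_eq_zero_of_notMem fun h' => h (Set.Ioc_subset_Icc_self h')])

theorem integral_semicircle_density (r : ℕ) :
    ∫ t : ℝ, t ^ r * (Real.sqrt (4 - t ^ 2) / (2 * Real.pi)) = numDyckPaths r 0 := by
  rw [← integral_mul_sqrt, intervalIntegral.integral_of_le (by norm_num),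
    setIntegral_eq_integral_of_forall_compl_eq_zero]
  intro t ht
  simp [sqrt_eq_zero_of_notMem ht]

theorem measurable_semicircle_density :
    Measurable fun t : ℝ => ENNReal.ofReal (Real.sqrt (4 - t ^ 2) / (2 * Real.pi)) := by
  fun_prop

theorem toReal_semicircle_density (t : ℝ) :
    (ENNReal.ofReal (Real.sqrt (4 - t ^ 2) / (2 * Real.pi))).toReal
      = Real.sqrt (4 - t ^ 2) / (2 * Real.pi) :=
  ENNReal.toReal_ofReal (by have := Real.pi_pos; positivity)

theorem isProbabilityMeasure_semicircularLaw : IsProbabilityMeasure semicircularLaw := by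
  constructor
  have h0 := integral_semicircle_density 0
  have h1 := integrable_pow_mul_sqrt 0
  simp only [pow_zero, one_mul] at h0 h1
  rw [semicircularLaw, withDensity_apply _ MeasurableSet.univ, Measure.restrict_univ,
    ← ofReal_integral_eq_lintegral_ofReal h1
      (Eventually.of_forall fun t => by have := Real.pi_pos; positivity), h0]
  simp [numDyckPaths]

theorem integrable_pow_semicircularLaw (r : ℕ) :
    Integrable (fun t : ℝ => t ^ r) semicircularLaw := by
  rw [semicircularLaw, integrable_withDensity_iff measurable_semicircle_density
    (Eventually.of_forall fun t => ENNReal.ofReal_lt_top)]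
  simp_rw [toReal_semicircle_density]
  exact integrable_pow_mul_sqrt r

theorem integral_pow_semicircularLaw (r : ℕ) :
    ∫ t, t ^ r ∂semicircularLaw = numDyckPaths r 0 := by
  rw [semicircularLaw, integral_withDensity_eq_integral_toReal_smul measurable_semicircle_density
    (Eventually.of_forall fun t => ENNReal.ofReal_lt_top), ← integral_semicircle_density]
  refine integral_congr_ae (Eventually.of_forall fun t => ?_)
  simp only [toReal_semicircle_density, smul_eq_mul]
  ring

/-! ### Wigner matrices -/

section TreeWalks

variable {V : Type*}

/-- The edges traversed by the walk that starts at `c` and visits the vertices in the list. -/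
def walkEdges : V → List V → List (Sym2 V)
  | _, [] => []
  | c, x :: l => s(c, x) :: walkEdges x l

theorem length_walkEdges (c : V) (l : List V) : (walkEdges c l).length = l.length := by
  induction l generalizing c with
  | nil => rfl
  | cons x l ih => simp [walkEdges, ih]

theorem mem_of_mem_walkEdges {c : V} {l : List V} {e : Sym2 V} (he : e ∈ walkEdges c l) {y : V}
    (hy : y ∈ e) : y = c ∨ y ∈ l := by
  induction l generalizing c with
  | nil => simp [walkEdges] at he
  | cons x l ih =>
    rw [walkEdges, List.mem_cons] at he
    rcases he with rfl | he
    · rcases Sym2.mem_iff.1 hy with rfl | rfl <;> simp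
    · rcases ih he with rfl | h <;> simp [*]

theorem nodup_walkEdges {c : V} {l : List V} (h : (c :: l).Nodup) : (walkEdges c l).Nodup := by
  induction l generalizing c with
  | nil => simp [walkEdges]
  | cons x l ih =>
    rw [walkEdges, List.nodup_cons]
    refine ⟨fun he => ?_, ih (List.nodup_cons.1 h).2⟩
    have := mem_of_mem_walkEdges he (Sym2.mem_mk_left c x)
    exact (List.nodup_cons.1 h).1 (List.mem_cons.2 this)

variable [DecidableEq V]

/-- The lists of `r` vertices that are visited by a depth first search of a tree which is at the
top of the stack `s`, has already visited the vertices in `U`, and ends with the search. -/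
def treeWalks [Fintype V] : ℕ → List V → Finset V → Finset (List V)
  | _, [], _ => ∅
  | 0, [_], _ => {[]}
  | 0, _ :: _ :: _, _ => ∅
  | r + 1, [c], U =>
      (Finset.univ \ U).biUnion fun x => (treeWalks r [x, c] (insert x U)).image (List.cons x)
  | r + 1, c :: p :: s, U =>
      (Finset.univ \ U).biUnion (fun x =>
        (treeWalks r (x :: c :: p :: s) (insert x U)).image (List.cons x)) ∪
      (treeWalks r (p :: s) U).image (List.cons p)

theorem mem_treeWalks_zero [Fintype V] {c : V} {s : List V} {U : Finset V} {l : List V} :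
    l ∈ treeWalks 0 (c :: s) U ↔ s = [] ∧ l = [] := by
  rcases s with _ | ⟨p, s⟩ <;> simp [treeWalks]

theorem mem_treeWalks_succ [Fintype V] {r : ℕ} {c : V} {s : List V} {U : Finset V} {l : List V} :
    l ∈ treeWalks (r + 1) (c :: s) U ↔ ∃ x l', l = x :: l' ∧
      ((x ∉ U ∧ l' ∈ treeWalks r (x :: c :: s) (insert x U)) ∨
        ∃ s', s = x :: s' ∧ l' ∈ treeWalks r s U) := by
  rcases s with _ | ⟨p, s⟩
  · simp only [treeWalks, Finset.mem_biUnion, Finset.mem_sdiff, Finset.mem_univ, true_and,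
      Finset.mem_image]
    constructor
    · rintro ⟨x, hx, l', hl', rfl⟩
      exact ⟨x, l', rfl, Or.inl ⟨hx, hl'⟩⟩
    · rintro ⟨x, l', rfl, ⟨hx, hl'⟩ | ⟨s', hs', -⟩⟩
      · exact ⟨x, hx, l', hl', rfl⟩
      · simp at hs'
  · simp only [treeWalks, Finset.mem_biUnion, Finset.mem_sdiff, Finset.mem_univ, true_and,
      Finset.mem_image, Finset.mem_union]
    constructor
    · rintro (⟨x, hx, l', hl', rfl⟩ | ⟨l', hl', rfl⟩)
      · exact ⟨x, l', rfl, Or.inl ⟨hx, hl'⟩⟩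
      · exact ⟨p, l', rfl, Or.inr ⟨s, rfl, hl'⟩⟩
    · rintro ⟨x, l', rfl, ⟨hx, hl'⟩ | ⟨s', hs', hl'⟩⟩
      · exact Or.inl ⟨x, hx, l', hl', rfl⟩
      · obtain ⟨rfl, rfl⟩ := List.cons.inj hs'
        exact Or.inr ⟨l', hl', rfl⟩

theorem length_of_mem_treeWalks [Fintype V] {r : ℕ} {c : V} {s : List V} {U : Finset V}
    {l : List V} (h : l ∈ treeWalks r (c :: s) U) : l.length = r := by
  induction r generalizing c s U l with
  | zero => simp [(mem_treeWalks_zero.1 h).2]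
  | succ r ih =>
    obtain ⟨x, l', rfl, ⟨-, h⟩ | ⟨s', rfl, h⟩⟩ := mem_treeWalks_succ.1 h
    · simp [ih h]
    · simp [ih h]

/-- The search ends at the bottom of the stack. -/
theorem getLast_of_mem_treeWalks [Fintype V] {r : ℕ} {c : V} {s : List V} {U : Finset V}
    {l : List V} (h : l ∈ treeWalks r (c :: s) U) :
    (c :: l).getLast (by simp) = (c :: s).getLast (by simp) := by
  induction r generalizing c s U l with
  | zero =>
    obtain ⟨rfl, rfl⟩ := mem_treeWalks_zero.1 h
    rfl
  | succ r ih =>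
    obtain ⟨x, l', rfl, ⟨-, h⟩ | ⟨s', rfl, h⟩⟩ := mem_treeWalks_succ.1 h
    · simpa using ih h
    · simpa using ih h

/-- The number of the walks in `treeWalks`, for a stack with `d + 1` and a set of `u` visited
elements, on `n` vertices. -/
def numTreeWalks (n : ℕ) : ℕ → ℕ → ℕ → ℕ
  | 0, 0, _ => 1
  | 0, _ + 1, _ => 0
  | r + 1, 0, u => (n - u) * numTreeWalks n r 1 (u + 1)
  | r + 1, d + 1, u => (n - u) * numTreeWalks n r (d + 2) (u + 1) + numTreeWalks n r d u

/-- A step pushes one of the unvisited vertices or pops to the next vertex of the stack, so the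
count depends only on the depth and the number of visited vertices. Pushes and pops are distinct
because the vertices of the stack are visited. -/
theorem card_treeWalks [Fintype V] {r : ℕ} {c : V} {s : List V} {U : Finset V}
    (hs : ∀ x ∈ s, x ∈ U) :
    (treeWalks r (c :: s) (insert c U)).card
      = numTreeWalks (Fintype.card V) r s.length (insert c U).card := by
  induction r generalizing c s U with
  | zero => rcases s with _ | ⟨p, s⟩ <;> simp [treeWalks, numTreeWalks]
  | succ r ih =>
    have hbi : ((Finset.univ \ insert c U).biUnion fun x =>
        (treeWalks r (x :: c :: s) (insert x (insert c U))).image (List.cons x)).card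
        = (Fintype.card V - (insert c U).card) *
          numTreeWalks (Fintype.card V) r (s.length + 1) ((insert c U).card + 1) := by
      rw [Finset.card_biUnion]
      · rw [← Finset.card_univ, ← Finset.card_sdiff_of_subset (Finset.subset_univ _),
          ← smul_eq_mul, ← Finset.sum_const]
        refine Finset.sum_congr rfl fun x hx => ?_
        rw [Finset.card_image_of_injective _ (List.cons_injective), ih]
        · rw [Finset.card_insert_of_notMem (Finset.mem_sdiff.1 hx).2]
          rfl
        · intro y hy
          rcases List.mem_cons.1 hy with rfl | hy
          · simp
          · simp [hs y hy]
      · intro x _ y _ hxy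
        rw [Function.onFun, Finset.disjoint_left]
        intro l hl hl'
        obtain ⟨a, -, rfl⟩ := Finset.mem_image.1 hl
        obtain ⟨b, -, hb⟩ := Finset.mem_image.1 hl'
        exact hxy (List.cons.inj hb).1.symm
    rcases s with _ | ⟨p, s⟩
    · exact hbi
    · rw [treeWalks, Finset.card_union_of_disjoint, hbi]
      · rw [List.length_cons, numTreeWalks, Finset.card_image_of_injective _ (List.cons_injective)]
        have hp : p ∈ insert c U := by simp [hs p]
        have := ih (c := p) (s := s) (U := insert c U) fun x hx => by simp [hs x (by simp [hx])]
        rw [Finset.insert_eq_of_mem hp] at this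
        rw [this]
      · rw [Finset.disjoint_left]
        intro l hl hl'
        obtain ⟨x, hx, hl⟩ := Finset.mem_biUnion.1 hl
        obtain ⟨a, -, rfl⟩ := Finset.mem_image.1 hl
        obtain ⟨b, -, hb⟩ := Finset.mem_image.1 hl'
        obtain rfl := (List.cons.inj hb).1
        exact (Finset.mem_sdiff.1 hx).2 (by simp [hs p])

/-- Every edge traversed in a depth first search of a tree is traversed twice, once the edges of
the stack are added. -/
theorem count_eq_two_of_mem_treeWalks [Fintype V] {r : ℕ} {c : V} {s : List V} {U : Finset V}
    {l : List V} (h : l ∈ treeWalks r (c :: s) U) (hU : ∀ x ∈ c :: s, x ∈ U)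
    (hs : (c :: s).Nodup) :
    ∀ e ∈ walkEdges c l ++ walkEdges c s, (walkEdges c l ++ walkEdges c s).count e = 2 ∧
      (e ∈ walkEdges c s ∨ ∃ y ∈ e, y ∉ U) := by
  induction r generalizing c s U l with
  | zero =>
    obtain ⟨rfl, rfl⟩ := mem_treeWalks_zero.1 h
    simp [walkEdges]
  | succ r ih =>
    obtain ⟨x, l', rfl, ⟨hx, h⟩ | ⟨s', rfl, h⟩⟩ := mem_treeWalks_succ.1 h
    -- A push moves the edge `s(c, x)` from the walk to the stack; the multiset of all edges is
    -- unchanged.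
    · have hperm : (walkEdges c (x :: l') ++ walkEdges c s).Perm
          (walkEdges x l' ++ walkEdges x (c :: s)) := by
        rw [walkEdges, walkEdges, Sym2.eq_swap, List.cons_append]
        exact List.perm_middle.symm
      have := ih h (fun y hy => ?_) (List.nodup_cons.2 ⟨fun hxs => hx (hU x hxs), hs⟩)
      · intro e he
        obtain ⟨h1, h2⟩ := this e (hperm.subset he)
        refine ⟨by rw [hperm.count_eq, h1], ?_⟩
        rcases h2 with h2 | ⟨y, hy, hyU⟩
        · rw [walkEdges, List.mem_cons] at h2
          rcases h2 with rfl | h2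
          · exact Or.inr ⟨x, Sym2.mem_mk_left _ _, hx⟩
          · exact Or.inl h2
        · exact Or.inr ⟨y, hy, fun h => hyU (Finset.mem_insert_of_mem h)⟩
      · rcases List.mem_cons.1 hy with rfl | hy
        · simp
        · exact Finset.mem_insert_of_mem (hU y hy)
    · have hs' := List.nodup_cons.1 hs
      have := ih h (fun y hy => hU y (List.mem_cons_of_mem _ hy)) hs'.2
      have hperm : (walkEdges c (x :: l') ++ walkEdges c (x :: s')).Perm
          (s(c, x) :: s(c, x) :: (walkEdges x l' ++ walkEdges x s')) := by
        rw [walkEdges, walkEdges, List.cons_append]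
        exact List.Perm.cons _ List.perm_middle
      -- By the second part of the induction hypothesis, a remaining edge lies in the shortened
      -- stack, which avoids `c`, or contains a vertex outside `U`. The popped edge does neither, so
      -- it is counted exactly twice.
      have hnot : s(c, x) ∉ walkEdges x l' ++ walkEdges x s' := by
        intro hmem
        rcases (this _ hmem).2 with h2 | ⟨y, hy, hyU⟩
        · exact hs'.1 (List.mem_cons.2 (mem_of_mem_walkEdges h2 (Sym2.mem_mk_left c x)))
        · rcases Sym2.mem_iff.1 hy with rfl | rfl
          · exact hyU (hU _ (by simp))
          · exact hyU (hU _ (by simp))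
      intro e he
      rw [hperm.count_eq, walkEdges]
      by_cases hec : e = s(c, x)
      · subst hec
        rw [List.count_cons_self, List.count_cons_self, List.count_eq_zero_of_not_mem hnot]
        exact ⟨rfl, Or.inl (by simp)⟩
      · have hmem : e ∈ walkEdges x l' ++ walkEdges x s' := by
          have := hperm.subset he
          simpa [hec] using this
        rw [List.count_cons_of_ne (Ne.symm hec), List.count_cons_of_ne (Ne.symm hec)]
        exact ⟨(this e hmem).1, (this e hmem).2.imp_left (List.mem_cons_of_mem _)⟩

/-- The newly visited vertices are reached by distinct new edges. -/
theorem exists_new_edges {c : V} (l : List V) {U : Finset V} (hc : c ∈ U) :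
    ∃ F ⊆ (walkEdges c l).toFinset, F.card = (l.toFinset \ U).card ∧ ∀ e ∈ F, ∃ y ∈ e, y ∉ U := by
  induction l generalizing c U with
  | nil => exact ⟨∅, by simp⟩
  | cons x l ih =>
    by_cases hx : x ∈ U
    · obtain ⟨F, hF, hcard, hnew⟩ := ih hx
      rw [List.toFinset_cons, Finset.insert_sdiff_of_mem _ hx]
      refine ⟨F, hF.trans fun e he => ?_, hcard, hnew⟩
      rw [List.mem_toFinset] at he ⊢
      exact List.mem_cons_of_mem _ he
    · have h1 : ((x :: l).toFinset \ U).card = (l.toFinset \ insert x U).card + 1 := by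
        rw [← Finset.card_insert_of_notMem (a := x) (s := l.toFinset \ insert x U) (by simp)]
        congr 1
        ext y
        by_cases hy : y = x
        · simp [hy, hx]
        · simp [hy]
      obtain ⟨F, hF, hcard, hnew⟩ := ih (Finset.mem_insert_self x U)
      have hnot : s(c, x) ∉ F := by
        intro h
        obtain ⟨y, hy, hyU⟩ := hnew _ h
        rcases Sym2.mem_iff.1 hy with rfl | rfl
        · exact hyU (Finset.mem_insert_of_mem hc)
        · exact hyU (Finset.mem_insert_self _ _)
      refine ⟨insert s(c, x) F, ?_, ?_, ?_⟩
      · rw [walkEdges, List.toFinset_cons]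
        exact Finset.insert_subset_insert _ hF
      · rw [Finset.card_insert_of_notMem hnot, hcard, h1]
      · intro e he
        rcases Finset.mem_insert.1 he with rfl | he
        · exact ⟨x, Sym2.mem_mk_right _ _, hx⟩
        · obtain ⟨y, hy, hyU⟩ := hnew e he
          exact ⟨y, hy, fun h => hyU (Finset.mem_insert_of_mem h)⟩

theorem length_eq_two_mul_card_toFinset {A : Type*} [DecidableEq A] {l : List A}
    (h : ∀ a ∈ l, l.count a = 2) : l.length = 2 * l.toFinset.card := by
  have h1 := Multiset.toFinset_sum_count_eq (l : Multiset A)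
  rw [Multiset.coe_card] at h1
  rw [← h1, mul_comm, ← smul_eq_mul, ← Finset.sum_const]
  refine Finset.sum_congr rfl fun a ha => ?_
  rw [Multiset.coe_count]
  exact h a (by simpa using ha)

/-- A walk that traverses every edge twice and visits as many new vertices as possible is a depth
first search of a tree. -/
theorem mem_treeWalks [Fintype V] {r : ℕ} {c : V} {s : List V} {U : Finset V} {l : List V}
    (hl : l.length = r) (hU : ∀ x ∈ c :: s, x ∈ U) (hs : (c :: s).Nodup)
    (h : ∀ e ∈ walkEdges c l ++ walkEdges c s, (walkEdges c l ++ walkEdges c s).count e = 2)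
    (hnew : r ≤ 2 * (l.toFinset \ U).card + s.length) : l ∈ treeWalks r (c :: s) U := by
  -- The bound `hnew` is the balance of a search: each new vertex costs a push and later a pop, and
  -- the stack itself costs `s.length` pops.
  induction r generalizing c s U l with
  | zero =>
    obtain rfl := List.eq_nil_of_length_eq_zero hl
    refine mem_treeWalks_zero.2 ⟨?_, rfl⟩
    -- For the empty walk, the edges of the stack would occur only once, so there are none.
    rcases s with _ | ⟨p, s⟩
    · rfl
    · have h1 := h s(c, p) (by simp [walkEdges])
      have h2 := (List.nodup_iff_count_le_one.1 (nodup_walkEdges hs)) s(c, p)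
      rw [walkEdges, List.nil_append] at h1
      omega
  | succ r ih =>
    rcases l with _ | ⟨x, l⟩
    · simp at hl
    have hl' : l.length = r := by simpa using hl
    refine mem_treeWalks_succ.2 ⟨x, l, rfl, ?_⟩
    by_cases hx : x ∈ U
    · right
      rw [List.toFinset_cons, Finset.insert_sdiff_of_mem _ hx] at hnew
      by_cases hmem : s(c, x) ∈ walkEdges c s
      · rcases s with _ | ⟨p, s⟩
        · simp [walkEdges] at hmem
        have hs' := List.nodup_cons.1 hs
        rw [walkEdges, List.mem_cons] at hmem
        have hp : s(c, x) ∉ walkEdges p s := fun h3 =>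
          hs'.1 (List.mem_cons.2 (mem_of_mem_walkEdges h3 (Sym2.mem_mk_left c x)))
        obtain rfl : x = p := Sym2.congr_right.1 (hmem.resolve_right hp)
        refine ⟨s, rfl, ih hl' (fun y hy => hU y (List.mem_cons_of_mem _ hy)) hs'.2 ?_ ?_⟩
        · have hperm : (walkEdges c (x :: l) ++ walkEdges c (x :: s)).Perm
              (s(c, x) :: s(c, x) :: (walkEdges x l ++ walkEdges x s)) := by
            rw [walkEdges, walkEdges, List.cons_append]
            exact List.Perm.cons _ List.perm_middle
          simp_rw [hperm.count_eq, hperm.mem_iff] at h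
          intro e he
          have h1 := h e (by simp [he])
          by_cases hec : e = s(c, x)
          · subst hec
            rw [List.count_cons_self, List.count_cons_self] at h1
            have := List.count_pos_iff.2 he
            omega
          · rwa [List.count_cons_of_ne (Ne.symm hec), List.count_cons_of_ne (Ne.symm hec)] at h1
        · simp only [List.length_cons] at hnew
          omega
      -- A step to a visited vertex by an edge outside the stack wastes an edge. The new edges `F`,
      -- the edge `s(c, x)` and the edges of the stack are all distinct, and by `hnew` they are more
      -- than half of the total length, although every edge occurs twice.
      · exfalso
        have hcU : c ∈ U := hU c (by simp)
        obtain ⟨F, hF, hcard, hFnew⟩ := exists_new_edges l hx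
        have hlen := length_eq_two_mul_card_toFinset h
        rw [List.length_append, length_walkEdges, length_walkEdges, hl] at hlen
        have hsU : ∀ e ∈ walkEdges c s, ∀ y ∈ e, y ∈ U := fun e he y hy =>
          hU y (List.mem_cons.2 (mem_of_mem_walkEdges he hy))
        have hdisj : Disjoint F (insert s(c, x) (walkEdges c s).toFinset) := by
          rw [Finset.disjoint_left]
          intro e he he'
          obtain ⟨y, hy, hyU⟩ := hFnew e he
          rcases Finset.mem_insert.1 he' with rfl | he'
          · rcases Sym2.mem_iff.1 hy with rfl | rfl
            · exact hyU hcU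
            · exact hyU hx
          · exact hyU (hsU e (List.mem_toFinset.1 he') y hy)
        have hsub : F ∪ insert s(c, x) (walkEdges c s).toFinset
            ⊆ (walkEdges c (x :: l) ++ walkEdges c s).toFinset := by
          intro e he
          simp only [Finset.mem_union, Finset.mem_insert, List.mem_toFinset] at he
          simp only [List.mem_toFinset, walkEdges, List.mem_append, List.mem_cons]
          rcases he with he | rfl | he
          · exact Or.inl (Or.inr (List.mem_toFinset.1 (hF he)))
          · exact Or.inl (Or.inl rfl)
          · exact Or.inr he
        have hle := Finset.card_le_card hsub
        rw [Finset.card_union_of_disjoint hdisj, Finset.card_insert_of_notMem (by simpa using hmem),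
          List.toFinset_card_of_nodup (nodup_walkEdges hs), length_walkEdges, hcard] at hle
        omega
    · left
      refine ⟨hx, ih hl' (fun y hy => ?_) (List.nodup_cons.2 ⟨fun hxs => hx (hU x hxs), hs⟩) ?_ ?_⟩
      · rcases List.mem_cons.1 hy with rfl | hy
        · simp
        · exact Finset.mem_insert_of_mem (hU y hy)
      · have hperm : (walkEdges c (x :: l) ++ walkEdges c s).Perm
            (walkEdges x l ++ walkEdges x (c :: s)) := by
          rw [walkEdges, walkEdges, Sym2.eq_swap, List.cons_append]
          exact List.perm_middle.symm
        simpa only [hperm.count_eq, hperm.mem_iff] using h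
      · have h1 : ((x :: l).toFinset \ U).card ≤ (l.toFinset \ insert x U).card + 1 := by
          rw [← Finset.card_insert_of_notMem (a := x) (s := l.toFinset \ insert x U) (by simp)]
          refine Finset.card_le_card fun y hy => ?_
          by_cases hyx : y = x
          · simp [hyx]
          · simpa [hyx] using hy
        simp only [List.length_cons]
        omega

end TreeWalks

/-! #### Counting -/

/-- A path from height `d` to `0` in `r` steps has `(r - d) / 2` pushes, each with about `n`
choices. This gives the order `√n ^ (r - d)` per path. -/
theorem tendsto_numTreeWalks (r d u : ℕ) :
    Tendsto (fun n : ℕ => (numTreeWalks n r d u : ℝ) * Real.sqrt n ^ d / Real.sqrt n ^ r) atTop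
      (𝓝 (numDyckPaths r d)) := by
  have hfac : ∀ u : ℕ, Tendsto (fun n : ℕ => ((n - u : ℕ) : ℝ) / n) atTop (𝓝 1) := by
    intro u
    have h1 : Tendsto (fun n : ℕ => 1 - (u : ℝ) / n) atTop (𝓝 (1 - 0)) :=
      tendsto_const_nhds.sub (tendsto_const_div_atTop_nhds_zero_nat _)
    rw [sub_zero] at h1
    refine h1.congr' ?_
    filter_upwards [eventually_ge_atTop u, eventually_gt_atTop 0] with n hn hn0
    have : (n : ℝ) ≠ 0 := by exact_mod_cast hn0.ne'
    rw [Nat.cast_sub hn]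
    field_simp
  induction r generalizing d u with
  | zero =>
    rcases d with _ | d
    · simp [numTreeWalks, numDyckPaths]
    · simp [numTreeWalks, numDyckPaths]
  | succ r ih =>
    have hpush := (hfac u).mul (ih (d + 1) (u + 1))
    rw [one_mul] at hpush
    rcases d with _ | d
    · refine hpush.congr' ?_
      filter_upwards [eventually_gt_atTop 0] with n hn
      have hn' : (0 : ℝ) < n := by exact_mod_cast hn
      have hs : 0 < Real.sqrt n := Real.sqrt_pos.2 hn'
      have hsq : (n : ℝ) = Real.sqrt n ^ 2 := (Real.sq_sqrt hn'.le).symm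
      rw [numTreeWalks]
      push_cast
      generalize ((n - u : ℕ) : ℝ) = a
      generalize Real.sqrt n = b at *
      rw [hsq]
      field_simp
      ring
    · have := hpush.add (ih d u)
      rw [numDyckPaths]
      push_cast
      refine this.congr' ?_
      filter_upwards [eventually_gt_atTop 0] with n hn
      have hn' : (0 : ℝ) < n := by exact_mod_cast hn
      have hs : 0 < Real.sqrt n := Real.sqrt_pos.2 hn'
      have hsq : (n : ℝ) = Real.sqrt n ^ 2 := (Real.sq_sqrt hn'.le).symm
      rw [numTreeWalks]
      push_cast
      generalize ((n - u : ℕ) : ℝ) = a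
      generalize Real.sqrt n = b at *
      rw [hsq]
      field_simp
      ring

/-- There are few functions with few values. -/
theorem card_few_values_le {m n u : ℕ} (C : Finset (Fin (m + 1) → Fin n))
    (hC : ∀ q ∈ C, (Finset.univ.image q).card ≤ u) :
    C.card ≤ (m + 1) ^ (m + 1) * n ^ u := by
  have := card_le_mul_of_patterns C (fun q => q) (n ^ u) ?_
  · simpa using this
  intro f Z hZ hf
  rcases Z.eq_empty_or_nonempty with rfl | ⟨q, hq⟩
  · simp
  have hn : 0 < n := Fin.pos (q 0)
  have h1 : (Finset.univ.image f).card ≤ u := by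
    rw [card_image_eq_of_ker_eq (hf q hq)]
    exact hC q (hZ hq)
  have h2 : Z.card ≤ Fintype.card (Finset.univ.image f → Fin n) := by
    have hf' : ∀ a : Finset.univ.image f, ∃ e, f e = a.1 := fun a => by
      obtain ⟨e, -, he⟩ := Finset.mem_image.1 a.2
      exact ⟨e, he⟩
    choose g hg using hf'
    rw [← Fintype.card_coe]
    refine Fintype.card_le_of_injective (fun z : Z => fun a => z.1 (g a)) fun z z' h => ?_
    apply Subtype.ext
    funext e
    have h3 := congrFun h ⟨f e, by simp⟩
    have h4 : f (g ⟨f e, by simp⟩) = f e := hg _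
    have h5 := (hf z.1 z.2 _ _).1 h4
    have h6 := (hf z'.1 z'.2 _ _).1 h4
    simp only at h3
    rw [← h5, ← h6, h3]
  refine h2.trans ?_
  rw [Fintype.card_fun, Fintype.card_fin, Fintype.card_coe]
  exact Nat.pow_le_pow_right hn h1

/-! ### Closed walks and the Wigner link function -/

theorem wignerLink_eq_iff {n : ℕ} {i j i' j' : Fin n} :
    wignerLink n i j = wignerLink n i' j' ↔ s(i, j) = s(i', j') := by
  rw [Sym2.eq_iff]
  simp only [wignerLink, Prod.mk.injEq, Fin.ext_iff]
  omega

theorem isSymmetric_wignerLink : wignerLink.IsSymmetric := fun _ _ _ =>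
  wignerLink_eq_iff.2 Sym2.eq_swap

theorem propertyB_wignerLink : wignerLink.PropertyB := by
  refine ⟨1, fun n k t => ?_⟩
  refine (Set.ncard_le_one_iff (Set.toFinite _)).2 fun {a b} ha hb => ?_
  have : wignerLink n k a = wignerLink n k b := Eq.trans ha (Eq.symm hb)
  exact Sym2.congr_right.1 (wignerLink_eq_iff.1 this)

theorem walkEdges_ofFn {V : Type*} (v : ℕ → V) (r : ℕ) :
    walkEdges (v 0) (List.ofFn fun i : Fin r => v (i + 1))
      = List.ofFn fun i : Fin r => s(v i, v (i + 1)) := by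
  induction r generalizing v with
  | zero => rfl
  | succ r ih =>
    rw [List.ofFn_succ, List.ofFn_succ, walkEdges]
    have := ih fun j => v (j + 1)
    simpa using this

/-- The list of the vertices visited by the closed walk `q` after its start. -/
def closedWalkList {m : ℕ} {V : Type*} (q : Fin (m + 1) → V) : List V :=
  List.ofFn fun i => q (i + 1)

theorem walkEdges_closedWalkList {m : ℕ} {V : Type*} (q : Fin (m + 1) → V) :
    walkEdges (q 0) (closedWalkList q) = List.ofFn fun i => s(q i, q (i + 1)) := by
  have := walkEdges_ofFn (fun j => q (Fin.ofNat (m + 1) j)) (m + 1)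
  have h1 : ∀ i : Fin (m + 1), Fin.ofNat (m + 1) (i : ℕ) = i := fun i => by
    ext; simp
  have h2 : ∀ i : Fin (m + 1), Fin.ofNat (m + 1) ((i : ℕ) + 1) = i + 1 := fun i => by
    ext; simp [Fin.val_add]
  simp only [h1, h2] at this
  exact this

theorem count_ofFn {h : ℕ} {A : Type*} [DecidableEq A] (g : Fin h → A) (a : A) :
    (List.ofFn g).count a = (Finset.univ.filter fun i => g i = a).card := by
  rw [← Multiset.coe_count, ← Fin.univ_val_map, Multiset.count_map]
  simp_rw [eq_comm (a := a)]
  rfl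

theorem pairMatched_walkLabel_wignerLink {m n : ℕ} (q : Fin (m + 1) → Fin n) :
    PairMatched (walkLabel (wignerLink n) q) ↔
      ∀ e ∈ walkEdges (q 0) (closedWalkList q), (walkEdges (q 0) (closedWalkList q)).count e = 2 := by
  rw [walkEdges_closedWalkList, List.forall_mem_ofFn_iff]
  simp_rw [count_ofFn]
  rw [pairMatched_iff_card]
  simp only [walkLabel, wignerLink_eq_iff]

/-- The closed walks that are depth first searches of trees. -/
def closedTreeWalks (m n : ℕ) : Finset (Fin (m + 1) → Fin n) :=
  Finset.univ.filter fun q => closedWalkList q ∈ treeWalks (m + 1) [q 0] {q 0}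

/-- A closed walk corresponds to its root and the list of its later vertices; conversely the search
ends at the bottom of the stack, so such a list closes up at the root. -/
theorem card_closedTreeWalks (m n : ℕ) :
    (closedTreeWalks m n).card = n * numTreeWalks n (m + 1) 0 1 := by
  have h1 : ∀ v : Fin n, (treeWalks (m + 1) [v] {v}).card = numTreeWalks n (m + 1) 0 1 := by
    intro v
    have := card_treeWalks (r := m + 1) (c := v) (s := []) (U := ∅) (by simp)
    simpa using this
  have h2 : (Finset.univ.sigma fun v : Fin n => treeWalks (m + 1) [v] {v}).card
      = n * numTreeWalks n (m + 1) 0 1 := by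
    rw [Finset.card_sigma, Finset.sum_congr rfl fun v _ => h1 v]
    simp
  rw [← h2]
  refine Finset.card_bij (fun q _ => ⟨q 0, closedWalkList q⟩) (fun q hq => ?_)
    (fun q _ q' _ h => ?_) (fun x hx => ?_)
  · simpa [closedTreeWalks] using hq
  · have h3 : closedWalkList q = closedWalkList q' := by
      simpa using (Sigma.mk.inj_iff.1 h).2
    have h4 := List.ofFn_injective h3
    funext i
    have := congrFun h4 (i - 1)
    simpa using this
  · obtain ⟨v, l⟩ := x
    simp only [Finset.mem_sigma, Finset.mem_univ, true_and] at hx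
    have hlen := length_of_mem_treeWalks hx
    have hlast := getLast_of_mem_treeWalks hx
    set q : Fin (m + 1) → Fin n := fun i => l.get ((i - 1).cast hlen.symm) with hq
    have hl : closedWalkList q = l := by
      refine List.ext_get (by simp [closedWalkList, hlen]) fun j hj hj' => ?_
      simp only [closedWalkList, hq, List.get_eq_getElem, List.getElem_ofFn, add_sub_cancel_right]
      rfl
    have hv : q 0 = v := by
      have hne : l ≠ [] := by rintro rfl; simp at hlen
      rw [List.getLast_cons hne, List.getLast_eq_getElem] at hlast
      simp only [List.getLast_singleton] at hlast
      rw [← hlast, hq]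
      simp [hlen]
    refine ⟨q, ?_, ?_⟩
    · simp only [closedTreeWalks, Finset.mem_filter, Finset.mem_univ, true_and]
      rw [hl, hv]
      exact hx
    · simp only [hl, hv]

theorem closedTreeWalks_subset {m n : ℕ} {q : Fin (m + 1) → Fin n} (hq : q ∈ closedTreeWalks m n) :
    PairMatched (walkLabel (wignerLink n) q) := by
  rw [pairMatched_walkLabel_wignerLink]
  intro e he
  have := count_eq_two_of_mem_treeWalks (Finset.mem_filter.1 hq).2 (by simp) (by simp) e
  simp only [walkEdges, List.append_nil] at this
  exact (this he).1

/-- The length is even, say `2k`, and a walk through `k` edges that meets more than `k` vertices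
discovers a new vertex by each of its edges. -/
theorem mem_closedTreeWalks {m n : ℕ} {q : Fin (m + 1) → Fin n}
    (hq : PairMatched (walkLabel (wignerLink n) q))
    (hcard : m + 1 < 2 * (Finset.univ.image q).card) : q ∈ closedTreeWalks m n := by
  refine Finset.mem_filter.2 ⟨Finset.mem_univ _, mem_treeWalks (by simp [closedWalkList]) (by simp)
    (by simp) ?_ ?_⟩
  · rw [pairMatched_walkLabel_wignerLink] at hq
    simpa [walkEdges] using hq
  · have hset : (closedWalkList q).toFinset = Finset.univ.image q := by
      ext y
      simp only [closedWalkList, List.mem_toFinset, List.mem_ofFn, Finset.mem_image,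
        Finset.mem_univ, true_and]
      exact ⟨fun ⟨i, hi⟩ => ⟨i + 1, hi⟩, fun ⟨i, hi⟩ => ⟨i - 1, by simpa using hi⟩⟩
    have h0 : q 0 ∈ Finset.univ.image q := by simp
    have h1 := Finset.card_sdiff_of_subset (Finset.singleton_subset_iff.2 h0)
    rw [hset, h1, Finset.card_singleton]
    simp only [List.length_nil]
    have heven : ∃ k, m + 1 = 2 * k := by
      classical
      exact ⟨_, by simpa using hq.card_eq⟩
    obtain ⟨k, hk⟩ := heven
    omega

/-- A pair-matched walk is a tree walk or visits at most `(m + 1) / 2` vertices; the walks of the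
second kind are fewer by a factor of order `n`. -/
theorem hasPairLimits_wignerLink :
    wignerLink.HasPairLimits fun h => (numDyckPaths h 0 : ℝ) := by
  refine ⟨by simp [numDyckPaths], fun m => ?_⟩
  have hmain : Tendsto (fun n : ℕ => ((closedTreeWalks m n).card : ℝ) /
      (n * Real.sqrt n ^ (m + 1))) atTop (𝓝 (numDyckPaths (m + 1) 0)) := by
    refine (tendsto_numTreeWalks (m + 1) 0 1).congr' ?_
    filter_upwards [eventually_gt_atTop 0] with n hn
    have hn' : (0 : ℝ) < n := by exact_mod_cast hn
    rw [card_closedTreeWalks]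
    push_cast
    rw [mul_div_mul_left _ _ hn'.ne']
    simp
  have hbound : ∀ n, (closedTreeWalks m n).card ≤ wignerLink.numPairMatched m n ∧
      wignerLink.numPairMatched m n
        ≤ (closedTreeWalks m n).card + (m + 1) ^ (m + 1) * n ^ ((m + 1) / 2) := by
    intro n
    classical
    rw [LinkFunction.numPairMatched, Set.ncard_eq_toFinset_card']
    constructor
    · refine Finset.card_le_card fun q hq => ?_
      rw [Set.mem_toFinset]
      exact closedTreeWalks_subset hq
    · set C := Finset.univ.filter fun q : Fin (m + 1) → Fin n =>
        (Finset.univ.image q).card ≤ (m + 1) / 2 with hC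
      have hsub : ({q | PairMatched (walkLabel (wignerLink n) q)} :
          Set (Fin (m + 1) → Fin n)).toFinset ⊆ closedTreeWalks m n ∪ C := by
        intro q hq
        rw [Set.mem_toFinset] at hq
        rw [Finset.mem_union]
        by_cases h : m + 1 < 2 * (Finset.univ.image q).card
        · exact Or.inl (mem_closedTreeWalks hq h)
        · exact Or.inr (Finset.mem_filter.2 ⟨Finset.mem_univ _, by omega⟩)
      refine (Finset.card_le_card hsub).trans ((Finset.card_union_le _ _).trans ?_)
      gcongr
      exact card_few_values_le C fun q hq => (Finset.mem_filter.1 hq).2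
  set K : ℝ := (m + 1) ^ (m + 1) with hK
  have herr : Tendsto (fun n : ℕ => K / n) atTop (𝓝 0) := tendsto_const_div_atTop_nhds_zero_nat _
  have hup := hmain.add herr
  rw [add_zero] at hup
  refine tendsto_of_tendsto_of_tendsto_of_le_of_le' hmain hup ?_ ?_
  · refine Eventually.of_forall fun n => ?_
    have := (hbound n).1
    gcongr
  · filter_upwards [eventually_gt_atTop 0] with n hn
    have hn' : (1 : ℝ) ≤ n := by exact_mod_cast hn
    have hs : 1 ≤ Real.sqrt n := by rwa [Real.one_le_sqrt]
    have h1 : (wignerLink.numPairMatched m n : ℝ)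
        ≤ (closedTreeWalks m n).card + K * (n : ℝ) ^ ((m + 1) / 2) := by
      rw [hK]
      exact_mod_cast (hbound n).2
    have h2 : (n : ℝ) ^ ((m + 1) / 2) ≤ Real.sqrt n ^ (m + 1) := by
      calc (n : ℝ) ^ ((m + 1) / 2) = Real.sqrt n ^ (2 * ((m + 1) / 2)) := by
            rw [pow_mul, Real.sq_sqrt (by linarith)]
        _ ≤ _ := pow_le_pow_right₀ hs (by omega)
    have h3 : K / n = K * Real.sqrt n ^ (m + 1) / (n * Real.sqrt n ^ (m + 1)) := by
      rw [mul_div_mul_right _ _ (by positivity)]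
    rw [h3, ← add_div]
    gcongr
    exact h1.trans (by gcongr)

theorem momentsDetermine_semicircularLaw :
    MomentsDetermine (fun h => (numDyckPaths h 0 : ℝ)) semicircularLaw := by
  haveI := isProbabilityMeasure_semicircularLaw
  exact momentsDetermine_of_moments (hasPairLimits_wignerLink.momentGrowth propertyB_wignerLink)
    integrable_pow_semicircularLaw integral_pow_semicircularLaw

theorem isLSD_wignerLink : LinkFunction.IsLSD.{0, w} wignerLink semicircularLaw := by
  haveI := isProbabilityMeasure_semicircularLaw
  exact hasPairLimits_wignerLink.isLSD isSymmetric_wignerLink propertyB_wignerLink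
    momentsDetermine_semicircularLaw

/-- Every symmetric link function factors through the Wigner link function. -/
theorem LinkFunction.IsSymmetric.exists_factorization {T : Type v} {L : LinkFunction T}
    (hL : L.IsSymmetric) :
    ∃ ρ : ℕ → ℕ × ℕ → T, ∀ (n : ℕ) (i j : Fin n), L n i j = ρ n (wignerLink n i j) := by
  classical
  -- The default `L 1 0 0` is arbitrary: it is used only at pairs that are not labels of size `n`.
  refine ⟨fun n p => if h : ∃ ij : Fin n × Fin n, wignerLink n ij.1 ij.2 = p then
    L n h.choose.1 h.choose.2 else L 1 0 0, fun n i j => ?_⟩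
  have h : ∃ ij : Fin n × Fin n, wignerLink n ij.1 ij.2 = wignerLink n i j := ⟨(i, j), rfl⟩
  beta_reduce
  rw [dif_pos h]
  rcases Sym2.eq_iff.1 (wignerLink_eq_iff.1 h.choose_spec) with ⟨h1, h2⟩ | ⟨h1, h2⟩
  · rw [h1, h2]
  · rw [h1, h2, hL]

theorem isHadamardLSD_wignerLink {T : Type v} {L : LinkFunction T} (hL : L.IsSymmetric)
    (hB : L.PropertyB) : LinkFunction.IsHadamardLSD.{0, v, w} wignerLink L semicircularLaw := by
  haveI := isProbabilityMeasure_semicircularLaw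
  obtain ⟨ρ, hρ⟩ := hL.exists_factorization
  exact hasPairLimits_wignerLink.isHadamardLSD isSymmetric_wignerLink hρ hB
    momentsDetermine_semicircularLaw

/-! ### Lattice points in dilated polytopes -/

/-- The number of integral points in the dilates of a bounded set given by linear inequalities is
asymptotic to a multiple of the corresponding power of the dilation factor. -/
theorem exists_tendsto_card_integral_points {ι J : Type*} [Fintype ι] [Finite J]
    (f : J → (ι → ℝ) →ₗ[ℝ] ℝ) (g : J → (ι → ℤ) → ℤ) (hfg : ∀ j z, f j (fun i => (z i : ℝ)) = g j z)
    (hbdd : ∃ R : ℝ, ∀ x, (∀ j, 0 ≤ f j x ∧ f j x < 1) → ∀ i, |x i| ≤ R) :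
    ∃ p : ℝ, Tendsto (fun n : ℕ => ({z : ι → ℤ | ∀ j, 0 ≤ g j z ∧ g j z < n}.ncard : ℝ) /
      (n : ℝ) ^ Fintype.card ι) atTop (𝓝 p) := by
  set s : Set (ι → ℝ) := {x | ∀ j, 0 ≤ f j x ∧ f j x < 1} with hs
  have hs_eq : s = ⋂ j, (f j) ⁻¹' Set.Ico 0 1 := by
    ext x
    simp [hs]
  have hcont : ∀ j, Continuous (f j) := fun j => (f j).continuous_of_finiteDimensional
  have h1 : Bornology.IsBounded s := by
    obtain ⟨R, hR⟩ := hbdd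
    refine (Metric.isBounded_closedBall (x := (0 : ι → ℝ)) (r := max R 0)).subset fun x hx => ?_
    rw [mem_closedBall_zero_iff, pi_norm_le_iff_of_nonneg (le_max_right _ _)]
    exact fun i => (hR x hx i).trans (le_max_left _ _)
  have h2 : MeasurableSet s := by
    rw [hs_eq]
    exact MeasurableSet.iInter fun j => (hcont j).measurable measurableSet_Ico
  have h3 : Convex ℝ s := by
    rw [hs_eq]
    exact convex_iInter fun j => (convex_Ico 0 1).linear_preimage (f j)
  have h4 : volume (frontier s) = 0 := h3.addHaar_frontier _
  -- By homogeneity, the points `z` to be counted correspond to the points `n⁻¹ z` in `s`. Their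
  -- number is asymptotic to the volume times a power of `n`, as the frontier of a convex set is
  -- null.
  refine ⟨volume.real s, (tendsto_card_div_pow_atTop_volume s h1 h2 h4).congr' ?_⟩
  filter_upwards [eventually_gt_atTop 0] with n hn
  have hn' : (0 : ℝ) < n := by exact_mod_cast hn
  congr 2
  set F : (ι → ℤ) → (ι → ℝ) := fun z => (n : ℝ)⁻¹ • fun i => (z i : ℝ) with hF
  have hFinj : Function.Injective F := by
    intro z z' h
    have := smul_right_injective (ι → ℝ) (inv_ne_zero hn'.ne') h
    funext i
    exact_mod_cast congrFun this i
  have hmem : ∀ z, F z ∈ s ↔ ∀ j, 0 ≤ g j z ∧ g j z < n := by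
    intro z
    refine forall_congr' fun j => ?_
    rw [hF]
    simp only [map_smul, hfg, smul_eq_mul]
    rw [inv_mul_lt_iff₀ hn', mul_one, mul_nonneg_iff_of_pos_left (inv_pos.2 hn')]
    norm_cast
  rw [← Set.ncard_image_of_injective _ hFinj, Nat.card_coe_set_eq]
  congr 1
  ext x
  constructor
  · rintro ⟨hx, y, hy, rfl⟩
    obtain ⟨z, rfl⟩ : ∃ z : ι → ℤ, (fun i => (z i : ℝ)) = y := by
      have := (Module.Basis.mem_span_iff_repr_mem ℤ (Pi.basisFun ℝ ι) y).1 hy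
      choose z hz using this
      exact ⟨z, funext fun i => by simpa using hz i⟩
    exact ⟨z, (hmem z).1 hx, rfl⟩
  · rintro ⟨z, hz, rfl⟩
    refine ⟨(hmem z).2 hz, _, ?_, rfl⟩
    refine (Module.Basis.mem_span_iff_repr_mem ℤ (Pi.basisFun ℝ ι) _).2 fun i => ⟨z i, by simp⟩

/-! ### Partial sums along closed walks -/

section PartialSums

variable {m : ℕ} {R : Type*} [AddCommGroup R]

theorem sum_Iio_add_one (t : Fin (m + 1) → R) {i : Fin (m + 1)} (hi : i ≠ Fin.last m) :
    ∑ j ∈ Finset.Iio (i + 1), t j = ∑ j ∈ Finset.Iio i, t j + t i := by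
  have hlt : i < Fin.last m := lt_of_le_of_ne (Fin.le_last _) hi
  have : Finset.Iio (i + 1) = insert i (Finset.Iio i) := by
    ext j
    simp only [Finset.mem_Iio, Finset.mem_insert, Fin.lt_def, Fin.ext_iff,
      Fin.val_add_one_of_lt hlt]
    omega
  rw [this, Finset.sum_insert (by simp), add_comm]

/-- At the last index `i + 1` wraps around to `0`; there the vanishing of the total sum is used. -/
theorem sum_Iio_add_one_sub (t : Fin (m + 1) → R) (ht : ∑ i, t i = 0) (i : Fin (m + 1)) :
    ∑ j ∈ Finset.Iio (i + 1), t j - ∑ j ∈ Finset.Iio i, t j = t i := by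
  rcases eq_or_ne i (Fin.last m) with rfl | hi
  · have h1 : (Finset.univ : Finset (Fin (m + 1)))
        = insert (Fin.last m) (Finset.Iio (Fin.last m)) := by
      ext j
      simp only [Finset.mem_univ, Finset.mem_insert, Finset.mem_Iio, true_iff]
      exact (Fin.le_last j).eq_or_lt
    rw [h1, Finset.sum_insert (by simp)] at ht
    rw [Fin.last_add_one]
    have h0 : Finset.Iio (0 : Fin (m + 1)) = ∅ := by ext j; simp
    rw [h0, Finset.sum_empty, zero_sub]
    exact (eq_neg_of_add_eq_zero_left ht).symm
  · rw [sum_Iio_add_one t hi, add_sub_cancel_left]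

theorem eq_add_sum_Iio (f : Fin (m + 1) → R) (i : Fin (m + 1)) :
    f i = f 0 + ∑ j ∈ Finset.Iio i, (f (j + 1) - f j) := by
  obtain ⟨i, hi⟩ := i
  induction i with
  | zero =>
    have h0 : Finset.Iio (0 : Fin (m + 1)) = ∅ := by ext j; simp
    change f 0 = f 0 + ∑ j ∈ Finset.Iio 0, (f (j + 1) - f j)
    rw [h0, Finset.sum_empty, add_zero]
  | succ i ih =>
    have hlast : (⟨i, by omega⟩ : Fin (m + 1)) ≠ Fin.last m := by
      rw [Ne, Fin.ext_iff, Fin.val_last]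
      simp only
      omega
    have hadd : (⟨i + 1, hi⟩ : Fin (m + 1)) = ⟨i, by omega⟩ + 1 := by
      ext
      rw [Fin.val_add_one_of_lt (lt_of_le_of_ne (Fin.le_last _) hlast)]
    rw [hadd, sum_Iio_add_one _ hlast, ← add_assoc, ← ih (by omega), add_sub_cancel]

theorem sum_add_one_sub_eq_zero (f : Fin (m + 1) → R) : ∑ j, (f (j + 1) - f j) = 0 := by
  rw [Finset.sum_sub_distrib, sub_eq_zero]
  exact Equiv.sum_comp (Equiv.addRight (1 : Fin (m + 1))) f

end PartialSums

/-! ### Pairings -/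

/-- The other element of the class of `i`. -/
theorem Setoid.IsPairing.exists_partner {E : Type*} {r : Setoid E} (hr : r.IsPairing) :
    ∃ p : E → E, (∀ i, p i ≠ i) ∧ Function.Involutive p ∧ ∀ i j, r i j ↔ j = i ∨ j = p i := by
  have h : ∀ i, ∃ j, j ≠ i ∧ ∀ e, r i e ↔ e = i ∨ e = j := by
    intro i
    obtain ⟨a, b, hab, hs⟩ := Set.ncard_eq_two.1 (hr i)
    have hs' : ∀ e, r i e ↔ e = a ∨ e = b := by
      intro e
      have : e ∈ {e' | Quotient.mk r e' = Quotient.mk r i} ↔ e ∈ ({a, b} : Set E) := by rw [hs]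
      simp only [Set.mem_ofPred_eq, Set.mem_insert_iff, Set.mem_singleton_iff] at this
      rw [← this, eq_comm]
      exact Quotient.eq.symm
    rcases (hs' i).1 (r.refl i) with rfl | rfl
    · exact ⟨b, hab.symm, hs'⟩
    · exact ⟨a, hab, fun e => by rw [hs', or_comm]⟩
  choose p hp1 hp2 using h
  refine ⟨p, hp1, fun i => ?_, hp2⟩
  have h1 : r (p i) i := r.symm ((hp2 i (p i)).2 (Or.inr rfl))
  rcases (hp2 (p i) i).1 h1 with h2 | h2
  · exact absurd h2.symm (hp1 i)
  · exact h2.symm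

/-! ### Toeplitz matrices -/

section Toeplitz

variable {m n : ℕ}

/-- The increment of the closed walk `q` at step `i`. -/
def walkIncrement (q : Fin (m + 1) → Fin n) (i : Fin (m + 1)) : ℤ :=
  (q (i + 1) : ℤ) - (q i : ℤ)

theorem walkLabel_toeplitzLink_eq_iff (q : Fin (m + 1) → Fin n) (i j : Fin (m + 1)) :
    walkLabel (toeplitzLink n) q i = walkLabel (toeplitzLink n) q j ↔
      walkIncrement q i = walkIncrement q j ∨ walkIncrement q i = -walkIncrement q j := by
  rw [walkLabel, walkLabel, toeplitzLink, toeplitzLink, Int.natAbs_eq_natAbs_iff]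
  simp only [walkIncrement]
  omega

theorem abs_walkIncrement_lt (q : Fin (m + 1) → Fin n) (i : Fin (m + 1)) :
    |walkIncrement q i| < n := by
  rw [walkIncrement, abs_lt]
  omega

theorem eq_of_walkIncrement_eq {q q' : Fin (m + 1) → Fin n} (h0 : q 0 = q' 0)
    (h : ∀ i, walkIncrement q i = walkIncrement q' i) : q = q' := by
  funext i
  have h1 := eq_add_sum_Iio (fun i => (q i : ℤ)) i
  have h2 := eq_add_sum_Iio (fun i => (q' i : ℤ)) i
  have h3 : ∑ j ∈ Finset.Iio i, ((q (j + 1) : ℤ) - q j)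
      = ∑ j ∈ Finset.Iio i, ((q' (j + 1) : ℤ) - q' j) := Finset.sum_congr rfl fun j _ => h j
  simp only [h0, h3] at h1 h2
  rw [← h2] at h1
  exact Fin.ext (by exact_mod_cast h1)

theorem isSymmetric_toeplitzLink : toeplitzLink.IsSymmetric := fun n i j => by
  simp only [toeplitzLink]
  omega

theorem propertyB_toeplitzLink : toeplitzLink.PropertyB := by
  classical
  refine ⟨2, fun n k t => ?_⟩
  have hsub : (fun l : Fin n => (l : ℤ)) '' {l : Fin n | toeplitzLink n k l = t}
      ⊆ (({(k : ℤ) + t, (k : ℤ) - t} : Finset ℤ) : Set ℤ) := by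
    rintro _ ⟨l, hl, rfl⟩
    have hl' : ((k : ℤ) - (l : ℤ)).natAbs = t := hl
    simp only [Finset.coe_insert, Finset.coe_singleton, Set.mem_insert_iff, Set.mem_singleton_iff]
    omega
  have hinj : Function.Injective fun l : Fin n => (l : ℤ) := fun a b h => by
    simpa [Fin.ext_iff] using h
  rw [← Set.ncard_image_of_injective _ hinj]
  refine (Set.ncard_le_ncard hsub (Finset.finite_toSet _)).trans ?_
  rw [Set.ncard_coe_finset]
  exact Finset.card_le_two

/-- The closed walks with opposite increments at paired positions. -/
def oppositeWalks (p : Fin (m + 1) → Fin (m + 1)) (n : ℕ) : Set (Fin (m + 1) → Fin n) :=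
  {q | ∀ i, walkIncrement q (p i) = -walkIncrement q i}

theorem card_quotient {r : Setoid (Fin (m + 1))} (hr : r.IsPairing) {k : ℕ} (hk : m + 1 = 2 * k)
    [Fintype (Quotient r)] : Fintype.card (Quotient r) = k := by
  classical
  have h1 := LinkFunction.card_image_mk hr
  rw [Finset.image_univ_of_surjective Quotient.mk_surjective, Finset.card_univ] at h1
  omega

/-- Walks with opposite increments rarely have additional coincidences of labels. -/
theorem ncard_oppositeWalks_diff_le {r : Setoid (Fin (m + 1))} (hr : r.IsPairing) {k : ℕ}
    (hk : m + 1 = 2 * k) {p : Fin (m + 1) → Fin (m + 1)} (hp : ∀ i j, r i j ↔ j = i ∨ j = p i) :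
    ∃ C : ℕ, ∀ n, (oppositeWalks p n \ toeplitzLink.walksWithPattern r n).ncard ≤ C * n ^ k := by
  classical
  obtain ⟨Δ, hΔ0, hΔ⟩ := exists_pos_propertyB propertyB_toeplitzLink
  refine ⟨(m + 1) ^ (m + 1) * Δ ^ (m + 1), fun n => ?_⟩
  have hk0 : 1 + (k - 1) = k := by omega
  rw [Set.ncard_eq_toFinset_card', mul_assoc]
  have := card_walks_few_labels hΔ0 (hΔ n) (k - 1)
    (oppositeWalks p n \ toeplitzLink.walksWithPattern r n).toFinset ?_
  · rwa [hk0] at this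
  intro q hq
  rw [Set.mem_toFinset] at hq
  obtain ⟨hq1, hq2⟩ := hq
  have hfac : ∀ i j, r i j → walkLabel (toeplitzLink n) q i = walkLabel (toeplitzLink n) q j := by
    intro i j hij
    rw [walkLabel_toeplitzLink_eq_iff]
    rcases (hp i j).1 hij with rfl | rfl
    · exact Or.inl rfl
    · right
      rw [hq1 i, neg_neg]
  set g : Quotient r → ℕ := Quotient.lift (walkLabel (toeplitzLink n) q) hfac with hg
  have himg : Finset.univ.image (walkLabel (toeplitzLink n) q) = Finset.univ.image g := by
    ext a
    simp only [Finset.mem_image, Finset.mem_univ, true_and]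
    constructor
    · rintro ⟨i, rfl⟩
      exact ⟨Quotient.mk r i, rfl⟩
    · rintro ⟨c, rfl⟩
      obtain ⟨i, rfl⟩ := Quotient.mk_surjective c
      exact ⟨i, rfl⟩
  -- A further coincidence identifies two classes of `r`. Then at most `k - 1` labels are left, and
  -- such walks number `O(n ^ k)`.
  have hninj : ¬ Function.Injective g := by
    intro hinj
    refine hq2 (Setoid.ext fun i j => ⟨fun h => ?_, hfac i j⟩)
    exact Quotient.eq.1 (hinj (a₁ := Quotient.mk r i) (a₂ := Quotient.mk r j) h)
  have hlt : (Finset.univ.image g).card < Fintype.card (Quotient r) := by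
    refine lt_of_le_of_ne (Finset.card_image_le.trans_eq Finset.card_univ) fun h => hninj ?_
    rw [← Finset.card_univ] at h
    simpa [Set.injOn_univ] using Finset.card_image_iff.1 h
  rw [card_quotient hr hk] at hlt
  rw [himg]
  omega

/-- Walks with the given pattern and the same increments at two paired positions are rare. -/
theorem ncard_diff_oppositeWalks_le {r : Setoid (Fin (m + 1))} (hr : r.IsPairing) {k : ℕ}
    (hk : m + 1 = 2 * k) {p : Fin (m + 1) → Fin (m + 1)} (hp1 : ∀ i, p i ≠ i)
    (hp : ∀ i j, r i j ↔ j = i ∨ j = p i) :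
    ∃ C : ℕ, ∀ n, (toeplitzLink.walksWithPattern r n \ oppositeWalks p n).ncard ≤ C * n ^ k := by
  classical
  -- The first factor counts the choices of an offending position and of the signs of the increments
  -- relative to their representatives. For each choice, `q 0` and the increments of the `k - 1`
  -- other classes, at most `3 * n` values each, determine the walk.
  refine ⟨Fintype.card (Fin (m + 1) × (Fin (m + 1) → ℤˣ)) * 3 ^ (k - 1), fun n => ?_⟩
  set rep : Fin (m + 1) → Fin (m + 1) := fun i => (Quotient.mk r i).out with hrep
  have hrep1 : ∀ i, r i (rep i) := fun i => r.symm (Quotient.mk_out i)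
  set Z : Fin (m + 1) × (Fin (m + 1) → ℤˣ) → Finset (Fin (m + 1) → Fin n) := fun a =>
    Finset.univ.filter fun q => walkIncrement q (p a.1) = walkIncrement q a.1 ∧
      ∀ i, walkIncrement q i = a.2 i * walkIncrement q (rep i) with hZ
  have hsub : (toeplitzLink.walksWithPattern r n \ oppositeWalks p n).toFinset
      ⊆ Finset.univ.biUnion Z := by
    intro q hq
    rw [Set.mem_toFinset] at hq
    obtain ⟨hq1, hq2⟩ := hq
    have hlab : ∀ i j, r i j → walkIncrement q i = walkIncrement q j ∨
        walkIncrement q i = -walkIncrement q j := by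
      intro i j hij
      rw [← walkLabel_toeplitzLink_eq_iff]
      have hq1' : Setoid.ker (walkLabel (toeplitzLink n) q) = r := hq1
      rw [← hq1'] at hij
      exact hij
    have hex : ∃ i, walkIncrement q (p i) ≠ -walkIncrement q i := by
      by_contra h
      push Not at h
      exact hq2 h
    obtain ⟨i₀, hi₀⟩ := hex
    have hε : ∀ i, ∃ ε : ℤˣ, walkIncrement q i = ε * walkIncrement q (rep i) := by
      intro i
      rcases hlab i (rep i) (hrep1 i) with h | h
      · exact ⟨1, by simpa using h⟩
      · exact ⟨-1, by simpa using h⟩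
    choose ε hε using hε
    refine Finset.mem_biUnion.2 ⟨(i₀, ε), Finset.mem_univ _, Finset.mem_filter.2
      ⟨Finset.mem_univ _, ?_, hε⟩⟩
    exact (hlab (p i₀) i₀ (r.symm ((hp i₀ _).2 (Or.inr rfl)))).resolve_right hi₀
  have hcard : ∀ a ∈ Finset.univ, (Z a).card ≤ 3 ^ (k - 1) * n ^ k := by
    rintro ⟨i₀, ε⟩ -
    set Φ : Z (i₀, ε) → Fin n × ({c : Quotient r // c ≠ Quotient.mk r i₀} →
        Finset.Ioo (-(n : ℤ)) n) := fun q => (q.1 0, fun c => ⟨walkIncrement q.1 c.1.out, by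
          rw [Finset.mem_Ioo, ← abs_lt]
          exact abs_walkIncrement_lt _ _⟩) with hΦ
    have hinj : Function.Injective Φ := by
      rintro ⟨q, hq⟩ ⟨q', hq'⟩ h
      obtain ⟨hq1, hq2⟩ := (Finset.mem_filter.1 hq).2
      obtain ⟨hq1', hq2'⟩ := (Finset.mem_filter.1 hq').2
      have h0 : q 0 = q' 0 := (Prod.mk.inj h).1
      have hc : ∀ c : Quotient r, c ≠ Quotient.mk r i₀ →
          walkIncrement q c.out = walkIncrement q' c.out := fun c hc =>
        congrArg Subtype.val (congrFun (Prod.mk.inj h).2 ⟨c, hc⟩)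
      have hoff : ∀ i, i ≠ i₀ → i ≠ p i₀ → walkIncrement q i = walkIncrement q' i := by
        intro i hi hi'
        rw [hq2 i, hq2' i]
        congr 1
        refine hc _ fun heq => ?_
        rcases (hp i₀ i).1 (r.symm (Quotient.eq.1 heq)) with h | h
        · exact hi h
        · exact hi' h
      -- The increments of a closed walk sum to zero. Those at `i₀` and `p i₀` are equal, so twice
      -- their value is determined by the others.
      have hsum : ∑ i, (walkIncrement q i - walkIncrement q' i) = 0 := by
        rw [Finset.sum_sub_distrib]
        have h1 := sum_add_one_sub_eq_zero fun i => (q i : ℤ)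
        have h2 := sum_add_one_sub_eq_zero fun i => (q' i : ℤ)
        simp only [walkIncrement]
        rw [h1, h2, sub_zero]
      have hpair : ∑ i, (walkIncrement q i - walkIncrement q' i)
          = ∑ i ∈ {i₀, p i₀}, (walkIncrement q i - walkIncrement q' i) := by
        symm
        refine Finset.sum_subset (Finset.subset_univ _) fun i _ hi => ?_
        simp only [Finset.mem_insert, Finset.mem_singleton, not_or] at hi
        rw [hoff i hi.1 hi.2, sub_self]
      rw [hpair, Finset.sum_pair (hp1 i₀).symm] at hsum
      simp only at hq1 hq1'
      refine Subtype.ext (eq_of_walkIncrement_eq h0 fun i => ?_)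
      change walkIncrement q i = walkIncrement q' i
      by_cases hi : i = i₀
      · subst hi; omega
      by_cases hi' : i = p i₀
      · subst hi'; omega
      exact hoff i hi hi'
    have h1 := Fintype.card_le_of_injective Φ hinj
    rw [Fintype.card_coe, Fintype.card_prod, Fintype.card_fun, Fintype.card_fin, Fintype.card_coe,
      Int.card_Ioo, Fintype.card_subtype_compl, Fintype.card_subtype_eq, card_quotient hr hk] at h1
    refine h1.trans ?_
    have h2 : ((n : ℤ) - -(n : ℤ) - 1).toNat ≤ 3 * n := by omega
    have hk0 : k = (k - 1) + 1 := by omega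
    calc n * ((n : ℤ) - -(n : ℤ) - 1).toNat ^ (k - 1) ≤ n * (3 * n) ^ (k - 1) :=
          Nat.mul_le_mul_left _ (Nat.pow_le_pow_left h2 _)
      _ = 3 ^ (k - 1) * n ^ ((k - 1) + 1) := by ring
      _ = 3 ^ (k - 1) * n ^ k := by rw [← hk0]
  rw [Set.ncard_eq_toFinset_card']
  refine (Finset.card_le_card hsub).trans (Finset.card_biUnion_le.trans
    ((Finset.sum_le_card_nsmul _ _ _ hcard).trans (le_of_eq ?_)))
  rw [Finset.card_univ, smul_eq_mul, mul_assoc]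

/-- Opposite increments cancel in pairs, so closing imposes no condition. The free parameters are
the start and the `k` increments at representatives. The vertices are integral linear forms in these
`k + 1` parameters, and the constraint that they lie in `[0, n)` describes a dilated polytope. -/
theorem exists_tendsto_ncard_oppositeWalks {r : Setoid (Fin (m + 1))} (hr : r.IsPairing) {k : ℕ}
    (hk : m + 1 = 2 * k) {p : Fin (m + 1) → Fin (m + 1)} (hp1 : ∀ i, p i ≠ i)
    (hp2 : Function.Involutive p) (hp : ∀ i j, r i j ↔ j = i ∨ j = p i) :
    ∃ b : ℝ, Tendsto (fun n : ℕ => ((oppositeWalks p n).ncard : ℝ) / (n : ℝ) ^ (k + 1)) atTop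
      (𝓝 b) := by
  classical
  set rep : Fin (m + 1) → Fin (m + 1) := fun i => (Quotient.mk r i).out with hrep
  have hrep1 : ∀ i, rep i = i ∨ rep i = p i := fun i =>
    (hp i (rep i)).1 (r.symm (Quotient.mk_out i))
  have hmk : ∀ i, Quotient.mk r (p i) = Quotient.mk r i := fun i =>
    Quotient.eq.2 (r.symm ((hp i _).2 (Or.inr rfl)))
  have hrepp : ∀ i, rep (p i) = rep i := fun i => by simp only [hrep, hmk]
  -- The sign is `1` at the representative of a pair and `-1` at its partner.
  set σ : Fin (m + 1) → ℤ := fun i => if rep i = i then 1 else -1 with hσ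
  have hσp : ∀ i, σ (p i) = -σ i := by
    intro i
    simp only [hσ, hrepp]
    rcases hrep1 i with h | h
    · rw [h, if_neg (hp1 i).symm, if_pos rfl]
    · rw [h, if_pos rfl, if_neg (hp1 i), neg_neg]
  have hout : ∀ c : Quotient r, rep c.out = c.out := fun c => by simp [hrep]
  have hσout : ∀ c : Quotient r, σ c.out = 1 := fun c => by simp [hσ, hout]
  -- the increments and the positions, as functions of the parameters
  set t : (Option (Quotient r) → ℤ) → Fin (m + 1) → ℤ :=
    fun z i => σ i * z (some (Quotient.mk r i)) with ht
  have htp : ∀ z i, t z (p i) = -t z i := fun z i => by simp only [ht, hσp, hmk]; ring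
  have htsum : ∀ z, ∑ i, t z i = 0 := by
    intro z
    have h1 : ∑ i, t z i = ∑ i, t z (p i) := (Equiv.sum_comp hp2.toPerm (t z)).symm
    simp_rw [htp, Finset.sum_neg_distrib] at h1
    omega
  set g : Fin (m + 1) → (Option (Quotient r) → ℤ) → ℤ :=
    fun i z => z none + ∑ j ∈ Finset.Iio i, t z j with hg
  have hg0 : ∀ z, g 0 z = z none := by
    intro z
    have h0 : Finset.Iio (0 : Fin (m + 1)) = ∅ := by ext j; simp
    simp only [hg, h0, Finset.sum_empty, add_zero]
  have hginc : ∀ z i, g (i + 1) z - g i z = t z i := by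
    intro z i
    simp only [hg]
    rw [add_sub_add_left_eq_sub, sum_Iio_add_one_sub _ (htsum z)]
  set f : Fin (m + 1) → (Option (Quotient r) → ℝ) →ₗ[ℝ] ℝ := fun i =>
    LinearMap.proj none + ∑ j ∈ Finset.Iio i,
      (σ j : ℝ) • LinearMap.proj (R := ℝ) (some (Quotient.mk r j)) with hf
  have hfx : ∀ i x, f i x = x none + ∑ j ∈ Finset.Iio i,
      (σ j : ℝ) * x (some (Quotient.mk r j)) := by
    intro i x
    simp [hf, LinearMap.sum_apply]
  have hfg : ∀ i z, f i (fun c => (z c : ℝ)) = g i z := by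
    intro i z
    rw [hfx]
    simp only [hg, ht]
    push_cast
    rfl
  have hbdd : ∃ R : ℝ, ∀ x, (∀ i, 0 ≤ f i x ∧ f i x < 1) → ∀ c, |x c| ≤ R := by
    -- The coordinate `none` is the value of `f 0`, and each other coordinate is a difference of two
    -- values `f (i + 1) x` and `f i x` in `[0, 1)`.
    refine ⟨1, fun x hx c => ?_⟩
    have hsumx : ∑ j, (σ j : ℝ) * x (some (Quotient.mk r j)) = 0 := by
      have h1 : ∑ j, (σ j : ℝ) * x (some (Quotient.mk r j))
          = ∑ j, (σ (p j) : ℝ) * x (some (Quotient.mk r (p j))) :=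
        (Equiv.sum_comp hp2.toPerm fun j => (σ j : ℝ) * x (some (Quotient.mk r j))).symm
      simp_rw [hσp, hmk] at h1
      push_cast at h1
      simp_rw [neg_mul, Finset.sum_neg_distrib] at h1
      linarith
    rcases c with _ | c
    · have h0 := hx 0
      have h0' : Finset.Iio (0 : Fin (m + 1)) = ∅ := by ext j; simp
      rw [hfx, h0', Finset.sum_empty, add_zero] at h0
      rw [abs_le]
      constructor <;> linarith
    · have h1 := hx (c.out + 1)
      have h2 := hx c.out
      rw [hfx] at h1 h2
      have h3 := sum_Iio_add_one_sub (fun j => (σ j : ℝ) * x (some (Quotient.mk r j))) hsumx c.out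
      simp only [hσout, Quotient.out_eq, Int.cast_one, one_mul] at h3
      rw [abs_le]
      constructor <;> linarith
  obtain ⟨b, hb⟩ := exists_tendsto_card_integral_points f g hfg hbdd
  rw [Fintype.card_option, card_quotient hr hk] at hb
  refine ⟨b, hb.congr fun n => ?_⟩
  congr 2
  refine Set.ncard_congr (fun z hz i => ⟨(g i z).toNat, by have := hz i; omega⟩) ?_ ?_ ?_
  · intro z hz
    have hinc : ∀ i, walkIncrement (fun i => (⟨(g i z).toNat, by have := hz i; omega⟩ : Fin n)) i
        = t z i := by
      intro i
      rw [← hginc]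
      have h1 := hz i
      have h2 := hz (i + 1)
      simp only [walkIncrement]
      omega
    intro i
    rw [hinc, hinc, htp]
  · intro z z' hz hz' h
    have h1 : ∀ i, g i z = g i z' := by
      intro i
      have := congrFun h i
      simp only [Fin.mk.injEq] at this
      have h2 := hz i
      have h3 := hz' i
      omega
    funext c
    rcases c with _ | c
    · rw [← hg0 z, ← hg0 z', h1]
    · have h2 := hginc z c.out
      rw [h1, h1, hginc] at h2
      simpa [ht, hσout] using h2.symm
  · intro q hq
    set z : Option (Quotient r) → ℤ := fun c => c.elim (q 0 : ℤ) fun c => walkIncrement q c.out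
      with hz
    have htz : ∀ i, t z i = walkIncrement q i := by
      intro i
      change σ i * walkIncrement q (rep i) = walkIncrement q i
      rcases hrep1 i with h | h
      · rw [h]
        simp [hσ, h]
      · rw [h, hq i]
        simp [hσ, h, hp1 i]
    have hgz : ∀ i, g i z = q i := by
      intro i
      rw [eq_add_sum_Iio (fun i => (q i : ℤ)) i]
      simp only [hg, htz]
      rfl
    refine ⟨z, fun i => ?_, ?_⟩
    · rw [hgz]
      omega
    · funext i
      ext
      simp only [hgz]
      simp

/-- The walks with pattern `r` and the walks with opposite increments differ by `O(n ^ k)` in both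
directions, which is negligible against `n ^ (k + 1)`. -/
theorem exists_tendsto_ncard_walksWithPattern {r : Setoid (Fin (m + 1))} (hr : r.IsPairing) {k : ℕ}
    (hk : m + 1 = 2 * k) : ∃ b : ℝ, Tendsto (fun n : ℕ =>
      ((toeplitzLink.walksWithPattern r n).ncard : ℝ) / (n : ℝ) ^ (k + 1)) atTop (𝓝 b) := by
  obtain ⟨p, hp1, hp2, hp⟩ := hr.exists_partner
  obtain ⟨b, hb⟩ := exists_tendsto_ncard_oppositeWalks hr hk hp1 hp2 hp
  obtain ⟨C₁, hC₁⟩ := ncard_oppositeWalks_diff_le hr hk hp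
  obtain ⟨C₂, hC₂⟩ := ncard_diff_oppositeWalks_le hr hk hp1 hp
  refine ⟨b, ?_⟩
  have hlow := hb.sub (tendsto_const_div_atTop_nhds_zero_nat (C₁ : ℝ))
  have hup := hb.add (tendsto_const_div_atTop_nhds_zero_nat (C₂ : ℝ))
  rw [sub_zero] at hlow
  rw [add_zero] at hup
  have hdiv : ∀ (C : ℕ) {n : ℕ}, 0 < n → (C : ℝ) / n = (C * n ^ k : ℕ) / (n : ℝ) ^ (k + 1) := by
    intro C n hn
    have hn' : (0 : ℝ) < n := by exact_mod_cast hn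
    push_cast
    field_simp
    ring
  refine tendsto_of_tendsto_of_tendsto_of_le_of_le' hlow hup ?_ ?_
  · filter_upwards [eventually_gt_atTop 0] with n hn
    rw [hdiv C₁ hn, ← sub_div]
    gcongr
    have h1 := Set.ncard_le_ncard_sdiff_add_ncard (oppositeWalks p n)
      (toeplitzLink.walksWithPattern r n)
    have h2 := hC₁ n
    have h3 : (oppositeWalks p n).ncard
        ≤ C₁ * n ^ k + (toeplitzLink.walksWithPattern r n).ncard := by omega
    rw [sub_le_iff_le_add']
    exact_mod_cast h3
  · filter_upwards [eventually_gt_atTop 0] with n hn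
    rw [hdiv C₂ hn, ← add_div]
    gcongr
    have h1 := Set.ncard_le_ncard_sdiff_add_ncard (toeplitzLink.walksWithPattern r n)
      (oppositeWalks p n)
    have h2 := hC₂ n
    have h3 : (toeplitzLink.walksWithPattern r n).ncard
        ≤ (oppositeWalks p n).ncard + C₂ * n ^ k := by omega
    exact_mod_cast h3

theorem exists_hasPairLimits_toeplitzLink : ∃ β, toeplitzLink.HasPairLimits β :=
  LinkFunction.exists_hasPairLimits fun _ _ hk _ hr => exists_tendsto_ncard_walksWithPattern hr hk

/-! ### The symmetric circulant link function -/

theorem propertyB_symmetricCirculantLink : symmetricCirculantLink.PropertyB := by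
  classical
  refine ⟨4, fun n k t => ?_⟩
  have hsub : (fun l : Fin n => (l : ℤ)) '' {l : Fin n | symmetricCirculantLink n k l = t}
      ⊆ (({(k : ℤ) + t, (k : ℤ) - t, (k : ℤ) + n - t, (k : ℤ) - n + t} : Finset ℤ) : Set ℤ) := by
    rintro _ ⟨l, hl, rfl⟩
    have hl' : min ((k : ℤ) - (l : ℤ)).natAbs (n - ((k : ℤ) - (l : ℤ)).natAbs) = t := hl
    simp only [Finset.coe_insert, Finset.coe_singleton, Set.mem_insert_iff, Set.mem_singleton_iff]
    omega
  have hinj : Function.Injective fun l : Fin n => (l : ℤ) := fun a b h => by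
    simpa [Fin.ext_iff] using h
  rw [← Set.ncard_image_of_injective _ hinj]
  refine (Set.ncard_le_ncard hsub (Finset.finite_toSet _)).trans ?_
  rw [Set.ncard_coe_finset]
  exact Finset.card_le_four

end Toeplitz

/-! ### The main theorem -/

/-- Invariance theorem for Schur-Hadamard products, with its consequences for Wigner and Toeplitz
matrices. -/
theorem mainTheorem2 :
    (∀ (S : Type u) (LX : LinkFunction S),
      LX.IsSymmetric → LX.PropertyB → LX.GrowthConditions → LX.WordLimitsExist →
      ∃ μ : Measure ℝ, IsProbabilityMeasure μ ∧ LinkFunction.IsLSD.{u, w} LX μ ∧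
        ∀ (T : Type v) (LY : LinkFunction T) (ρ : ℕ → S → T),
          (∀ (n : ℕ) (i j : Fin n), LY n i j = ρ n (LX n i j)) →
          LY.PropertyB → LY.GrowthConditions →
          LinkFunction.IsHadamardLSD.{u, v, w} LX LY μ) ∧
    (IsProbabilityMeasure semicircularLaw ∧
      LinkFunction.IsLSD.{0, w} wignerLink semicircularLaw ∧
      ∀ (T : Type v) (LY : LinkFunction T),
        LY.IsSymmetric → LY.PropertyB → LY.GrowthConditions →
        LinkFunction.IsHadamardLSD.{0, v, w} wignerLink LY semicircularLaw) ∧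
    (∃ μT : Measure ℝ, IsProbabilityMeasure μT ∧ LinkFunction.IsLSD.{0, w} toeplitzLink μT ∧
      LinkFunction.IsHadamardLSD.{0, 0, w} toeplitzLink symmetricCirculantLink μT) := by
  refine ⟨fun S LX hX hB _ hW => ?_, ⟨isProbabilityMeasure_semicircularLaw, isLSD_wignerLink,
    fun T LY hY hB _ => isHadamardLSD_wignerLink hY hB⟩, ?_⟩
  · obtain ⟨β, hβ⟩ := hW.exists_hasPairLimits
    obtain ⟨μ, hμ, hdet⟩ := hβ.exists_momentsDetermine hX hB
    exact ⟨μ, hμ, hβ.isLSD hX hB hdet, fun T LY ρ hρ hBY _ => hβ.isHadamardLSD hX hρ hBY hdet⟩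
  · obtain ⟨β, hβ⟩ := exists_hasPairLimits_toeplitzLink
    obtain ⟨μ, hμ, hdet⟩ :=
      hβ.exists_momentsDetermine isSymmetric_toeplitzLink propertyB_toeplitzLink
    exact ⟨μ, hμ, hβ.isLSD isSymmetric_toeplitzLink propertyB_toeplitzLink hdet,
      -- The symmetric circulant label is a function of `d = |i - j|` that depends on `n`.
      hβ.isHadamardLSD (ρ := fun n d => min d (n - d)) isSymmetric_toeplitzLink
        (fun _ _ _ => rfl) propertyB_symmetricCirculantLink hdet⟩
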